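/- Let $d\ge 1$ and let $\Omega^*=\begin{pmatrix}1&\delta^\top\\ \delta&\bar\Omega\end{pmatrix}$ be a full-rank $(d+1)\times(d+1)$ correlation matrix, $\delta\in\mathbb{R}^d$. Let $U^*=(U_0,U)$, with $U_0$ scalar and $U$ $d$-dimensional, have the elliptical density $c_{d+1}|\Omega^*|^{-1/2}\tilde f\{u^\top(\Omega^*)^{-1}u\}$ on $\mathbb{R}^{d+1}$, where $\tilde f:[0,\infty)\to[0,\infty)$ is the density generator and $c_{d+1}$ the normalising constant. Let $Z=(U\mid U_0>0)$, let $f_U$ be the density of $U$, and put $\alpha=(1-\delta^\top\bar\Omega^{-1}\delta)^{-1/2}\,\bar\Omega^{-1}\delta$ and $Q_z=z^\top\bar\Omega^{-1}z$. For $q\ge 0$ let $F^{q}(y)=\int_{-\infty}^{y}\tilde f(q+x^2)\,dx\big/\int_{-\infty}^{\infty}\tilde f(q+x^2)\,dx$ be the distribution function of the conditional generator, so that $Z$ has density $2f_U(z)F^{Q_z}(\alpha^\top z)$. Then: (i) Suppose $d\ge 2$ and $\delta\ne 0$ (equivalently $\alpha\neq 0$). The density of $Z$ can be written as $2f_U(z)F\{w(z)\}$,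 with $F$ a (fixed) distribution function on $\mathbb{R}$, $w(z)=h(\alpha^\top z,Q_z)$ for some function $h$, and $w(z)=\alpha^\top z$ for all $z$, if and only if $U^*$ is Gaussian. (ii) For every $d\ge1$ and every $\delta$, the conditional distribution function $F^{Q_z}$ does not depend on $Q_z$ (that is, there is one distribution function $F$ on $\mathbb{R}$ with $F^{Q_z}(y)=F(y)$ for all $y\in\mathbb{R}$, for almost every $z$ with $f_U(z)\ne0$) if and only if $U^*$ is Gaussian. (iii) For every $d\ge1$ and every $\delta$, the following are equivalent: $U^*$ is Gaussian; $Z\sim\mathrm{SN}_d(0,\sigma^2\bar\Omega,\alpha)$ for some $\sigma>0$; $Z$ is skew normal, that is, $Z\sim\mathrm{SN}_d(\xi,\Omega,\alpha')$ for some $\xi,\alpha'\in\mathbb{R}^d$ and some full-rank covariance matrix $\Omega$. Here $\mathrm{SN}_d(\xi,\Omega,\alpha)$ is the law with density $2\,\phi_d(z-\xi;\Omega)\,\Phi(\alpha^\top\omega^{-1}(z-\xi))$, where $\phi_d(\cdot\,;\Omega)$ is the $\mathrm{N}_d(0,\Omega)$ density, $\Phi$ the standard normal distribution function, and $\omega$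 the diagonal matrix of the square roots of the diagonal entries of $\Omega$. -/

import Mathlib

open MeasureTheory ProbabilityTheory
open scoped Matrix

noncomputable section

/-- The quadratic form `xᵀ A⁻¹ x`. -/
def invQuadForm {ι : Type*} [Fintype ι] [DecidableEq ι] (A : Matrix ι ι ℝ)
    (x : EuclideanSpace ℝ ι) : ℝ :=
  x.ofLp ⬝ᵥ (A⁻¹ *ᵥ x.ofLp)

/-- The normalising constant `c` of a density generator `f` on `ℝ^ι`, i.e. the inverse of
`∫ f (‖x‖²) dx`. -/
def ellipticalConst (ι : Type*) [Fintype ι] (f : ℝ → ℝ) : ℝ :=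
  (∫ x : EuclideanSpace ℝ ι, f (‖x‖ ^ 2))⁻¹

/-- The elliptical density `c |A|^{-1/2} f ((y - ξ)ᵀ A⁻¹ (y - ξ))`. -/
def ellipticalDensity {ι : Type*} [Fintype ι] [DecidableEq ι] (ξ : EuclideanSpace ℝ ι)
    (A : Matrix ι ι ℝ) (f : ℝ → ℝ) (y : EuclideanSpace ℝ ι) : ℝ :=
  ellipticalConst ι f / √A.det * f (invQuadForm A (y - ξ))

/-- `Y ∼ Ell(ξ, A, f)` under `P`: the matrix `A` is symmetric positive definite, the density
generator `f` is a nonnegative measurable function on `[0, ∞)` (its values at negative arguments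
play no role), and `Y` has the elliptical density.  Under a probability measure this forces
`x ↦ f (‖x‖²)` to be integrable with positive integral: otherwise `ellipticalConst` is `0`. -/
structure IsElliptical {S : Type*} [MeasurableSpace S] (P : Measure S) {ι : Type*} [Fintype ι]
    [DecidableEq ι] (Y : S → EuclideanSpace ℝ ι) (ξ : EuclideanSpace ℝ ι) (A : Matrix ι ι ℝ)
    (f : ℝ → ℝ) : Prop where
  posDef : A.PosDef
  measurable_generator : Measurable f
  generator_nonneg : ∀ t, 0 ≤ t → 0 ≤ f t
  aemeasurable : AEMeasurable Y P
  law : P.map Y = volume.withDensity (fun y => ENNReal.ofReal (ellipticalDensity ξ A f y))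

/-- A full-rank correlation matrix. -/
def IsFullRankCorrelation {ι : Type*} (A : Matrix ι ι ℝ) : Prop :=
  A.PosDef ∧ ∀ i, A i i = 1

/-- The block matrix `Ω* = [[1, δᵀ], [δ, Ω̄]]`. -/
def starMatrix {d : ℕ} (δ : Fin d → ℝ) (Ωbar : Matrix (Fin d) (Fin d) ℝ) :
    Matrix (Unit ⊕ Fin d) (Unit ⊕ Fin d) ℝ :=
  Matrix.fromBlocks 1 (Matrix.replicateRow Unit δ) (Matrix.replicateCol Unit δ) Ωbar

/-- The point `(u₀, u)` of `ℝ^(1 + d)`. -/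
def joinVec {d : ℕ} (u₀ : ℝ) (u : EuclideanSpace ℝ (Fin d)) :
    EuclideanSpace ℝ (Unit ⊕ Fin d) :=
  WithLp.toLp 2 (Sum.elim (fun _ => u₀) u.ofLp)

/-- The `d`-dimensional component `u` of `(u₀, u)`. -/
def vecPart {d : ℕ} (x : EuclideanSpace ℝ (Unit ⊕ Fin d)) : EuclideanSpace ℝ (Fin d) :=
  WithLp.toLp 2 (fun i => x.ofLp (Sum.inr i))

/-- The shape parameter `α = (1 - δᵀ Ω̄⁻¹ δ)^{-1/2} Ω̄⁻¹ δ`. -/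
def shapeParam {d : ℕ} (δ : Fin d → ℝ) (Ωbar : Matrix (Fin d) (Fin d) ℝ) : Fin d → ℝ :=
  (1 / √(1 - δ ⬝ᵥ (Ωbar⁻¹ *ᵥ δ))) • (Ωbar⁻¹ *ᵥ δ)

/-- The density `f_U` of the component `U` of `U* = (U₀, U) ∼ Ell(0, Ω*, f)`, i.e. the joint
density integrated over `u₀`. -/
def marginalDensity {d : ℕ} (δ : Fin d → ℝ) (Ωbar : Matrix (Fin d) (Fin d) ℝ) (f : ℝ → ℝ)
    (z : EuclideanSpace ℝ (Fin d)) : ℝ :=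
  ∫ u₀ : ℝ, ellipticalDensity 0 (starMatrix δ Ωbar) f (joinVec u₀ z)

/-- The conditional density generator `f^q (x) = f (q + x)`.  Given `U = z`, the standardised
variable `(U₀ - δᵀ Ω̄⁻¹ z) / (1 - δᵀ Ω̄⁻¹ δ)^{1/2}` has density `c₁ f^q (y²)` with
`q = zᵀ Ω̄⁻¹ z`. -/
def condGenerator (f : ℝ → ℝ) (q x : ℝ) : ℝ := f (q + x)

/-- The distribution function `F^q` of the conditional density generator `f^q`:
`F^q (y) = ∫_{-∞}^y c₁ f^q (x²) dx`, where `1 / c₁` is the integral of `f^q (x²)` over `ℝ`. -/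
def condDistFun (f : ℝ → ℝ) (q y : ℝ) : ℝ :=
  (∫ x in Set.Iic y, condGenerator f q (x ^ 2)) / ∫ x : ℝ, condGenerator f q (x ^ 2)

/-- The law of `Z = (U | U₀ > 0)`. -/
def skewLaw {S : Type*} [MeasurableSpace S] (P : Measure S) {d : ℕ}
    (Ustar : S → EuclideanSpace ℝ (Unit ⊕ Fin d)) : Measure (EuclideanSpace ℝ (Fin d)) :=
  (ProbabilityTheory.cond P {s | 0 < (Ustar s).ofLp (Sum.inl ())}).map
    (fun s => vecPart (Ustar s))

/-- `Z = (U | U₀ > 0)` has density `2 f_U(z) F(w(z))`, where `F` is the distribution function of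
the probability measure `ν` on `ℝ`, and `w(z) = h (αᵀ z, zᵀ Ω̄⁻¹ z)` for some function `h`. -/
def IsSkewingRepresentation {S : Type*} [MeasurableSpace S] (P : Measure S) {d : ℕ}
    (Ustar : S → EuclideanSpace ℝ (Unit ⊕ Fin d)) (δ : Fin d → ℝ)
    (Ωbar : Matrix (Fin d) (Fin d) ℝ) (f : ℝ → ℝ) (ν : Measure ℝ)
    (w : EuclideanSpace ℝ (Fin d) → ℝ) : Prop :=
  IsProbabilityMeasure ν ∧
  (∃ h : ℝ → ℝ → ℝ, ∀ z, w z = h (shapeParam δ Ωbar ⬝ᵥ z.ofLp) (invQuadForm Ωbar z)) ∧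
  skewLaw P Ustar =
    volume.withDensity (fun z => ENNReal.ofReal (2 * marginalDensity δ Ωbar f z * cdf ν (w z)))

/-- The density of `N_d(0, A)` at `x`. -/
def normalDensity {d : ℕ} (A : Matrix (Fin d) (Fin d) ℝ) (x : EuclideanSpace ℝ (Fin d)) : ℝ :=
  (2 * Real.pi) ^ (-(d : ℝ) / 2) / √A.det * Real.exp (-(invQuadForm A x) / 2)

/-- The skew normal density `2 φ_d(z - ξ; A) Φ(αᵀ ω⁻¹ (z - ξ))`, where `ω` is the diagonal matrix
of the square roots of the diagonal entries of `A`. -/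
def skewNormalDensity {d : ℕ} (ξ : EuclideanSpace ℝ (Fin d)) (A : Matrix (Fin d) (Fin d) ℝ)
    (α : Fin d → ℝ) (z : EuclideanSpace ℝ (Fin d)) : ℝ :=
  2 * normalDensity A (z - ξ) *
    cdf (gaussianReal 0 1) (∑ i, α i * ((z - ξ).ofLp i / √(A i i)))

/-- `μ` is the skew normal law `SN_d(ξ, A, α)`. -/
def IsSkewNormal {d : ℕ} (μ : Measure (EuclideanSpace ℝ (Fin d))) (ξ : EuclideanSpace ℝ (Fin d))
    (A : Matrix (Fin d) (Fin d) ℝ) (α : Fin d → ℝ) : Prop :=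
  A.PosDef ∧
    μ = volume.withDensity (fun z => ENNReal.ofReal (skewNormalDensity ξ A α z))

end

/-!
A linear map turning `(Ω*)⁻¹` into the identity makes `U*` rotation invariant, so `U*` is Gaussian
as soon as its generator `f` is exponential on `(0, ∞)` or one of its one-dimensional marginals is
normal.

If `F^q` does not depend on `q`, then `f (q + x ^ 2)` is a function of `q` times a function of `x`;
in (i) this is known only for `x ^ 2 < κ * q`, a cone which `(αᵀ z, Q_z)` fills because `2 ≤ d`. The
tail `Φ r = ∫_{t > r} f` therefore satisfies `Φ (r + u) * Φ r' = Φ r * Φ (r' + u)` for `u < κ * r`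
and `u < κ * r'`, and being continuous it is an exponential.

If `Z` is skew normal, then it has the law of `ξ + (V | V₀ > 0)` for a Gaussian `(V₀, V)`.
Projecting to a direction `t` compares, for two spherical laws, the images under `⟪a, ·⟫` of their
restrictions to half-spaces `0 < ⟪b, ·⟫`. The exponents `l` for which `exp (l x ^ 2)` is integrable
on either half-line see only the extreme directions of the half-space, so they make the pairs
`(a, b)` of the two laws congruent up to scaling `a`. The mass of `{⟪a, ·⟫ > 0}`, which depends only
on the angle between `a` and `b`, then forces the shift to vanish, and adding the reflected image
shows that the marginal `⟪a, ·⟫` is normal.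
-/

noncomputable section

section Polar

open Set

variable {E : Type*} [NormedAddCommGroup E] [InnerProductSpace ℝ E]

/-- A cone with apex `0`, which need not contain `0` itself. -/
def IsRadialCone (K : Set E) : Prop := ∀ r : ℝ, 0 < r → ∀ w, r • w ∈ K ↔ w ∈ K

theorem isRadialCone_univ : IsRadialCone (univ : Set E) := fun _ _ _ => by simp

variable [FiniteDimensional ℝ E] [MeasurableSpace E] [BorelSpace E] [Nontrivial E]

theorem setLIntegral_cone_fun_norm {K : Set E} (hK : MeasurableSet K) (hcone : IsRadialCone K)
    {h : ℝ → ENNReal} (hh : Measurable h) :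
    ∫⁻ w in K, h ‖w‖ = (volume : Measure E).toSphere ((↑) ⁻¹' K) *
      ∫⁻ r : Ioi (0 : ℝ), h r ∂.volumeIoiPow (Module.finrank ℝ E - 1) := by
  have hpolar : ∀ w : ({0}ᶜ : Set E), K.indicator (fun w => h ‖w‖) w =
      ((↑) ⁻¹' K : Set (Metric.sphere (0 : E) 1)).indicator 1 (homeomorphUnitSphereProd E w).1 *
        h (homeomorphUnitSphereProd E w).2 := by
    intro w
    have hw : (0 : ℝ) < ‖(w : E)‖ := norm_pos_iff.2 w.2
    have hmem : (‖(w : E)‖⁻¹ • (w : E) ∈ K) ↔ (w : E) ∈ K := hcone _ (inv_pos.2 hw) _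
    by_cases hwK : (w : E) ∈ K <;> simp [hwK, hmem]
  calc ∫⁻ w in K, h ‖w‖
      = ∫⁻ w : ({0}ᶜ : Set E), K.indicator (fun w => h ‖w‖) w
          ∂Measure.comap ((↑) : ({0}ᶜ : Set E) → E) volume := by
        rw [lintegral_subtype_comap (measurableSet_singleton _).compl, restrict_compl_singleton,
          lintegral_indicator hK]
    _ = ∫⁻ x, ((↑) ⁻¹' K : Set (Metric.sphere (0 : E) 1)).indicator 1 x.1 * h x.2
          ∂(volume : Measure E).toSphere.prod (.volumeIoiPow (Module.finrank ℝ E - 1)) := by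
        simp only [hpolar]
        exact (volume : Measure E).measurePreserving_homeomorphUnitSphereProd.lintegral_comp_emb
          (Homeomorph.measurableEmbedding _)
          (fun x => ((↑) ⁻¹' K : Set (Metric.sphere (0 : E) 1)).indicator 1 x.1 * h x.2)
    _ = _ := by
        have hK' := hK.preimage (measurable_subtype_coe (p := (· ∈ Metric.sphere (0 : E) 1)))
        rw [lintegral_prod_mul (f := ((↑) ⁻¹' K : Set (Metric.sphere (0 : E) 1)).indicator 1)
          (g := fun r : Ioi (0 : ℝ) => h r) (measurable_one.indicator hK').aemeasurable
          (by fun_prop), lintegral_indicator_one hK']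

theorem toSphere_preimage_pos {K : Set E} (hK : IsOpen K) (hcone : IsRadialCone K)
    (hne : K.Nonempty) : 0 < (volume : Measure E).toSphere ((↑) ⁻¹' K) := by
  refine pos_iff_ne_zero.2 fun hzero => (hK.measure_pos volume hne).ne' ?_
  simpa [hzero] using setLIntegral_cone_fun_norm hK.measurableSet hcone measurable_one

theorem lintegral_comp_sq_Ioi (g : ℝ → ENNReal) :
    ∫⁻ t in Ioi (0 : ℝ), g t = ∫⁻ r in Ioi (0 : ℝ), ENNReal.ofReal (2 * r) * g (r ^ 2) := by
  have himage : (fun r : ℝ => r ^ 2) '' Ioi 0 = Ioi 0 := by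
    ext t
    exact ⟨fun ⟨r, hr, h⟩ => h ▸ mem_Ioi.2 (pow_pos hr 2),
      fun ht => ⟨√t, Real.sqrt_pos.2 ht, Real.sq_sqrt (le_of_lt ht)⟩⟩
  conv_lhs => rw [← himage]
  refine lintegral_image_eq_lintegral_deriv_mul_of_monotoneOn measurableSet_Ioi (fun r _ => ?_)
    (fun r hr s _ hrs => pow_le_pow_left₀ (le_of_lt hr) hrs 2) g
  simpa using (hasDerivAt_pow 2 r).hasDerivWithinAt

theorem lintegral_indicator_compl_comp_eq_zero_iff {X : Type*} [MeasurableSpace X]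
    {μ : Measure X} {p : ℝ → Prop} (hp : MeasurableSet {t | p t}) {u : X → ℝ}
    (hu : Measurable u) :
    ∫⁻ x, {t | p t}ᶜ.indicator 1 (u x) ∂μ = 0 ↔ ∀ᵐ x ∂μ, p (u x) := by
  have hind : Measurable ({t | p t}ᶜ.indicator (1 : ℝ → ENNReal)) :=
    measurable_one.indicator hp.compl
  rw [lintegral_eq_zero_iff (by fun_prop)]
  refine Filter.eventually_congr (.of_forall fun x => ?_)
  by_cases h : p (u x) <;> simp [h]

theorem ae_comp_sq_Ioi_iff {p : ℝ → Prop} (hp : MeasurableSet {t | p t}) :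
    (∀ᵐ r ∂volume.restrict (Ioi (0 : ℝ)), p (r ^ 2)) ↔
      ∀ᵐ t ∂volume.restrict (Ioi (0 : ℝ)), p t := by
  have hind : Measurable ({t | p t}ᶜ.indicator (1 : ℝ → ENNReal)) :=
    measurable_one.indicator hp.compl
  rw [← lintegral_indicator_compl_comp_eq_zero_iff (u := fun t => t) hp measurable_id,
    lintegral_comp_sq_Ioi, lintegral_eq_zero_iff (by fun_prop)]
  refine Filter.eventually_congr ((ae_restrict_mem measurableSet_Ioi).mono fun r hr => ?_)
  have hr' : (0 : ℝ) < r := hr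
  by_cases h : p (r ^ 2) <;> simp [h, hr']

theorem ae_volumeIoiPow_iff (n : ℕ) (p : ℝ → Prop) :
    (∀ᵐ r : Ioi (0 : ℝ) ∂Measure.volumeIoiPow n, p r) ↔
      ∀ᵐ r ∂volume.restrict (Ioi (0 : ℝ)), p r := by
  rw [Measure.volumeIoiPow, ae_withDensity_iff (by fun_prop),
    ← map_comap_subtype_coe measurableSet_Ioi,
    (MeasurableEmbedding.subtype_coe measurableSet_Ioi).ae_map_iff]
  refine Filter.eventually_congr (.of_forall fun r => ?_)
  have hr : (0 : ℝ) < r := r.2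
  simp [hr]

variable (E) in
theorem ae_norm_sq_iff {p : ℝ → Prop} (hp : MeasurableSet {t | p t}) :
    (∀ᵐ w : E, p (‖w‖ ^ 2)) ↔ ∀ᵐ t ∂volume.restrict (Ioi (0 : ℝ)), p t := by
  have hind : Measurable ({t | p t}ᶜ.indicator (1 : ℝ → ENNReal)) :=
    measurable_one.indicator hp.compl
  rw [← lintegral_indicator_compl_comp_eq_zero_iff hp (by fun_prop), ← setLIntegral_univ,
    setLIntegral_cone_fun_norm .univ isRadialCone_univ
      (h := fun r => {t | p t}ᶜ.indicator 1 (r ^ 2)) (by fun_prop),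
    mul_eq_zero,
    or_iff_right (toSphere_preimage_pos isOpen_univ isRadialCone_univ univ_nonempty).ne',
    lintegral_indicator_compl_comp_eq_zero_iff hp (by fun_prop),
    ae_volumeIoiPow_iff _ fun r => p (r ^ 2), ae_comp_sq_Ioi_iff hp]

theorem ae_comp_add_sq {p : ℝ → Prop} (hp : MeasurableSet {t | p t})
    (h : ∀ᵐ t ∂volume.restrict (Ioi (0 : ℝ)), p t) {q : ℝ} (hq : 0 ≤ q) :
    ∀ᵐ x : ℝ, p (q + x ^ 2) := by
  have hshift : ∀ᵐ t ∂volume.restrict (Ioi (0 : ℝ)), p (q + t) := by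
    rw [ae_restrict_iff' measurableSet_Ioi] at h ⊢
    filter_upwards [(measurePreserving_add_left volume q).quasiMeasurePreserving.ae h] with t ht h0
    exact ht (mem_Ioi.2 (add_pos_of_nonneg_of_pos hq h0))
  simpa using (ae_norm_sq_iff ℝ (p := fun t => p (q + t)) (hp.preimage (by fun_prop))).2 hshift

end Polar

section ExponentialEquation

open Set Filter Topology

variable {Φ : ℝ → ℝ} {κ : ℝ}

theorem hasDerivAt_integral_window {ε r : ℝ} (hΦ : ContinuousOn Φ (Ioi 0)) (hε : 0 < ε)
    (hr : 0 < r) : HasDerivAt (fun r => ∫ x in r..r + ε, Φ x) (Φ (r + ε) - Φ r) r := by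
  have hint : ∀ s, 0 < s → IntervalIntegrable Φ volume (r / 2) s := fun s hs =>
    (hΦ.mono fun x hx => lt_of_lt_of_le (lt_min (half_pos hr) hs) hx.1).intervalIntegrable
  have hprim : ∀ s, 0 < s → HasDerivAt (fun s => ∫ x in (r / 2)..s, Φ x) (Φ s) s := fun s hs =>
    intervalIntegral.integral_hasDerivAt_right (hint s hs)
      (hΦ.stronglyMeasurableAtFilter isOpen_Ioi s hs) (hΦ.continuousAt (Ioi_mem_nhds hs))
  refine (((hprim (r + ε) (by positivity)).comp_add_const r ε).sub
    (hprim r hr)).congr_of_eventuallyEq ?_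
  filter_upwards [Ioi_mem_nhds hr] with s hs
  exact (intervalIntegral.integral_interval_sub_left (hint _ (add_pos hs hε)) (hint s hs)).symm

theorem exists_hasDerivAt_const_mul_of_mul_eq (hΦ : ContinuousOn Φ (Ioi 0)) (hκ : 0 < κ)
    (hmul : ∀ r r' u, 0 ≤ u → u < κ * r → u < κ * r' → Φ (r + u) * Φ r' = Φ r * Φ (r' + u))
    {r₀ δ : ℝ} (hr₀ : Φ r₀ ≠ 0) (hδ : 0 < δ) (hδr₀ : δ < r₀) :
    ∃ b, ∀ r, δ < r → HasDerivAt Φ (b * Φ r) r := by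
  have hr₀_pos : 0 < r₀ := hδ.trans hδr₀
  obtain ⟨ε, hε, hεκ, hwindow⟩ : ∃ ε, 0 < ε ∧ ε < κ * δ ∧ ∫ x in r₀..r₀ + ε, Φ x ≠ 0 := by
    have hderiv : HasDerivAt (fun s => ∫ x in r₀..s, Φ x) (Φ r₀) r₀ :=
      intervalIntegral.integral_hasDerivAt_right (by simp)
        (hΦ.stronglyMeasurableAtFilter isOpen_Ioi r₀ hr₀_pos)
        (hΦ.continuousAt (Ioi_mem_nhds hr₀_pos))
    have hne : ∀ᶠ s in 𝓝[>] r₀, ∫ x in r₀..s, Φ x ≠ 0 :=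
      (hderiv.eventually_ne hr₀).filter_mono (nhdsWithin_mono _ fun s hs => ne_of_gt hs)
    obtain ⟨s, hs, hs_gt, hs_lt⟩ := (hne.and (Ioo_mem_nhdsGT
      (lt_add_of_pos_right r₀ (mul_pos hκ hδ)))).exists
    exact ⟨s - r₀, by linarith, by linarith, by simpa using hs⟩
  -- Integrating the equation over `0 ≤ u ≤ ε` expresses `Φ` by its own integral, hence smoothly.
  set c := ∫ x in r₀..r₀ + ε, Φ x with hc
  have hΦ_eq : ∀ r, δ < r → Φ r = Φ r₀ / c * ∫ x in r..r + ε, Φ x := fun r hr => by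
    have hshift : ∀ s, ∫ x in s..s + ε, Φ x = ∫ u in (0 : ℝ)..ε, Φ (s + u) := by simp
    rw [eq_comm, div_mul_eq_mul_div, div_eq_iff hwindow, hc, hshift, hshift,
      ← intervalIntegral.integral_const_mul, ← intervalIntegral.integral_const_mul]
    refine intervalIntegral.integral_congr fun u hu => ?_
    rw [uIcc_of_le hε.le] at hu
    have := hmul r r₀ u hu.1 (hu.2.trans_lt (by nlinarith)) (hu.2.trans_lt (by nlinarith))
    simpa [mul_comm] using this
  refine ⟨Φ r₀ / c * (Φ (r₀ + ε) / Φ r₀ - 1), fun r hr => ?_⟩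
  have hderiv := (hasDerivAt_integral_window hΦ hε (hδ.trans hr)).const_mul (Φ r₀ / c)
  refine (hderiv.congr_of_eventuallyEq ?_).congr_deriv ?_
  · filter_upwards [Ioi_mem_nhds hr] with s hs using hΦ_eq s hs
  · have := hmul r r₀ ε hε.le (by nlinarith) (by nlinarith)
    field_simp
    linarith

theorem exists_eq_const_mul_exp_of_mul_eq (hΦ : ContinuousOn Φ (Ioi 0)) (hκ : 0 < κ)
    (hmul : ∀ r r' u, 0 ≤ u → u < κ * r → u < κ * r' → Φ (r + u) * Φ r' = Φ r * Φ (r' + u)) :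
    ∃ C b : ℝ, ∀ r, 0 < r → Φ r = C * Real.exp (b * r) := by
  by_cases hzero : ∀ r, 0 < r → Φ r = 0
  · exact ⟨0, 0, fun r hr => by simp [hzero r hr]⟩
  push Not at hzero
  obtain ⟨r₀, hr₀_pos, hr₀⟩ := hzero
  set b := deriv Φ r₀ / Φ r₀
  have hderiv : ∀ r, 0 < r → HasDerivAt Φ (b * Φ r) r := by
    intro r hr
    have hδ : 0 < min r r₀ / 2 := by positivity
    obtain ⟨b', hb'⟩ := exists_hasDerivAt_const_mul_of_mul_eq hΦ hκ hmul hr₀ hδ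
      ((half_lt_self (lt_min hr hr₀_pos)).trans_le (min_le_right _ _))
    have hbb' : b = b' := (div_eq_iff hr₀).2
      (hb' r₀ ((half_lt_self (lt_min hr hr₀_pos)).trans_le (min_le_right _ _))).deriv
    exact hbb' ▸ hb' r ((half_lt_self (lt_min hr hr₀_pos)).trans_le (min_le_left _ _))
  have hquot : ∀ r ∈ Ioi (0 : ℝ), HasDerivAt (fun r => Φ r * Real.exp (-(b * r))) 0 r :=
    fun r hr => ((hderiv r hr).mul (((hasDerivAt_id r).const_mul b).neg.exp)).congr_deriv
      (by simp only [id]; ring)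
  obtain ⟨C, hC⟩ := isOpen_Ioi.exists_is_const_of_deriv_eq_zero isPreconnected_Ioi
    (fun r hr => (hquot r hr).differentiableAt.differentiableWithinAt)
    (fun r hr => (hquot r hr).deriv)
  exact ⟨C, b, fun r hr => by rw [← hC r hr, mul_assoc, ← Real.exp_add]; simp⟩

end ExponentialEquation

section TailIntegral

open Set Filter Topology

/-- The tail `r ↦ ∫_{t > r} f(t) dt`, which is to a density generator what the survival function is
to a density. -/
def tailIntegral (f : ℝ → ℝ) (r : ℝ) : ℝ := ∫ t in Ioi r, f t

variable {f : ℝ → ℝ}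

theorem tailIntegral_sub_tailIntegral {r s : ℝ} (hr : IntegrableOn f (Ioi r)) (hrs : r ≤ s) :
    tailIntegral f r - tailIntegral f s = ∫ t in r..s, f t :=
  intervalIntegral.integral_Ioi_sub_Ioi hr hrs

theorem continuousOn_tailIntegral (hint : ∀ r, 0 < r → IntegrableOn f (Ioi r)) :
    ContinuousOn (tailIntegral f) (Ioi 0) := fun r hr =>
  (((hint (r / 2) (half_pos hr)).continuousOn_Ici_primitive_Ioi).continuousAt
    (Ici_mem_nhds (half_lt_self hr))).continuousWithinAt

theorem tendsto_tailIntegral_atTop {r : ℝ} (hr : IntegrableOn f (Ioi r)) :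
    Tendsto (tailIntegral f) atTop (𝓝 0) := by
  have hlim : Tendsto (fun s => tailIntegral f r - ∫ t in r..s, f t) atTop (𝓝 0) := by
    simpa [tailIntegral] using
      (intervalIntegral_tendsto_integral_Ioi r hr tendsto_id).const_sub (tailIntegral f r)
  refine hlim.congr' ?_
  filter_upwards [eventually_ge_atTop r] with s hs
  rw [← tailIntegral_sub_tailIntegral hr hs, sub_sub_cancel]

theorem ae_hasDerivAt_tailIntegral (hint : ∀ r, 0 < r → IntegrableOn f (Ioi r)) :
    ∀ᵐ t ∂volume.restrict (Ioi (0 : ℝ)), HasDerivAt (tailIntegral f) (-f t) t := by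
  have hlocal : ∀ n : ℕ, ∀ᵐ t : ℝ, 1 / ((n : ℝ) + 1) < t →
      HasDerivAt (tailIntegral f) (-f t) t := fun n => by
    set r : ℝ := 1 / ((n : ℝ) + 1)
    have hr : 0 < r := Nat.one_div_pos_of_nat
    have hind : LocallyIntegrable ((Ioi r).indicator f) volume :=
      ((hint r hr).integrable_indicator measurableSet_Ioi).locallyIntegrable
    filter_upwards [LocallyIntegrable.ae_hasDerivAt_integral hind] with t ht hrt
    have hderiv := (ht r).const_sub (tailIntegral f r)
    rw [indicator_of_mem (mem_Ioi.2 hrt)] at hderiv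
    refine hderiv.congr_of_eventuallyEq ?_
    filter_upwards [Ioi_mem_nhds hrt] with s hs
    rw [eq_sub_iff_add_eq, ← eq_sub_iff_add_eq', tailIntegral_sub_tailIntegral (hint r hr) hs.le,
      intervalIntegral.integral_of_le (le_of_lt hs), intervalIntegral.integral_of_le (le_of_lt hs)]
    exact setIntegral_congr_fun measurableSet_Ioc fun y hy => indicator_of_mem (mem_Ioi.2 hy.1) f
  rw [ae_restrict_iff' measurableSet_Ioi]
  filter_upwards [ae_all_iff.2 hlocal] with t ht ht0
  obtain ⟨n, hn⟩ := exists_nat_one_div_lt (mem_Ioi.1 ht0)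
  exact ht n hn

theorem ae_eq_exp_of_tailIntegral_eq_exp (hf0 : ∀ t, 0 ≤ t → 0 ≤ f t)
    (hint : ∀ r, 0 < r → IntegrableOn f (Ioi r))
    (hne : ¬ ∀ᵐ t ∂volume.restrict (Ioi (0 : ℝ)), f t = 0) {C b : ℝ}
    (hexp : ∀ r, 0 < r → tailIntegral f r = C * Real.exp (b * r)) :
    ∃ a c : ℝ, 0 < a ∧ 0 < c ∧
      ∀ᵐ t ∂volume.restrict (Ioi (0 : ℝ)), f t = a * Real.exp (-c * t) := by
  have hf : ∀ᵐ t ∂volume.restrict (Ioi (0 : ℝ)), f t = -(b * C) * Real.exp (b * t) := by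
    filter_upwards [ae_hasDerivAt_tailIntegral hint, ae_restrict_mem measurableSet_Ioi] with t ht h0
    have hderiv : HasDerivAt (tailIntegral f) (C * (Real.exp (b * t) * (b * 1))) t :=
      (((hasDerivAt_id t).const_mul b).exp.const_mul C).congr_of_eventuallyEq
        (by filter_upwards [Ioi_mem_nhds h0] with s hs using hexp s hs)
    linarith [ht.unique hderiv]
  have hprod : b * C ≠ 0 := fun h => hne (hf.mono fun t ht => by simp [ht, h])
  have hC : 0 < C := by
    have h1 : 0 ≤ C * Real.exp (b * 1) := hexp 1 one_pos ▸
      setIntegral_nonneg measurableSet_Ioi fun t ht => hf0 t (zero_le_one.trans (le_of_lt ht))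
    exact (nonneg_of_mul_nonneg_left h1 (Real.exp_pos _)).lt_of_ne' (right_ne_zero_of_mul hprod)
  have hb : b < 0 := by
    refine (left_ne_zero_of_mul hprod).lt_or_gt.resolve_right fun hb => ?_
    refine hC.not_ge (ge_of_tendsto (tendsto_tailIntegral_atTop (hint 1 one_pos)) ?_)
    filter_upwards [eventually_gt_atTop 0] with r hr
    rw [hexp r hr]
    exact le_mul_of_one_le_right hC.le (Real.one_le_exp (mul_pos hb hr).le)
  exact ⟨-(b * C), -b, neg_pos.2 (mul_neg_of_neg_of_pos hb hC), neg_pos.2 hb, by simpa using hf⟩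

end TailIntegral

section ConditionalGenerator

open Set Filter Topology

variable {f : ℝ → ℝ}

theorem condGenerator_nonneg (hf0 : ∀ t, 0 ≤ t → 0 ≤ f t) {q : ℝ} (hq : 0 ≤ q) (x : ℝ) :
    0 ≤ condGenerator f q (x ^ 2) := hf0 _ (by positivity)

theorem integral_mul_condDistFun_sub_half (hf0 : ∀ t, 0 ≤ t → 0 ≤ f t) {q : ℝ} (hq : 0 ≤ q)
    (hint : Integrable fun x => condGenerator f q (x ^ 2)) (y : ℝ) :
    (∫ x, condGenerator f q (x ^ 2)) * (condDistFun f q y - 1 / 2) =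
      ∫ x in (0 : ℝ)..y, condGenerator f q (x ^ 2) := by
  have hhalf : ∫ x in Iic (0 : ℝ), condGenerator f q (x ^ 2) =
      (∫ x, condGenerator f q (x ^ 2)) / 2 := by
    have hsymm : ∫ x in Iic (0 : ℝ), condGenerator f q (x ^ 2) =
        ∫ x in Ioi (0 : ℝ), condGenerator f q (x ^ 2) := by
      have := integral_comp_neg_Iic (0 : ℝ) fun x => condGenerator f q (x ^ 2)
      simp only [even_two.neg_pow, neg_zero] at this
      exact this
    linarith [intervalIntegral.integral_Iic_add_Ioi hint.integrableOn hint.integrableOn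
      (b := (0 : ℝ))]
  have hle : ∫ x in Iic y, condGenerator f q (x ^ 2) =
      (∫ x, condGenerator f q (x ^ 2)) * condDistFun f q y := by
    rcases eq_or_ne (∫ x, condGenerator f q (x ^ 2)) 0 with h0 | h0
    · have hnonneg : 0 ≤ fun x => condGenerator f q (x ^ 2) := condGenerator_nonneg hf0 hq
      rw [h0, zero_mul, setIntegral_congr_ae measurableSet_Iic
        (((integral_eq_zero_iff_of_nonneg hnonneg hint).1 h0).mono fun x hx _ => hx)]
      simp
    · rw [condDistFun, mul_div_cancel₀ _ h0]
  rw [mul_sub, ← hle, mul_one_div, ← hhalf,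
    intervalIntegral.integral_Iic_sub_Iic hint.integrableOn hint.integrableOn]

theorem setIntegral_Ioi_condGenerator (f : ℝ → ℝ) (r x : ℝ) :
    ∫ q in Ioi r, condGenerator f q x = tailIntegral f (r + x) := by
  simpa [condGenerator, tailIntegral] using
    (measurePreserving_add_right (volume : Measure ℝ) x).setIntegral_preimage_emb
    (measurableEmbedding_addRight x) f (Ioi (r + x))

theorem integrableOn_Ioi_condGenerator {r x : ℝ} (hint : IntegrableOn f (Ioi (r + x))) :
    IntegrableOn (fun q => condGenerator f q x) (Ioi r) := by
  simpa [condGenerator, Function.comp_def] using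
    ((measurePreserving_add_right (volume : Measure ℝ) x).integrableOn_comp_preimage
    (measurableEmbedding_addRight x)).2 hint

theorem setIntegral_Ioi_intervalIntegral_condGenerator (hf : Measurable f)
    (hf0 : ∀ t, 0 ≤ t → 0 ≤ f t) (hint : ∀ r, 0 < r → IntegrableOn f (Ioi r)) {r : ℝ}
    (hr : 0 < r) (y : ℝ) :
    ∫ q in Ioi r, ∫ x in (0 : ℝ)..y, condGenerator f q (x ^ 2) =
      ∫ x in (0 : ℝ)..y, tailIntegral f (r + x ^ 2) := by
  have htail : Continuous fun x => tailIntegral f (r + x ^ 2) :=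
    (continuousOn_tailIntegral hint).comp_continuous (by fun_prop) fun x =>
      mem_Ioi.2 (add_pos_of_pos_of_nonneg hr (sq_nonneg x))
  have hprod : Integrable (Function.uncurry fun x q => condGenerator f q (x ^ 2))
      ((volume.restrict (uIoc 0 y)).prod (volume.restrict (Ioi r))) := by
    refine (integrable_prod_iff ?_).2 ⟨.of_forall fun x => ?_, ?_⟩
    · unfold condGenerator Function.uncurry
      exact Measurable.aestronglyMeasurable (by fun_prop)
    · exact integrableOn_Ioi_condGenerator (hint _ (add_pos_of_pos_of_nonneg hr (sq_nonneg x)))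
    · have hnorm : ∀ x, ∫ q in Ioi r, ‖condGenerator f q (x ^ 2)‖ = tailIntegral f (r + x ^ 2) :=
        fun x => by
          rw [← setIntegral_Ioi_condGenerator]
          exact setIntegral_congr_fun measurableSet_Ioi fun q hq =>
            Real.norm_of_nonneg (condGenerator_nonneg hf0 (hr.trans hq).le x)
      simpa only [Function.uncurry, hnorm, IntegrableOn] using (htail.intervalIntegrable 0 y).def'
  rw [← intervalIntegral_integral_swap hprod]
  simp only [setIntegral_Ioi_condGenerator]

theorem deriv_mul_deriv_zero_comm_of_ae_mul_comm {A B a b : ℝ → ℝ}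
    (hA : ∀ y, HasDerivAt A (a y) y) (hB : ∀ y, HasDerivAt B (b y) y) {ρ : ℝ}
    (hAB : ∀ᵐ y, y ∈ Ioo (-ρ) ρ → ∀ᵐ y', y' ∈ Ioo (-ρ) ρ → A y * B y' = A y' * B y) {u : ℝ}
    (hu : u ∈ Ioo (-ρ) ρ) : a u * b 0 = a 0 * b u := by
  have hAc : Continuous A := continuous_iff_continuousAt.2 fun y => (hA y).continuousAt
  have hBc : Continuous B := continuous_iff_continuousAt.2 fun y => (hB y).continuousAt
  have hderiv_eq : ∀ {F G : ℝ → ℝ} {m n v : ℝ}, Continuous F → Continuous G →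
      (∀ᵐ y, y ∈ Ioo (-ρ) ρ → F y = G y) → v ∈ Ioo (-ρ) ρ → HasDerivAt F m v →
      HasDerivAt G n v → m = n := by
    intro F G m n v hF hG hFG hv hFv hGv
    have heq := Measure.eqOn_open_of_ae_eq ((ae_restrict_iff' measurableSet_Ioo).2 hFG) isOpen_Ioo
      hF.continuousOn hG.continuousOn
    exact hFv.unique (hGv.congr_of_eventuallyEq (heq.eventuallyEq_of_mem (isOpen_Ioo.mem_nhds hv)))
  have h0 : (0 : ℝ) ∈ Ioo (-ρ) ρ := ⟨by linarith [hu.1, hu.2], by linarith [hu.1, hu.2]⟩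
  refine hderiv_eq (hAc.mul_const (b 0)) (hBc.const_mul (a 0)) ?_ hu ((hA u).mul_const _)
    ((hB u).const_mul _)
  filter_upwards [hAB] with y hy hyρ
  refine hderiv_eq (F := fun y' => A y * B y') (G := fun y' => A y' * B y) (by fun_prop)
    (by fun_prop) (hy hyρ) h0 ((hB 0).const_mul _) ((hA 0).mul_const _)

theorem ae_intervalIntegral_condGenerator_eq (hf0 : ∀ t, 0 ≤ t → 0 ≤ f t)
    (hcond : ∀ᵐ q ∂volume.restrict (Ioi (0 : ℝ)), Integrable fun x => condGenerator f q (x ^ 2))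
    {κ : ℝ} (hκ : 0 < κ) {y F : ℝ}
    (hF : ∀ᵐ q ∂volume.restrict (Ioi (0 : ℝ)), y ^ 2 < κ * q →
      ∫ x, condGenerator f q (x ^ 2) ≠ 0 → condDistFun f q y = F)
    {r : ℝ} (hr : 0 < r) (hyr : y ^ 2 < κ * r) :
    ∀ᵐ q ∂volume.restrict (Ioi r), ∫ x in (0 : ℝ)..y, condGenerator f q (x ^ 2) =
      (∫ x, condGenerator f q (x ^ 2)) * (F - 1 / 2) := by
  filter_upwards [ae_restrict_of_ae_restrict_of_subset (Ioi_subset_Ioi hr.le) hF,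
    ae_restrict_of_ae_restrict_of_subset (Ioi_subset_Ioi hr.le) hcond,
    ae_restrict_mem measurableSet_Ioi] with q hFq hcondq hrq
  rw [← integral_mul_condDistFun_sub_half hf0 (hr.trans hrq).le hcondq]
  rcases eq_or_ne (∫ x, condGenerator f q (x ^ 2)) 0 with h0 | h0
  · rw [h0, zero_mul, zero_mul]
  · rw [hFq (hyr.trans (mul_lt_mul_of_pos_left hrq hκ)) h0]

theorem intervalIntegral_tailIntegral_mul_comm (hf : Measurable f)
    (hf0 : ∀ t, 0 ≤ t → 0 ≤ f t) (hint : ∀ r, 0 < r → IntegrableOn f (Ioi r))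
    {N : ℝ → ℝ} {r r' y y' c c' : ℝ} (hr : 0 < r) (hr' : 0 < r')
    (hy : ∀ s, s = r ∨ s = r' →
      ∀ᵐ q ∂volume.restrict (Ioi s), ∫ x in (0 : ℝ)..y, condGenerator f q (x ^ 2) = N q * c)
    (hy' : ∀ s, s = r ∨ s = r' →
      ∀ᵐ q ∂volume.restrict (Ioi s), ∫ x in (0 : ℝ)..y', condGenerator f q (x ^ 2) = N q * c') :
    (∫ x in (0 : ℝ)..y, tailIntegral f (r + x ^ 2)) *
        ∫ x in (0 : ℝ)..y', tailIntegral f (r' + x ^ 2) =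
      (∫ x in (0 : ℝ)..y', tailIntegral f (r + x ^ 2)) *
        ∫ x in (0 : ℝ)..y, tailIntegral f (r' + x ^ 2) := by
  simp only [← setIntegral_Ioi_intervalIntegral_condGenerator hf hf0 hint hr,
    ← setIntegral_Ioi_intervalIntegral_condGenerator hf hf0 hint hr', ← integral_mul_const,
    ← integral_const_mul]
  refine integral_congr_ae ?_
  filter_upwards [hy r' (.inr rfl), hy' r' (.inr rfl)] with q hq hq'
  refine integral_congr_ae ?_
  filter_upwards [hy r (.inl rfl), hy' r (.inl rfl)] with p hp hp'
  rw [hq, hq', hp, hp']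
  ring

theorem tailIntegral_add_mul_comm (hf : Measurable f) (hf0 : ∀ t, 0 ≤ t → 0 ≤ f t)
    (hint : ∀ r, 0 < r → IntegrableOn f (Ioi r))
    (hcond : ∀ᵐ q ∂volume.restrict (Ioi (0 : ℝ)), Integrable fun x => condGenerator f q (x ^ 2))
    {κ : ℝ} (hκ : 0 < κ) {F : ℝ → ℝ}
    (hF : ∀ᵐ y, ∀ᵐ q ∂volume.restrict (Ioi (0 : ℝ)), y ^ 2 < κ * q →
      ∫ x, condGenerator f q (x ^ 2) ≠ 0 → condDistFun f q y = F y)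
    {r r' u : ℝ} (hu : 0 ≤ u) (hur : u < κ * r) (hur' : u < κ * r') :
    tailIntegral f (r + u) * tailIntegral f r' = tailIntegral f r * tailIntegral f (r' + u) := by
  have hpos : ∀ {s}, u < κ * s → 0 < s := fun hs => pos_of_mul_pos_right (hu.trans_lt hs) hκ.le
  have hprim : ∀ {s}, 0 < s → ∀ y, HasDerivAt (fun y => ∫ x in (0 : ℝ)..y,
      tailIntegral f (s + x ^ 2)) (tailIntegral f (s + y ^ 2)) y := fun {s} hs y =>
    (((continuousOn_tailIntegral hint).comp_continuous (by fun_prop) fun x =>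
      mem_Ioi.2 (add_pos_of_pos_of_nonneg hs (sq_nonneg x))).integral_hasStrictDerivAt
        0 y).hasDerivAt
  set ρ := √(min (κ * r) (κ * r'))
  have hsq : ∀ {y}, y ∈ Ioo (-ρ) ρ → ∀ s, s = r ∨ s = r' → 0 < s ∧ y ^ 2 < κ * s := by
    intro y hy s hs
    have hlt : y ^ 2 < min (κ * r) (κ * r') := by
      simpa only [sq_abs] using (Real.lt_sqrt (abs_nonneg y)).1 (abs_lt.2 hy)
    rcases hs with rfl | rfl
    exacts [⟨hpos hur, hlt.trans_le (min_le_left _ _)⟩,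
      ⟨hpos hur', hlt.trans_le (min_le_right _ _)⟩]
  have huρ : √u ∈ Ioo (-ρ) ρ :=
    abs_lt.1 ((abs_of_nonneg (Real.sqrt_nonneg u)).trans_lt
      (Real.sqrt_lt_sqrt hu (lt_min hur hur')))
  have hderiv := deriv_mul_deriv_zero_comm_of_ae_mul_comm (hprim (hpos hur)) (hprim (hpos hur'))
    (ρ := ρ) ?_ huρ
  · simpa [Real.sq_sqrt hu] using hderiv
  filter_upwards [hF] with y hFy hy
  filter_upwards [hF] with y' hFy' hy'
  exact intervalIntegral_tailIntegral_mul_comm hf hf0 hint (hpos hur) (hpos hur')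
    (fun s hs => ae_intervalIntegral_condGenerator_eq hf0 hcond hκ hFy (hsq hy s hs).1
      (hsq hy s hs).2)
    fun s hs => ae_intervalIntegral_condGenerator_eq hf0 hcond hκ hFy' (hsq hy' s hs).1
      (hsq hy' s hs).2

theorem ae_eq_exp_of_condDistFun_eq (hf : Measurable f) (hf0 : ∀ t, 0 ≤ t → 0 ≤ f t)
    (hint : ∀ r, 0 < r → IntegrableOn f (Ioi r))
    (hne : ¬ ∀ᵐ t ∂volume.restrict (Ioi (0 : ℝ)), f t = 0)
    (hcond : ∀ᵐ q ∂volume.restrict (Ioi (0 : ℝ)), Integrable fun x => condGenerator f q (x ^ 2))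
    {κ : ℝ} (hκ : 0 < κ) {F : ℝ → ℝ}
    (hF : ∀ᵐ y, ∀ᵐ q ∂volume.restrict (Ioi (0 : ℝ)), y ^ 2 < κ * q →
      ∫ x, condGenerator f q (x ^ 2) ≠ 0 → condDistFun f q y = F y) :
    ∃ a c : ℝ, 0 < a ∧ 0 < c ∧
      ∀ᵐ t ∂volume.restrict (Ioi (0 : ℝ)), f t = a * Real.exp (-c * t) := by
  obtain ⟨C, b, hexp⟩ := exists_eq_const_mul_exp_of_mul_eq (continuousOn_tailIntegral hint) hκ
    fun _ _ _ => tailIntegral_add_mul_comm hf hf0 hint hcond hκ hF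
  exact ae_eq_exp_of_tailIntegral_eq_exp hf0 hint hne hexp

end ConditionalGenerator

section StandardizingMap

open Matrix
open scoped MatrixOrder

variable {ι : Type*} [Fintype ι] {A : Matrix ι ι ℝ}

theorem dotProduct_mulVec_comm_of_isHermitian (hA : A.IsHermitian) (x y : ι → ℝ) :
    x ⬝ᵥ (A *ᵥ y) = y ⬝ᵥ (A *ᵥ x) := by
  rw [IsHermitian, conjTranspose_eq_transpose_of_trivial] at hA
  rw [dotProduct_mulVec, ← mulVec_transpose, hA, dotProduct_comm]

variable [DecidableEq ι]

theorem inv_mulVec_mulVec_of_posDef (hA : A.PosDef) (x : ι → ℝ) : A⁻¹ *ᵥ (A *ᵥ x) = x := by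
  rw [mulVec_mulVec, nonsing_inv_mul _ ((isUnit_iff_isUnit_det A).1 hA.isUnit), one_mulVec]

theorem mulVec_inv_mulVec_of_posDef (hA : A.PosDef) (x : ι → ℝ) : A *ᵥ (A⁻¹ *ᵥ x) = x := by
  rw [mulVec_mulVec, mul_nonsing_inv _ ((isUnit_iff_isUnit_det A).1 hA.isUnit), one_mulVec]

theorem invQuadForm_of_mulVec_eq (hA : A.PosDef) {x : EuclideanSpace ℝ ι} {y : ι → ℝ}
    (h : A *ᵥ y = x.ofLp) : invQuadForm A x = x.ofLp ⬝ᵥ y := by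
  rw [invQuadForm, ← h, inv_mulVec_mulVec_of_posDef hA]

theorem exists_posDef_mul_self_eq_inv (hA : A.PosDef) :
    ∃ B : Matrix ι ι ℝ, B.PosDef ∧ B * B = A⁻¹ ∧ B.det = (√A.det)⁻¹ := by
  have hBB : CFC.sqrt A⁻¹ * CFC.sqrt A⁻¹ = A⁻¹ :=
    CFC.sqrt_mul_sqrt_self A⁻¹ hA.inv.posSemidef.nonneg
  have hpsd : (CFC.sqrt A⁻¹).PosSemidef := nonneg_iff_posSemidef.1 (CFC.sqrt_nonneg _)
  have hdet : (CFC.sqrt A⁻¹).det = (√A.det)⁻¹ := by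
    rw [← Real.sqrt_inv, ← Ring.inverse_eq_inv', ← det_nonsing_inv, eq_comm,
      Real.sqrt_eq_iff_mul_self_eq hA.inv.posSemidef.det_nonneg hpsd.det_nonneg, ← det_mul, hBB]
  refine ⟨CFC.sqrt A⁻¹, hpsd.posDef_iff_isUnit.2 ?_, hBB, hdet⟩
  rw [isUnit_iff_isUnit_det, hdet]
  exact (inv_pos.2 (Real.sqrt_pos.2 hA.det_pos)).ne'.isUnit

theorem exists_norm_sq_eq_invQuadForm (hA : A.PosDef) :
    ∃ T : EuclideanSpace ℝ ι ≃L[ℝ] EuclideanSpace ℝ ι, (∀ y, ‖T y‖ ^ 2 = invQuadForm A y) ∧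
      (volume : Measure (EuclideanSpace ℝ ι)).map T = ENNReal.ofReal √A.det • volume := by
  obtain ⟨B, hB, hBB, hdet⟩ := exists_posDef_mul_self_eq_inv hA
  let T : EuclideanSpace ℝ ι ≃L[ℝ] EuclideanSpace ℝ ι := ContinuousLinearEquiv.equivOfInverse
    (toEuclideanCLM (n := ι) (𝕜 := ℝ) B) (toEuclideanCLM (n := ι) (𝕜 := ℝ) B⁻¹)
    (fun x => WithLp.ofLp_injective 2 (by
      simp only [ofLp_toEuclideanCLM, inv_mulVec_mulVec_of_posDef hB]))
    (fun x => WithLp.ofLp_injective 2 (by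
      simp only [ofLp_toEuclideanCLM, mulVec_inv_mulVec_of_posDef hB]))
  refine ⟨T, fun y => ?_, ?_⟩
  · have hTy : (T y).ofLp = B *ᵥ y.ofLp := rfl
    rw [invQuadForm, ← hBB, ← mulVec_mulVec,
      dotProduct_mulVec_comm_of_isHermitian hB.isHermitian, ← hTy, EuclideanSpace.real_norm_sq_eq,
      dotProduct]
    simp only [sq]
  · have hdetT : LinearMap.det (toEuclideanLin B) = (√A.det)⁻¹ := by
      rw [toEuclideanLin_eq_toLin_orthonormal, LinearMap.det_toLin, hdet]
    have hmap := Measure.map_linearMap_addHaar_eq_smul_addHaar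
      (volume : Measure (EuclideanSpace ℝ ι)) (f := toEuclideanLin B)
      (by rw [hdetT]; exact (inv_pos.2 (Real.sqrt_pos.2 hA.det_pos)).ne')
    rwa [hdetT, inv_inv, abs_of_nonneg (Real.sqrt_nonneg _)] at hmap

theorem invQuadForm_neg (A : Matrix ι ι ℝ) (x : EuclideanSpace ℝ ι) :
    invQuadForm A (-x) = invQuadForm A x := by
  simp [invQuadForm, mulVec_neg]

theorem invQuadForm_smul {c : ℝ} (hc : c ≠ 0) (hA : A.PosDef) (x : EuclideanSpace ℝ ι) :
    invQuadForm (c • A) x = c⁻¹ * invQuadForm A x := by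
  rw [invQuadForm, invQuadForm, show c • A = (Units.mk0 c hc) • A from rfl,
    inv_smul' _ _ ((isUnit_iff_isUnit_det A).1 hA.isUnit)]
  simp [smul_mulVec, Units.smul_def]

theorem invQuadForm_nonneg (hA : A.PosDef) (x : EuclideanSpace ℝ ι) : 0 ≤ invQuadForm A x := by
  obtain ⟨T, hT, -⟩ := exists_norm_sq_eq_invQuadForm hA
  rw [← hT]
  positivity

theorem continuous_invQuadForm (A : Matrix ι ι ℝ) : Continuous (invQuadForm A) := by
  unfold invQuadForm dotProduct mulVec dotProduct
  fun_prop

end StandardizingMap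

section StarMatrix

open Matrix

variable {d : ℕ} {δ : Fin d → ℝ} {Ωbar : Matrix (Fin d) (Fin d) ℝ}

theorem posDef_of_starMatrix (h : (starMatrix δ Ωbar).PosDef) : Ωbar.PosDef :=
  h.submatrix (e := (Sum.inr : Fin d → Unit ⊕ Fin d)) Sum.inr_injective

theorem starMatrix_mulVec_elim (δ : Fin d → ℝ) (Ωbar : Matrix (Fin d) (Fin d) ℝ) (c : ℝ)
    (v : Fin d → ℝ) : starMatrix δ Ωbar *ᵥ Sum.elim (fun _ => c) v =
      Sum.elim (fun _ => c + δ ⬝ᵥ v) (c • δ + Ωbar *ᵥ v) := by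
  rw [starMatrix, fromBlocks_mulVec, Sum.elim_comp_inl, Sum.elim_comp_inr, one_mulVec]
  congr 1
  ext i
  simp [mulVec, dotProduct, mul_comm]

theorem elim_dotProduct_elim (c c' : ℝ) (v v' : Fin d → ℝ) :
    Sum.elim (fun _ : Unit => c) v ⬝ᵥ Sum.elim (fun _ => c') v' = c * c' + v ⬝ᵥ v' := by
  simp [dotProduct, Fintype.sum_sum_type]

theorem schurComplement_pos_of_starMatrix (h : (starMatrix δ Ωbar).PosDef) :
    0 < 1 - δ ⬝ᵥ (Ωbar⁻¹ *ᵥ δ) := by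
  have hx : Sum.elim (fun _ : Unit => (1 : ℝ)) (-(Ωbar⁻¹ *ᵥ δ)) ≠ 0 := fun h0 => by
    simpa using congrFun h0 (Sum.inl ())
  have hpos := h.dotProduct_mulVec_pos hx
  rw [star_trivial, starMatrix_mulVec_elim, elim_dotProduct_elim, mulVec_neg,
    mulVec_inv_mulVec_of_posDef (posDef_of_starMatrix h)] at hpos
  simpa [← sub_eq_add_neg] using hpos

theorem invQuadForm_starMatrix (h : (starMatrix δ Ωbar).PosDef) (u₀ : ℝ)
    (z : EuclideanSpace ℝ (Fin d)) :
    invQuadForm (starMatrix δ Ωbar) (joinVec u₀ z) = invQuadForm Ωbar z +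
      ((u₀ - δ ⬝ᵥ (Ωbar⁻¹ *ᵥ z.ofLp)) / √(1 - δ ⬝ᵥ (Ωbar⁻¹ *ᵥ δ))) ^ 2 := by
  have hΩ := posDef_of_starMatrix h
  have hs := schurComplement_pos_of_starMatrix h
  set s := 1 - δ ⬝ᵥ (Ωbar⁻¹ *ᵥ δ) with hs_def
  have hδ : δ ⬝ᵥ (Ωbar⁻¹ *ᵥ δ) = 1 - s := by rw [hs_def, sub_sub_cancel]
  set y₀ := (u₀ - δ ⬝ᵥ (Ωbar⁻¹ *ᵥ z.ofLp)) / s with hy₀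
  have hsolve : starMatrix δ Ωbar *ᵥ Sum.elim (fun _ => y₀)
      (Ωbar⁻¹ *ᵥ z.ofLp - y₀ • (Ωbar⁻¹ *ᵥ δ)) = (joinVec u₀ z).ofLp := by
    rw [starMatrix_mulVec_elim, mulVec_sub, mulVec_smul, mulVec_inv_mulVec_of_posDef hΩ,
      mulVec_inv_mulVec_of_posDef hΩ, add_sub_cancel, dotProduct_sub, dotProduct_smul, hδ,
      smul_eq_mul, joinVec]
    congr 2
    funext
    linear_combination div_mul_cancel₀ (u₀ - δ ⬝ᵥ (Ωbar⁻¹ *ᵥ z.ofLp)) hs.ne'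
  rw [invQuadForm_of_mulVec_eq h hsolve, joinVec, elim_dotProduct_elim, dotProduct_sub,
    dotProduct_smul, dotProduct_mulVec_comm_of_isHermitian hΩ.inv.isHermitian z.ofLp δ, div_pow,
    Real.sq_sqrt hs.le, invQuadForm, smul_eq_mul, hy₀]
  field_simp
  ring

theorem shapeParam_dotProduct (h : (starMatrix δ Ωbar).PosDef) (z : EuclideanSpace ℝ (Fin d)) :
    shapeParam δ Ωbar ⬝ᵥ z.ofLp =
      (δ ⬝ᵥ (Ωbar⁻¹ *ᵥ z.ofLp)) / √(1 - δ ⬝ᵥ (Ωbar⁻¹ *ᵥ δ)) := by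
  rw [shapeParam, smul_dotProduct, smul_eq_mul, dotProduct_comm _ z.ofLp,
    dotProduct_mulVec_comm_of_isHermitian (posDef_of_starMatrix h).inv.isHermitian z.ofLp δ,
    one_div, inv_mul_eq_div]

theorem shapeParam_ne_zero (h : (starMatrix δ Ωbar).PosDef) (hδ : δ ≠ 0) :
    shapeParam δ Ωbar ≠ 0 := by
  refine smul_ne_zero (one_div_pos.2 (Real.sqrt_pos.2 (schurComplement_pos_of_starMatrix h))).ne'
    fun h0 => hδ ?_
  rw [← mulVec_inv_mulVec_of_posDef (posDef_of_starMatrix h) δ, h0, mulVec_zero]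

end StarMatrix

section IsotropicGaussian

open scoped RealInnerProductSpace

variable {E : Type*} [NormedAddCommGroup E] [InnerProductSpace ℝ E]

/-- The density of the centred normal law with covariance `σ²` times the identity. -/
def isotropicGaussianDensity (E : Type*) [NormedAddCommGroup E] [InnerProductSpace ℝ E]
    (σ : ℝ) (w : E) : ℝ :=
  (2 * Real.pi * σ ^ 2) ^ (-(Module.finrank ℝ E : ℝ) / 2) * Real.exp (-(‖w‖ ^ 2) / (2 * σ ^ 2))

theorem isotropicGaussianDensity_pos {σ : ℝ} (hσ : 0 < σ) (w : E) :
    0 < isotropicGaussianDensity E σ w := by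
  unfold isotropicGaussianDensity
  positivity

theorem continuous_isotropicGaussianDensity (σ : ℝ) :
    Continuous (isotropicGaussianDensity E σ) := by
  unfold isotropicGaussianDensity
  fun_prop

variable [FiniteDimensional ℝ E] [MeasurableSpace E] [BorelSpace E]

theorem integral_isotropicGaussianDensity_mul_cexp {σ : ℝ} (hσ : 0 < σ) (t : E) :
    ∫ w : E, (isotropicGaussianDensity E σ w : ℂ) * Complex.exp (⟪w, t⟫ * Complex.I) =
      Complex.exp (-(σ ^ 2 * ‖t‖ ^ 2) / 2) := by
  have hσ' : (σ : ℂ) ≠ 0 := by exact_mod_cast hσ.ne'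
  set b : ℝ := 1 / (2 * σ ^ 2) with hb
  set c : ℝ := 2 * Real.pi * σ ^ 2 with hc
  have hc_pos : 0 < c := by positivity
  have hfun : ∀ w : E, (isotropicGaussianDensity E σ w : ℂ) * Complex.exp (⟪w, t⟫ * Complex.I) =
      ((c ^ (-(Module.finrank ℝ E : ℝ) / 2) : ℝ) : ℂ) *
        Complex.exp (-(b : ℂ) * ‖w‖ ^ 2 + Complex.I * ⟪t, w⟫) := by
    intro w
    rw [isotropicGaussianDensity, Complex.ofReal_mul, mul_assoc, Complex.ofReal_exp,
      ← Complex.exp_add, real_inner_comm w t, hb]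
    congr 2
    push_cast
    ring
  have hpi : (Real.pi : ℂ) / (b : ℂ) = (c : ℂ) := by
    rw [hb, hc]
    push_cast
    field_simp
  have hpow : (c : ℂ) ^ ((Module.finrank ℝ E : ℂ) / 2) =
      ((c ^ ((Module.finrank ℝ E : ℝ) / 2) : ℝ) : ℂ) := by
    rw [Complex.ofReal_cpow hc_pos.le]
    push_cast
    rfl
  have hb_pos : 0 < (b : ℂ).re := by
    rw [Complex.ofReal_re]
    positivity
  simp_rw [hfun]
  rw [integral_const_mul, GaussianFourier.integral_cexp_neg_mul_sq_norm_add hb_pos Complex.I t,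
    hpi, hpow, ← mul_assoc, ← Complex.ofReal_mul, ← Real.rpow_add hc_pos, neg_div, neg_add_cancel,
    Real.rpow_zero, Complex.ofReal_one, one_mul, Complex.I_sq, hb]
  congr 1
  push_cast
  field_simp
  norm_num

theorem integrable_isotropicGaussianDensity {σ : ℝ} (hσ : 0 < σ) :
    Integrable (isotropicGaussianDensity E σ) := by
  by_contra hcon
  have h1 := integral_isotropicGaussianDensity_mul_cexp (E := E) hσ 0
  simp only [inner_zero_right, Complex.ofReal_zero, zero_mul, Complex.exp_zero, mul_one,
    norm_zero] at h1
  rw [integral_undef fun hi => hcon (by simpa using hi.re)] at h1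
  simp at h1

theorem stdGaussian_map_smul {σ : ℝ} (hσ : 0 < σ) :
    (stdGaussian E).map (σ • ·) =
      volume.withDensity (fun w => ENNReal.ofReal (isotropicGaussianDensity E σ w)) := by
  have := isFiniteMeasure_withDensity_ofReal (integrable_isotropicGaussianDensity (E := E) hσ).2
  refine Measure.ext_of_charFun (funext fun t => ?_)
  rw [charFun_map_smul, charFun_stdGaussian, charFun_apply,
    integral_withDensity_eq_integral_toReal_smul
      (continuous_isotropicGaussianDensity σ).measurable.ennreal_ofReal
      (ae_of_all _ fun _ => ENNReal.ofReal_lt_top)]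
  simp_rw [ENNReal.toReal_ofReal (isotropicGaussianDensity_pos hσ _).le, Complex.real_smul]
  rw [integral_isotropicGaussianDensity_mul_cexp hσ, norm_smul, Real.norm_of_nonneg hσ.le]
  push_cast
  ring_nf

theorem stdGaussian_eq_withDensity :
    stdGaussian E =
      volume.withDensity (fun w => ENNReal.ofReal (isotropicGaussianDensity E 1 w)) := by
  rw [← stdGaussian_map_smul one_pos]
  simp

theorem charFun_map_inner (μ : Measure E) (a : E) (τ : ℝ) :
    charFun (μ.map (fun w => ⟪a, w⟫)) τ = charFun μ (τ • a) := by
  rw [charFun_apply, charFun_apply, integral_map (by fun_prop) (by fun_prop)]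
  simp only [RCLike.inner_apply, conj_trivial, real_inner_smul_right, real_inner_comm a]

theorem stdGaussian_map_inner (a : E) :
    (stdGaussian E).map (fun w => ⟪a, w⟫) = gaussianReal 0 (‖a‖ ^ 2).toNNReal := by
  have h := IsGaussian.map_eq_gaussianReal (μ := stdGaussian E) (innerSL ℝ a)
  rwa [integral_strongDual_stdGaussian, variance_dual_stdGaussian, innerSL_apply_norm] at h

theorem isGaussian_stdGaussian_map_smul (σ : ℝ) : IsGaussian ((stdGaussian E).map (σ • ·)) :=
  isGaussian_map (μ := stdGaussian E) (σ • ContinuousLinearMap.id ℝ E)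

end IsotropicGaussian

section RadialMeasure

open scoped RealInnerProductSpace

variable {E : Type*} [NormedAddCommGroup E] [InnerProductSpace ℝ E] [FiniteDimensional ℝ E]
  [MeasurableSpace E] [BorelSpace E]

theorem map_withDensity_of_map_eq_smul {h : E → ENNReal} (hh : Measurable h) (T : E ≃L[ℝ] E)
    {k : ENNReal} (hT : (volume : Measure E).map T = k • volume) :
    (volume.withDensity h).map T = volume.withDensity (fun w => k * h (T.symm w)) := by
  have hTm : Measurable T := T.continuous.measurable
  have hhT : Measurable fun w => h (T.symm w) := hh.comp T.symm.continuous.measurable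
  ext s hs
  have hmap := setLIntegral_map (μ := (volume : Measure E)) hs hhT hTm
  simp only [hT, Measure.restrict_smul, lintegral_smul_measure,
    ContinuousLinearEquiv.symm_apply_apply] at hmap
  rw [Measure.map_apply hTm hs, withDensity_apply _ (hTm hs), withDensity_apply _ hs,
    lintegral_const_mul k hhT, ← hmap, smul_eq_mul]

/-- The rotation invariant measure with density `p (‖w‖)` with respect to Lebesgue measure. -/
def radialMeasure (E : Type*) [NormedAddCommGroup E] [InnerProductSpace ℝ E]
    [FiniteDimensional ℝ E] [MeasurableSpace E] [BorelSpace E] (p : ℝ → ENNReal) : Measure E :=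
  volume.withDensity (fun w => p ‖w‖)

theorem radialMeasure_absolutelyContinuous (p : ℝ → ENNReal) : radialMeasure E p ≪ volume :=
  withDensity_absolutelyContinuous _ _

theorem exists_stdGaussian_eq_radialMeasure :
    ∃ p : ℝ → ENNReal, Measurable p ∧ stdGaussian E = radialMeasure E p :=
  ⟨fun r => ENNReal.ofReal ((2 * Real.pi * 1 ^ 2) ^ (-(Module.finrank ℝ E : ℝ) / 2) *
    Real.exp (-(r ^ 2) / (2 * 1 ^ 2))), by fun_prop, stdGaussian_eq_withDensity⟩

variable {p : ℝ → ENNReal}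

theorem measurePreserving_radialMeasure (hp : Measurable p) (e : E ≃ₗᵢ[ℝ] E) :
    MeasurePreserving e (radialMeasure E p) (radialMeasure E p) := by
  refine ⟨e.continuous.measurable, ?_⟩
  simpa [radialMeasure] using map_withDensity_of_map_eq_smul (h := fun w : E => p ‖w‖)
    (by fun_prop) e.toContinuousLinearEquiv (k := 1) (by simpa using e.measurePreserving.map_eq)

theorem charFun_radialMeasure_congr (hp : Measurable p) {t t' : E} (h : ‖t‖ = ‖t'‖) :
    charFun (radialMeasure E p) t = charFun (radialMeasure E p) t' := by
  let e := (ℝ ∙ (t - t'))ᗮ.reflection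
  have he : e t = t' := Submodule.reflection_sub h
  rw [charFun_apply, charFun_apply, ← (measurePreserving_radialMeasure hp e).integral_comp
    e.toHomeomorph.measurableEmbedding (fun x => Complex.exp (⟪x, t'⟫ * Complex.I)), ← he]
  simp only [LinearIsometryEquiv.inner_map_map]

theorem radialMeasure_eq_stdGaussian_map (hp : Measurable p)
    [IsProbabilityMeasure (radialMeasure E p)] {a : E} (ha : a ≠ 0) {s : ℝ} (hs : 0 ≤ s)
    (h : (radialMeasure E p).map (fun w => ⟪a, w⟫) = gaussianReal 0 (s ^ 2).toNNReal) :
    radialMeasure E p = (stdGaussian E).map ((s / ‖a‖) • ·) := by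
  have ha' : (‖a‖ : ℂ) ≠ 0 := by exact_mod_cast norm_ne_zero_iff.2 ha
  refine Measure.ext_of_charFun (funext fun t => ?_)
  have hnorm : ‖t‖ = ‖(‖t‖ / ‖a‖) • a‖ := by
    rw [norm_smul, norm_div, norm_norm, norm_norm, div_mul_cancel₀ _ (norm_ne_zero_iff.2 ha)]
  rw [charFun_radialMeasure_congr hp hnorm, ← charFun_map_inner, h, charFun_map_smul,
    charFun_stdGaussian, charFun_gaussianReal, norm_smul, Real.coe_toNNReal _ (by positivity),
    Real.norm_of_nonneg (by positivity)]
  congr 1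
  push_cast
  field_simp
  ring

theorem volume_inner_eq_zero {a : E} (ha : a ≠ 0) : volume {w : E | ⟪a, w⟫ = 0} = 0 := by
  refine Measure.addHaar_submodule (volume : Measure E) (LinearMap.ker (innerₗ E a)) fun htop => ?_
  have hmem : a ∈ LinearMap.ker (innerₗ E a) := htop ▸ Submodule.mem_top
  simp [ha] at hmem

theorem integral_inner_radialMeasure (hp : Measurable p) (a : E) :
    ∫ w, ⟪a, w⟫ ∂radialMeasure E p = 0 := by
  have hneg := (measurePreserving_radialMeasure hp
    (LinearIsometryEquiv.neg ℝ (E := E))).integral_comp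
      (LinearIsometryEquiv.neg ℝ).toHomeomorph.measurableEmbedding fun w => ⟪a, w⟫
  simp only [LinearIsometryEquiv.coe_neg, inner_neg_right, integral_neg] at hneg
  linarith

theorem exists_eq_stdGaussian_map_of_isGaussian [Nontrivial E] (hp : Measurable p)
    [IsGaussian (radialMeasure E p)] :
    ∃ σ : ℝ, 0 < σ ∧ radialMeasure E p = (stdGaussian E).map (σ • ·) := by
  obtain ⟨a, ha⟩ := exists_ne (0 : E)
  have := IsGaussian.toIsProbabilityMeasure (radialMeasure E p)
  set v := Var[innerSL ℝ a; radialMeasure E p].toNNReal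
  have hlaw : (radialMeasure E p).map (fun w => ⟪a, w⟫) = gaussianReal 0 v := by
    have h := IsGaussian.map_eq_gaussianReal (μ := radialMeasure E p) (innerSL ℝ a)
    rwa [show ∫ w, innerSL ℝ a w ∂radialMeasure E p = 0 from integral_inner_radialMeasure hp a]
      at h
  have hv : v ≠ 0 := by
    intro h0
    have hnull : (radialMeasure E p).map (fun w => ⟪a, w⟫) {0} = 0 := by
      rw [Measure.map_apply (by fun_prop) (measurableSet_singleton _)]
      exact radialMeasure_absolutelyContinuous p (volume_inner_eq_zero ha)
    simp [hlaw, h0, gaussianReal_zero_var] at hnull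
  refine ⟨√v / ‖a‖, by positivity,
    radialMeasure_eq_stdGaussian_map hp ha (Real.sqrt_nonneg v) ?_⟩
  rwa [Real.sq_sqrt v.coe_nonneg, Real.toNNReal_coe]

end RadialMeasure

section RadialIntegrability

variable {E : Type*} [NormedAddCommGroup E] [InnerProductSpace ℝ E] [FiniteDimensional ℝ E]
  [MeasurableSpace E] [BorelSpace E] {f : ℝ → ℝ} {r : ℝ}

theorem integrableOn_Ioi_of_integrable_comp_norm_sq (hE : 1 < Module.finrank ℝ E)
    (hf : Measurable f) (hint : Integrable fun w : E => f (‖w‖ ^ 2)) (hr : 0 < r) :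
    IntegrableOn f (Set.Ioi r) := by
  have : Nontrivial E := Module.nontrivial_of_finrank_pos (R := ℝ) (by omega)
  obtain ⟨k, hk⟩ := Nat.exists_eq_add_of_lt hE
  have hpolar : IntegrableOn (fun x => x ^ (k + 1) * f (x ^ 2)) (Set.Ioi 0) := by
    have h := (integrable_fun_norm_addHaar (volume : Measure E) (f := fun x => f (x ^ 2))).1 hint
    rwa [hk, show 1 + k + 1 - 1 = k + 1 by omega] at h
  set g := (Set.Ioi r).indicator f with hg
  have hg_meas : Measurable g := hf.indicator measurableSet_Ioi
  suffices hdom : IntegrableOn (fun x => x ^ ((2 : ℝ) - 1) • g (x ^ (2 : ℝ))) (Set.Ioi 0) by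
    have hgint := (integrableOn_Ioi_comp_rpow_iff' g two_ne_zero).1 hdom
    refine (hgint.mono_set (Set.Ioi_subset_Ioi hr.le)).congr_fun (fun t ht => ?_)
      measurableSet_Ioi
    exact Set.indicator_of_mem ht f
  refine (hpolar.norm.const_mul (√r ^ k)⁻¹).mono' (by fun_prop) ?_
  filter_upwards [ae_restrict_mem measurableSet_Ioi] with x hx
  have hx0 : 0 < x := hx
  rw [show (2 : ℝ) - 1 = 1 by norm_num, Real.rpow_one, Real.rpow_two, hg]
  by_cases hxr : x ^ 2 ∈ Set.Ioi r
  · have hle : √r ^ k ≤ x ^ k := by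
      gcongr
      exact (Real.sqrt_le_left hx0.le).2 (le_of_lt hxr)
    rw [Set.indicator_of_mem hxr, smul_eq_mul, norm_mul, norm_mul, norm_pow,
      Real.norm_of_nonneg hx0.le, inv_mul_eq_div, le_div_iff₀ (by positivity)]
    calc x * ‖f (x ^ 2)‖ * √r ^ k ≤ x * ‖f (x ^ 2)‖ * x ^ k := by gcongr
      _ = x ^ (k + 1) * ‖f (x ^ 2)‖ := by ring
  · rw [Set.indicator_of_notMem hxr, smul_zero, norm_zero]
    positivity

end RadialIntegrability

section Elliptical

variable {ι : Type*} [Fintype ι] {f : ℝ → ℝ}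

theorem ellipticalConst_nonneg (hf : ∀ t, 0 ≤ t → 0 ≤ f t) : 0 ≤ ellipticalConst ι f :=
  inv_nonneg.2 (integral_nonneg fun _ => hf _ (sq_nonneg _))

/-- The radial profile of the spherical density `c f (‖w‖²)`. -/
def sphericalProfile (ι : Type*) [Fintype ι] (f : ℝ → ℝ) (r : ℝ) : ENNReal :=
  ENNReal.ofReal (ellipticalConst ι f * f (r ^ 2))

theorem measurable_sphericalProfile (hf : Measurable f) : Measurable (sphericalProfile ι f) := by
  unfold sphericalProfile
  fun_prop

variable [DecidableEq ι] {A : Matrix ι ι ℝ}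

theorem ellipticalDensity_zero (y : EuclideanSpace ℝ ι) :
    ellipticalDensity 0 A f y = ellipticalConst ι f / √A.det * f (invQuadForm A y) := by
  rw [ellipticalDensity, sub_zero]

theorem measurable_ellipticalDensity (hf : Measurable f) :
    Measurable (ellipticalDensity (0 : EuclideanSpace ℝ ι) A f) := by
  have := (continuous_invQuadForm A).measurable
  simp only [funext (ellipticalDensity_zero (A := A) (f := f))]
  fun_prop

theorem ellipticalDensity_nonneg (hA : A.PosDef) (hf : ∀ t, 0 ≤ t → 0 ≤ f t)
    (y : EuclideanSpace ℝ ι) : 0 ≤ ellipticalDensity 0 A f y := by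
  rw [ellipticalDensity_zero]
  have := ellipticalConst_nonneg (ι := ι) hf
  have := hf _ (invQuadForm_nonneg hA y)
  positivity

theorem map_ellipticalDensity (hA : A.PosDef) (hf : Measurable f)
    {T : EuclideanSpace ℝ ι ≃L[ℝ] EuclideanSpace ℝ ι} (hT : ∀ y, ‖T y‖ ^ 2 = invQuadForm A y)
    (hdet : (volume : Measure (EuclideanSpace ℝ ι)).map T = ENNReal.ofReal √A.det • volume) :
    (volume.withDensity (fun y => ENNReal.ofReal (ellipticalDensity 0 A f y))).map T =
      radialMeasure (EuclideanSpace ℝ ι) (sphericalProfile ι f) := by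
  have hd := Real.sqrt_pos.2 hA.det_pos
  rw [map_withDensity_of_map_eq_smul (measurable_ellipticalDensity hf).ennreal_ofReal T hdet,
    radialMeasure]
  congr 1
  ext w
  rw [sphericalProfile, ← ENNReal.ofReal_mul hd.le, ellipticalDensity_zero, ← hT,
    T.apply_symm_apply]
  congr 1
  field_simp

variable {S : Type*} [MeasurableSpace S] {P : Measure S} {Y : S → EuclideanSpace ℝ ι}

theorem IsElliptical.map_eq_radialMeasure (h : IsElliptical P Y 0 A f)
    {T : EuclideanSpace ℝ ι ≃L[ℝ] EuclideanSpace ℝ ι} (hT : ∀ y, ‖T y‖ ^ 2 = invQuadForm A y)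
    (hdet : (volume : Measure (EuclideanSpace ℝ ι)).map T = ENNReal.ofReal √A.det • volume) :
    (P.map Y).map T = radialMeasure (EuclideanSpace ℝ ι) (sphericalProfile ι f) := by
  rw [h.law, map_ellipticalDensity h.posDef h.measurable_generator hT hdet]

theorem IsElliptical.isProbabilityMeasure_radialMeasure [IsProbabilityMeasure P]
    (h : IsElliptical P Y 0 A f) :
    IsProbabilityMeasure (radialMeasure (EuclideanSpace ℝ ι) (sphericalProfile ι f)) := by
  obtain ⟨T, hT, hdet⟩ := exists_norm_sq_eq_invQuadForm h.posDef
  rw [← h.map_eq_radialMeasure hT hdet]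
  have := Measure.isProbabilityMeasure_map h.aemeasurable
  exact Measure.isProbabilityMeasure_map T.continuous.measurable.aemeasurable

theorem IsElliptical.hasGaussianLaw_iff (h : IsElliptical P Y 0 A f) :
    HasGaussianLaw Y P ↔
      IsGaussian (radialMeasure (EuclideanSpace ℝ ι) (sphericalProfile ι f)) := by
  obtain ⟨T, hT, hdet⟩ := exists_norm_sq_eq_invQuadForm h.posDef
  rw [← h.map_eq_radialMeasure hT hdet]
  constructor
  · intro hY
    have := hY.isGaussian_map
    exact isGaussian_map (T : EuclideanSpace ℝ ι →L[ℝ] EuclideanSpace ℝ ι)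
  · intro hY
    have h1 := isGaussian_map (μ := (P.map Y).map T)
      (T.symm : EuclideanSpace ℝ ι →L[ℝ] EuclideanSpace ℝ ι)
    have hid : (T.symm : EuclideanSpace ℝ ι →L[ℝ] EuclideanSpace ℝ ι) ∘ T = id := by
      ext x : 1
      simp
    rw [Measure.map_map (by fun_prop) (by fun_prop), hid, Measure.map_id] at h1
    exact ⟨h1⟩

theorem IsElliptical.measurePreserving_neg (h : IsElliptical P Y 0 A f) :
    MeasurePreserving Neg.neg (P.map Y) (P.map Y) := by
  refine ⟨measurable_neg, ?_⟩
  have hmap := map_withDensity_of_map_eq_smul (measurable_ellipticalDensity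
    (A := A) h.measurable_generator).ennreal_ofReal
    (ContinuousLinearEquiv.neg ℝ) (k := 1)
    (by rw [one_smul]; exact (Measure.measurePreserving_neg volume).map_eq)
  rw [h.law]
  refine hmap.trans ?_
  congr 1
  ext y
  rw [one_mul, ellipticalDensity_zero, ellipticalDensity_zero, ← invQuadForm_neg _ y]
  rfl

theorem IsElliptical.ellipticalConst_pos [IsProbabilityMeasure P] (h : IsElliptical P Y 0 A f) :
    0 < ellipticalConst ι f := by
  refine (ellipticalConst_nonneg h.generator_nonneg).lt_of_ne fun h0 => ?_
  have h1 := h.isProbabilityMeasure_radialMeasure.measure_univ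
  simp [radialMeasure, sphericalProfile, ← h0] at h1

theorem IsElliptical.not_ae_eq_zero [Nonempty ι] [IsProbabilityMeasure P]
    (h : IsElliptical P Y 0 A f) : ¬ ∀ᵐ t ∂volume.restrict (Set.Ioi (0 : ℝ)), f t = 0 := by
  intro h0
  have hzero : ∀ᵐ w : EuclideanSpace ℝ ι, f (‖w‖ ^ 2) = 0 :=
    (ae_norm_sq_iff _ (h.measurable_generator (measurableSet_singleton 0))).2 h0
  have hpos := h.ellipticalConst_pos
  rw [ellipticalConst, integral_eq_zero_of_ae hzero] at hpos
  simp at hpos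

theorem IsElliptical.integrable_ellipticalDensity [IsProbabilityMeasure P]
    (h : IsElliptical P Y 0 A f) :
    Integrable (ellipticalDensity (0 : EuclideanSpace ℝ ι) A f) := by
  have h1 := (Measure.isProbabilityMeasure_map h.aemeasurable).measure_univ
  rw [h.law, withDensity_apply _ MeasurableSet.univ, Measure.restrict_univ] at h1
  refine ⟨(measurable_ellipticalDensity h.measurable_generator).aestronglyMeasurable, ?_⟩
  rw [hasFiniteIntegral_iff_ofReal
    (ae_of_all _ (ellipticalDensity_nonneg h.posDef h.generator_nonneg)), h1]
  exact ENNReal.one_lt_top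

theorem IsElliptical.integrable_generator [IsProbabilityMeasure P]
    (h : IsElliptical P Y 0 A f) : Integrable fun w : EuclideanSpace ℝ ι => f (‖w‖ ^ 2) := by
  by_contra hcon
  have := h.ellipticalConst_pos
  rw [ellipticalConst, integral_undef hcon] at this
  simp at this

theorem IsElliptical.integrableOn_generator [Nontrivial ι] [IsProbabilityMeasure P]
    (h : IsElliptical P Y 0 A f) {r : ℝ} (hr : 0 < r) : IntegrableOn f (Set.Ioi r) :=
  integrableOn_Ioi_of_integrable_comp_norm_sq
    (by rw [finrank_euclideanSpace]; exact Fintype.one_lt_card) h.measurable_generator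
    h.integrable_generator hr

end Elliptical

section HalfSpace

open scoped RealInnerProductSpace

variable {E : Type*} [NormedAddCommGroup E] [InnerProductSpace ℝ E] [FiniteDimensional ℝ E]
  [MeasurableSpace E] [BorelSpace E]

theorem measure_inner_pos_eq_half {μ : Measure E} [IsProbabilityMeasure μ] (hac : μ ≪ volume)
    (hneg : MeasurePreserving Neg.neg μ μ) {b : E} (hb : b ≠ 0) :
    μ {w | 0 < ⟪b, w⟫} = 2⁻¹ := by
  have hmeas : MeasurableSet {w : E | 0 < ⟪b, w⟫} := measurableSet_lt (by fun_prop) (by fun_prop)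
  have hreflect : μ {w | ⟪b, w⟫ < 0} = μ {w | 0 < ⟪b, w⟫} := by
    rw [← hneg.measure_preimage hmeas.nullMeasurableSet]
    simp
  have hcompl : μ {w | 0 < ⟪b, w⟫}ᶜ = μ {w | ⟪b, w⟫ < 0} := by
    refine measure_congr ?_
    filter_upwards [measure_eq_zero_iff_ae_notMem.1 (hac (volume_inner_eq_zero hb))] with w hw
    exact propext (not_lt.trans (lt_iff_le_and_ne.trans (and_iff_left hw)).symm)
  have hsum := measure_add_measure_compl (μ := μ) hmeas
  rw [hcompl, hreflect, measure_univ, ← mul_two] at hsum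
  exact ENNReal.eq_inv_of_mul_eq_one_left hsum

theorem cond_map_of_aemeasurable {S F : Type*} [MeasurableSpace S] [MeasurableSpace F]
    {P : Measure S} {Y : S → F} (hY : AEMeasurable Y P) {s : Set F} (hs : MeasurableSet s) :
    (ProbabilityTheory.cond P (Y ⁻¹' s)).map Y = ProbabilityTheory.cond (P.map Y) s := by
  rw [ProbabilityTheory.cond, ProbabilityTheory.cond, Measure.map_smul,
    Measure.restrict_map_of_aemeasurable hY hs, Measure.map_apply_of_aemeasurable hY hs]

end HalfSpace

section SkewLaw

variable {d : ℕ}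

theorem measurable_joinVec :
    Measurable fun q : ℝ × EuclideanSpace ℝ (Fin d) => joinVec q.1 q.2 := by
  unfold joinVec
  refine (PiLp.continuous_toLp 2 _).measurable.comp (measurable_pi_iff.2 ?_)
  rintro (_ | i)
  · exact measurable_fst
  · change Measurable fun q : ℝ × EuclideanSpace ℝ (Fin d) => q.2.ofLp i
    fun_prop

theorem measurable_vecPart : Measurable (vecPart (d := d)) := by
  unfold vecPart
  fun_prop

theorem measurePreserving_joinVec :
    MeasurePreserving (fun q : ℝ × EuclideanSpace ℝ (Fin d) => joinVec q.1 q.2) := by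
  have hcoord := ((volume_preserving_funUnique Unit ℝ).symm).prod
    (PiLp.volume_preserving_ofLp (Fin d))
  exact (PiLp.volume_preserving_toLp (Unit ⊕ Fin d)).comp
    ((volume_measurePreserving_sumPiEquivProdPi_symm fun _ : Unit ⊕ Fin d => ℝ).comp hcoord)

theorem map_vecPart_restrict_withDensity {g : EuclideanSpace ℝ (Unit ⊕ Fin d) → ENNReal}
    (hg : Measurable g) {s : Set ℝ} (hs : MeasurableSet s) :
    ((volume.withDensity g).restrict {y | y.ofLp (Sum.inl ()) ∈ s}).map vecPart =
      volume.withDensity fun z => ∫⁻ u in s, g (joinVec u z) := by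
  have hs' : MeasurableSet {y : EuclideanSpace ℝ (Unit ⊕ Fin d) | y.ofLp (Sum.inl ()) ∈ s} :=
    hs.preimage (by fun_prop)
  ext B hB
  have hB' := measurable_vecPart hB
  have hind : ∀ u z, (vecPart ⁻¹' B ∩ {y | y.ofLp (Sum.inl ()) ∈ s}).indicator g (joinVec u z) =
      (s ×ˢ B).indicator (fun q => g (joinVec q.1 q.2)) (u, z) := by
    intro u z
    classical
    simp only [Set.indicator_apply]
    exact if_congr and_comm rfl rfl
  rw [Measure.map_apply measurable_vecPart hB, Measure.restrict_apply hB',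
    withDensity_apply _ (hB'.inter hs'), ← lintegral_indicator (hB'.inter hs'),
    ← measurePreserving_joinVec.lintegral_comp (hg.indicator (hB'.inter hs')),
    withDensity_apply _ hB, Measure.volume_eq_prod]
  simp_rw [hind]
  rw [lintegral_indicator (hs.prod hB), ← Measure.prod_restrict,
    lintegral_prod_symm _ (by exact (hg.comp measurable_joinVec).aemeasurable)]

theorem integral_comp_sub_div (g : ℝ → ℝ) (m : ℝ) {k : ℝ} (hk : 0 < k) :
    ∫ u, g ((u - m) / k) = k * ∫ x, g x := by
  have hshift := integral_sub_right_eq_self (μ := volume) (fun u => g (u / k)) m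
  rw [hshift, Measure.integral_comp_div, abs_of_pos hk, smul_eq_mul]

theorem setIntegral_Ioi_comp_sub_div (g : ℝ → ℝ) (m : ℝ) {k : ℝ} (hk : 0 < k) :
    ∫ u in Set.Ioi 0, g ((u - m) / k) = k * ∫ x in Set.Ioi (-(m / k)), g x := by
  rw [← integral_indicator measurableSet_Ioi, ← integral_indicator measurableSet_Ioi,
    ← integral_comp_sub_div _ m hk]
  congr 1
  ext u
  have hmem : u ∈ Set.Ioi 0 ↔ (u - m) / k ∈ Set.Ioi (-(m / k)) := by
    rw [Set.mem_Ioi, Set.mem_Ioi, ← neg_div, div_lt_div_iff_of_pos_right hk]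
    constructor <;> intro <;> linarith
  exact if_congr hmem rfl rfl

variable {δ : Fin d → ℝ} {Ωbar : Matrix (Fin d) (Fin d) ℝ} {f : ℝ → ℝ}

/-- The ratio of `f_U (z)` to `∫ f (Q_z + x²) dx`. -/
def marginalConst (δ : Fin d → ℝ) (Ωbar : Matrix (Fin d) (Fin d) ℝ) (f : ℝ → ℝ) : ℝ :=
  ellipticalConst (Unit ⊕ Fin d) f / √(starMatrix δ Ωbar).det * √(1 - δ ⬝ᵥ (Ωbar⁻¹ *ᵥ δ))

theorem marginalDensity_eq (h : (starMatrix δ Ωbar).PosDef) (z : EuclideanSpace ℝ (Fin d)) :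
    marginalDensity δ Ωbar f z =
      marginalConst δ Ωbar f * ∫ x, f (invQuadForm Ωbar z + x ^ 2) := by
  have hκ := Real.sqrt_pos.2 (schurComplement_pos_of_starMatrix h)
  simp only [marginalDensity, ellipticalDensity_zero, invQuadForm_starMatrix h]
  rw [integral_const_mul, integral_comp_sub_div (fun x => f (invQuadForm Ωbar z + x ^ 2)) _ hκ,
    marginalConst]
  ring

theorem setIntegral_ellipticalDensity_joinVec (h : (starMatrix δ Ωbar).PosDef)
    (z : EuclideanSpace ℝ (Fin d)) :
    ∫ u in Set.Ioi 0, ellipticalDensity 0 (starMatrix δ Ωbar) f (joinVec u z) =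
      marginalConst δ Ωbar f * ∫ x in Set.Iic (shapeParam δ Ωbar ⬝ᵥ z.ofLp),
        f (invQuadForm Ωbar z + x ^ 2) := by
  have hκ := Real.sqrt_pos.2 (schurComplement_pos_of_starMatrix h)
  simp only [ellipticalDensity_zero, invQuadForm_starMatrix h]
  rw [integral_const_mul,
    setIntegral_Ioi_comp_sub_div (fun x => f (invQuadForm Ωbar z + x ^ 2)) _ hκ,
    ← shapeParam_dotProduct h, ← integral_comp_neg_Iic, marginalConst]
  simp only [neg_sq]
  ring

theorem marginalDensity_mul_condDistFun (h : (starMatrix δ Ωbar).PosDef)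
    (hf : ∀ t, 0 ≤ t → 0 ≤ f t) {z : EuclideanSpace ℝ (Fin d)}
    (hz : Integrable fun x => f (invQuadForm Ωbar z + x ^ 2)) :
    marginalDensity δ Ωbar f z *
        condDistFun f (invQuadForm Ωbar z) (shapeParam δ Ωbar ⬝ᵥ z.ofLp) =
      ∫ u in Set.Ioi 0, ellipticalDensity 0 (starMatrix δ Ωbar) f (joinVec u z) := by
  have hq := invQuadForm_nonneg (posDef_of_starMatrix h) z
  have hnonneg : ∀ x, 0 ≤ f (invQuadForm Ωbar z + x ^ 2) := fun x => hf _ (by positivity)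
  rw [marginalDensity_eq h, setIntegral_ellipticalDensity_joinVec h, condDistFun]
  simp only [condGenerator]
  rcases eq_or_ne (∫ x, f (invQuadForm Ωbar z + x ^ 2)) 0 with h0 | h0
  · rw [h0, div_zero, mul_zero]
    have hIic : ∫ x in Set.Iic (shapeParam δ Ωbar ⬝ᵥ z.ofLp),
        f (invQuadForm Ωbar z + x ^ 2) = 0 := by
      refine le_antisymm ?_ (integral_nonneg hnonneg)
      rw [← h0]
      exact setIntegral_le_integral hz (ae_of_all _ hnonneg)
    rw [hIic, mul_zero]
  · field_simp

variable {S : Type*} [MeasurableSpace S] {P : Measure S}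
  {Ustar : S → EuclideanSpace ℝ (Unit ⊕ Fin d)}

theorem skewLaw_eq_map_cond (hU : AEMeasurable Ustar P) :
    skewLaw P Ustar =
      (ProbabilityTheory.cond (P.map Ustar) {y | 0 < y.ofLp (Sum.inl ())}).map vecPart := by
  have hpos : MeasurableSet {y : EuclideanSpace ℝ (Unit ⊕ Fin d) | 0 < y.ofLp (Sum.inl ())} :=
    measurableSet_lt measurable_const (by fun_prop)
  rw [← cond_map_of_aemeasurable hU hpos, AEMeasurable.map_map_of_aemeasurable
    measurable_vecPart.aemeasurable (hU.mono_ac cond_absolutelyContinuous)]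
  rfl

variable [IsProbabilityMeasure P]

theorem IsElliptical.marginalConst_pos (hU : IsElliptical P Ustar 0 (starMatrix δ Ωbar) f) :
    0 < marginalConst δ Ωbar f := by
  have := hU.ellipticalConst_pos
  have := Real.sqrt_pos.2 hU.posDef.det_pos
  have := Real.sqrt_pos.2 (schurComplement_pos_of_starMatrix hU.posDef)
  unfold marginalConst
  positivity

theorem IsElliptical.ae_integrable_joinVec (hU : IsElliptical P Ustar 0 (starMatrix δ Ωbar) f) :
    ∀ᵐ z : EuclideanSpace ℝ (Fin d), Integrable fun u : ℝ =>
      ellipticalDensity 0 (starMatrix δ Ωbar) f (joinVec u z) :=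
  (measurePreserving_joinVec.integrable_comp_of_integrable
    hU.integrable_ellipticalDensity).prod_left_ae

theorem IsElliptical.ae_integrable_condGenerator
    (hU : IsElliptical P Ustar 0 (starMatrix δ Ωbar) f) :
    ∀ᵐ z : EuclideanSpace ℝ (Fin d), Integrable fun x => f (invQuadForm Ωbar z + x ^ 2) := by
  have hκ := Real.sqrt_pos.2 (schurComplement_pos_of_starMatrix hU.posDef)
  have hc := hU.ellipticalConst_pos
  have hdet := Real.sqrt_pos.2 hU.posDef.det_pos
  filter_upwards [hU.ae_integrable_joinVec] with z hz
  simp only [ellipticalDensity_zero, invQuadForm_starMatrix hU.posDef] at hz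
  have h1 := (integrable_const_mul_iff (IsUnit.mk0 _ (div_pos hc hdet).ne') _).1 hz
  have h2 := h1.comp_add_right (δ ⬝ᵥ (Ωbar⁻¹ *ᵥ z.ofLp))
  simp only [add_sub_cancel_right] at h2
  have h3 := h2.comp_mul_left' hκ.ne'
  refine h3.congr (ae_of_all _ fun x => ?_)
  simp only
  rw [mul_div_cancel_left₀ _ hκ.ne']

theorem IsElliptical.map_vecPart (hU : IsElliptical P Ustar 0 (starMatrix δ Ωbar) f) :
    (P.map Ustar).map vecPart =
      volume.withDensity fun z => ENNReal.ofReal (marginalDensity δ Ωbar f z) := by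
  have hmap := map_vecPart_restrict_withDensity (measurable_ellipticalDensity
    (A := starMatrix δ Ωbar) hU.measurable_generator).ennreal_ofReal MeasurableSet.univ
  simp only [Set.mem_univ, Set.ofPred_true, Measure.restrict_univ] at hmap
  rw [hU.law, hmap]
  refine withDensity_congr_ae ?_
  filter_upwards [hU.ae_integrable_joinVec] with z hz
  rw [marginalDensity, ofReal_integral_eq_lintegral_ofReal hz
    (ae_of_all _ fun u => ellipticalDensity_nonneg hU.posDef hU.generator_nonneg _)]

theorem IsElliptical.measure_pos_eq_half (hU : IsElliptical P Ustar 0 (starMatrix δ Ωbar) f) :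
    P.map Ustar {y | 0 < y.ofLp (Sum.inl ())} = 2⁻¹ := by
  have := Measure.isProbabilityMeasure_map hU.aemeasurable
  have hac : P.map Ustar ≪ volume := hU.law ▸ withDensity_absolutelyContinuous _ _
  simpa [EuclideanSpace.inner_single_left] using measure_inner_pos_eq_half hac
    hU.measurePreserving_neg
    (b := EuclideanSpace.single (Sum.inl () : Unit ⊕ Fin d) (1 : ℝ)) (by simp)

theorem IsElliptical.skewLaw_eq (hU : IsElliptical P Ustar 0 (starMatrix δ Ωbar) f) :
    skewLaw P Ustar = volume.withDensity fun z => ENNReal.ofReal (2 * marginalDensity δ Ωbar f z *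
      condDistFun f (invQuadForm Ωbar z) (shapeParam δ Ωbar ⬝ᵥ z.ofLp)) := by
  have hmap := map_vecPart_restrict_withDensity (measurable_ellipticalDensity
    (A := starMatrix δ Ωbar) hU.measurable_generator).ennreal_ofReal
    (measurableSet_Ioi (a := (0 : ℝ)))
  rw [skewLaw_eq_map_cond hU.aemeasurable, ProbabilityTheory.cond, hU.measure_pos_eq_half,
    inv_inv, Measure.map_smul, hU.law]
  refine (congrArg ((2 : ENNReal) • ·) hmap).trans ?_
  rw [← withDensity_smul' _ _ (by simp)]
  refine withDensity_congr_ae ?_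
  filter_upwards [hU.ae_integrable_joinVec, hU.ae_integrable_condGenerator] with z hz hz'
  rw [Pi.smul_apply, smul_eq_mul, mul_assoc,
    marginalDensity_mul_condDistFun hU.posDef hU.generator_nonneg hz',
    ENNReal.ofReal_mul zero_le_two, ofReal_integral_eq_lintegral_ofReal hz.integrableOn
      (ae_of_all _ fun u => ellipticalDensity_nonneg hU.posDef hU.generator_nonneg _),
    ENNReal.ofReal_ofNat]

end SkewLaw

section GaussianGenerator

variable {ι : Type*} [Fintype ι] [DecidableEq ι] {A : Matrix ι ι ℝ} {f : ℝ → ℝ}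
  {S : Type*} [MeasurableSpace S] {P : Measure S} [IsProbabilityMeasure P]
  {Y : S → EuclideanSpace ℝ ι}

theorem IsElliptical.generator_eq_exp_of_hasGaussianLaw [Nonempty ι]
    (h : IsElliptical P Y 0 A f) (hY : HasGaussianLaw Y P) :
    ∃ σ a : ℝ, 0 < σ ∧ 0 < a ∧
      ∀ᵐ t ∂volume.restrict (Set.Ioi (0 : ℝ)), f t = a * Real.exp (-(1 / (2 * σ ^ 2)) * t) := by
  have := h.hasGaussianLaw_iff.1 hY
  have := h.isProbabilityMeasure_radialMeasure
  have hc := h.ellipticalConst_pos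
  have hf := h.measurable_generator
  have hprof := measurable_sphericalProfile (ι := ι) hf
  obtain ⟨σ, hσ, hlaw⟩ :=
    exists_eq_stdGaussian_map_of_isGaussian (E := EuclideanSpace ℝ ι) hprof
  rw [stdGaussian_map_smul hσ, radialMeasure] at hlaw
  have hdens := (withDensity_eq_iff_of_sigmaFinite (by fun_prop)
    (continuous_isotropicGaussianDensity σ).measurable.ennreal_ofReal.aemeasurable).1 hlaw
  set k := (2 * Real.pi * σ ^ 2) ^ (-(Module.finrank ℝ (EuclideanSpace ℝ ι) : ℝ) / 2) with hk
  have hk_pos : 0 < k := by positivity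
  refine ⟨σ, k / ellipticalConst ι f, hσ, div_pos hk_pos hc,
    (ae_norm_sq_iff (EuclideanSpace ℝ ι) (measurableSet_eq_fun hf (by fun_prop))).1 ?_⟩
  filter_upwards [hdens] with w hw
  have hf0 := h.generator_nonneg (‖w‖ ^ 2) (by positivity)
  rw [sphericalProfile, ENNReal.ofReal_eq_ofReal_iff (by positivity)
    (isotropicGaussianDensity_pos hσ w).le, isotropicGaussianDensity, ← hk] at hw
  rw [neg_mul, one_div_mul_eq_div, ← neg_div, div_mul_eq_mul_div, ← hw,
    mul_div_cancel_left₀ _ hc.ne']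

theorem eq_one_of_lintegral_const_mul {α : Type*} [MeasurableSpace α] {μ : Measure α} {g h : α → ℝ}
    {k : ℝ} (hgh : ∀ᵐ x ∂μ, g x = k * h x) (hk : 0 ≤ k)
    (hg : ∫⁻ x, ENNReal.ofReal (g x) ∂μ = 1) (hh : ∫⁻ x, ENNReal.ofReal (h x) ∂μ = 1) : k = 1 := by
  have hmul : ∫⁻ x, ENNReal.ofReal (g x) ∂μ = ENNReal.ofReal k * ∫⁻ x, ENNReal.ofReal (h x) ∂μ := by
    rw [← lintegral_const_mul' _ _ ENNReal.ofReal_ne_top]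
    refine lintegral_congr_ae ?_
    filter_upwards [hgh] with x hx
    rw [hx, ENNReal.ofReal_mul hk]
  rw [hg, hh, mul_one] at hmul
  exact ENNReal.ofReal_eq_one.1 hmul.symm

theorem lintegral_isotropicGaussianDensity {E : Type*} [NormedAddCommGroup E]
    [InnerProductSpace ℝ E] [FiniteDimensional ℝ E] [MeasurableSpace E] [BorelSpace E] {σ : ℝ}
    (hσ : 0 < σ) : ∫⁻ w : E, ENNReal.ofReal (isotropicGaussianDensity E σ w) = 1 := by
  have := isGaussian_stdGaussian_map_smul (E := E) σ
  have huniv := (IsGaussian.toIsProbabilityMeasure ((stdGaussian E).map (σ • ·))).measure_univ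
  rwa [stdGaussian_map_smul hσ, withDensity_apply _ MeasurableSet.univ,
    Measure.restrict_univ] at huniv

theorem IsElliptical.lintegral_sphericalProfile (h : IsElliptical P Y 0 A f) :
    ∫⁻ w : EuclideanSpace ℝ ι, sphericalProfile ι f ‖w‖ = 1 := by
  have huniv := h.isProbabilityMeasure_radialMeasure.measure_univ
  rwa [radialMeasure, withDensity_apply _ MeasurableSet.univ, Measure.restrict_univ] at huniv

theorem IsElliptical.radialMeasure_eq_of_generator_eq_exp [Nonempty ι]
    (h : IsElliptical P Y 0 A f) {a c : ℝ} (ha : 0 < a) (hc : 0 < c)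
    (hf : ∀ᵐ t ∂volume.restrict (Set.Ioi (0 : ℝ)), f t = a * Real.exp (-c * t)) :
    radialMeasure (EuclideanSpace ℝ ι) (sphericalProfile ι f) =
      (stdGaussian (EuclideanSpace ℝ ι)).map (√(1 / (2 * c)) • ·) := by
  have hconst := h.ellipticalConst_pos
  set σ := √(1 / (2 * c))
  have hσ : 0 < σ := Real.sqrt_pos.2 (by positivity)
  have hσ_sq : σ ^ 2 = 1 / (2 * c) := Real.sq_sqrt (by positivity)
  set k := (2 * Real.pi * σ ^ 2) ^ (-(Module.finrank ℝ (EuclideanSpace ℝ ι) : ℝ) / 2) with hk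
  have hk_pos : 0 < k := by positivity
  have hdens : ∀ᵐ w : EuclideanSpace ℝ ι, ellipticalConst ι f * f (‖w‖ ^ 2) =
      (ellipticalConst ι f * a / k) * isotropicGaussianDensity (EuclideanSpace ℝ ι) σ w := by
    filter_upwards [(ae_norm_sq_iff (EuclideanSpace ℝ ι)
      (measurableSet_eq_fun h.measurable_generator (by fun_prop))).2 hf] with w hw
    have hexp : -(‖w‖ ^ 2) / (2 * (1 / (2 * c))) = -c * ‖w‖ ^ 2 := by field_simp
    rw [hw, isotropicGaussianDensity, ← hk, hσ_sq, hexp]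
    field_simp
  have hone := eq_one_of_lintegral_const_mul hdens (by positivity) h.lintegral_sphericalProfile
    (lintegral_isotropicGaussianDensity hσ)
  rw [stdGaussian_map_smul hσ]
  refine withDensity_congr_ae ?_
  filter_upwards [hdens] with w hw
  rw [sphericalProfile, hw, hone, one_mul]

theorem IsElliptical.hasGaussianLaw_of_generator_eq_exp [Nonempty ι]
    (h : IsElliptical P Y 0 A f) {a c : ℝ} (ha : 0 < a) (hc : 0 < c)
    (hf : ∀ᵐ t ∂volume.restrict (Set.Ioi (0 : ℝ)), f t = a * Real.exp (-c * t)) :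
    HasGaussianLaw Y P := by
  rw [h.hasGaussianLaw_iff, h.radialMeasure_eq_of_generator_eq_exp ha hc hf]
  exact isGaussian_stdGaussian_map_smul _

theorem cdf_gaussianReal_eq_setIntegral {v : NNReal} (hv : v ≠ 0) (y : ℝ) :
    cdf (gaussianReal 0 v) y = ∫ x in Set.Iic y, gaussianPDFReal 0 v x := by
  rw [cdf_eq_real, measureReal_def, gaussianReal_apply_eq_integral 0 hv,
    ENNReal.toReal_ofReal (integral_nonneg fun x => gaussianPDFReal_nonneg _ _ _)]

theorem cdf_gaussianReal_zero_sq {σ : ℝ} (hσ : 0 < σ) (x : ℝ) :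
    cdf (gaussianReal 0 (σ ^ 2).toNNReal) x = cdf (gaussianReal 0 1) (x / σ) := by
  have h : gaussianReal 0 (σ ^ 2).toNNReal = (gaussianReal 0 1).map (σ * ·) := by
    rw [gaussianReal_map_const_mul]
    congr 1
    · rw [mul_zero]
    · rw [mul_one]
      exact Real.toNNReal_of_nonneg (sq_nonneg σ)
  rw [cdf_eq_real, cdf_eq_real, measureReal_def, measureReal_def, h,
    Measure.map_apply (by fun_prop) measurableSet_Iic]
  congr 2
  ext y
  simp only [Set.mem_preimage, Set.mem_Iic]
  rw [le_div_iff₀ hσ, mul_comm]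

theorem condDistFun_eq_cdf_gaussianReal {σ a q : ℝ} (hfm : Measurable f) (hσ : 0 < σ) (ha : 0 < a)
    (hq : 0 ≤ q)
    (hf : ∀ᵐ t ∂volume.restrict (Set.Ioi (0 : ℝ)), f t = a * Real.exp (-(1 / (2 * σ ^ 2)) * t))
    (y : ℝ) :
    condDistFun f q y = cdf (gaussianReal 0 (σ ^ 2).toNNReal) y := by
  have hv : (σ ^ 2).toNNReal ≠ 0 := by simpa using hσ.ne'
  set k := a * Real.exp (-(1 / (2 * σ ^ 2)) * q) * √(2 * Real.pi * σ ^ 2) with hk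
  have hk_pos : 0 < k := by positivity
  have hae : ∀ᵐ x : ℝ, condGenerator f q (x ^ 2) = k * gaussianPDFReal 0 (σ ^ 2).toNNReal x := by
    filter_upwards [ae_comp_add_sq (measurableSet_eq_fun hfm (by fun_prop)) hf hq] with x hx
    rw [condGenerator, hx, gaussianPDFReal, hk, Real.coe_toNNReal _ (by positivity), mul_add,
      Real.exp_add, sub_zero]
    have hexp : -(1 / (2 * σ ^ 2)) * x ^ 2 = -x ^ 2 / (2 * σ ^ 2) := by ring
    rw [hexp]
    field_simp
  rw [condDistFun, integral_congr_ae hae, setIntegral_congr_ae measurableSet_Iic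
    (hae.mono fun x hx _ => hx), integral_const_mul, integral_const_mul,
    integral_gaussianPDFReal_eq_one 0 hv, cdf_gaussianReal_eq_setIntegral hv]
  field_simp

theorem integral_comp_add_sq_of_eq_exp {a c q : ℝ} (hfm : Measurable f) (hq : 0 ≤ q)
    (hf : ∀ᵐ t ∂volume.restrict (Set.Ioi (0 : ℝ)), f t = a * Real.exp (-c * t)) :
    ∫ x, f (q + x ^ 2) = a * √(Real.pi / c) * Real.exp (-c * q) := by
  have hae : ∀ᵐ x : ℝ, f (q + x ^ 2) = a * Real.exp (-c * q) * Real.exp (-c * x ^ 2) := by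
    filter_upwards [ae_comp_add_sq (measurableSet_eq_fun hfm (by fun_prop)) hf hq] with x hx
    rw [hx, mul_add, Real.exp_add, mul_assoc]
  rw [integral_congr_ae hae, integral_const_mul, integral_gaussian]
  ring

end GaussianGenerator

section NormalDensity

variable {d : ℕ} {A : Matrix (Fin d) (Fin d) ℝ}

theorem continuous_normalDensity : Continuous (normalDensity A) := by
  have := continuous_invQuadForm A
  unfold normalDensity
  fun_prop

theorem map_normalDensity (hA : A.PosDef)
    {T : EuclideanSpace ℝ (Fin d) ≃L[ℝ] EuclideanSpace ℝ (Fin d)}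
    (hT : ∀ y, ‖T y‖ ^ 2 = invQuadForm A y)
    (hdet : (volume : Measure (EuclideanSpace ℝ (Fin d))).map T =
      ENNReal.ofReal √A.det • volume) :
    (volume.withDensity fun z => ENNReal.ofReal (normalDensity A z)).map T =
      stdGaussian (EuclideanSpace ℝ (Fin d)) := by
  have hd := Real.sqrt_pos.2 hA.det_pos
  rw [map_withDensity_of_map_eq_smul continuous_normalDensity.measurable.ennreal_ofReal T hdet,
    stdGaussian_eq_withDensity]
  congr 1
  ext w
  rw [← ENNReal.ofReal_mul hd.le, normalDensity, isotropicGaussianDensity, ← hT,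
    T.apply_symm_apply, finrank_euclideanSpace, Fintype.card_fin, one_pow, mul_one, mul_one]
  congr 1
  field_simp

theorem lintegral_normalDensity (hA : A.PosDef) :
    ∫⁻ z, ENNReal.ofReal (normalDensity A z) = 1 := by
  obtain ⟨T, hT, hdet⟩ := exists_norm_sq_eq_invQuadForm hA
  have huniv := measure_univ (μ := stdGaussian (EuclideanSpace ℝ (Fin d)))
  rwa [← map_normalDensity hA hT hdet,
    Measure.map_apply T.continuous.measurable MeasurableSet.univ, Set.preimage_univ,
    withDensity_apply _ MeasurableSet.univ, Measure.restrict_univ] at huniv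

end NormalDensity

section SkewNormal

variable {d : ℕ} {δ : Fin d → ℝ} {Ωbar : Matrix (Fin d) (Fin d) ℝ} {f : ℝ → ℝ}
  {S : Type*} [MeasurableSpace S] {P : Measure S} [IsProbabilityMeasure P]
  {Ustar : S → EuclideanSpace ℝ (Unit ⊕ Fin d)}

theorem IsElliptical.lintegral_marginalDensity
    (hU : IsElliptical P Ustar 0 (starMatrix δ Ωbar) f) :
    ∫⁻ z, ENNReal.ofReal (marginalDensity δ Ωbar f z) = 1 := by
  have := Measure.isProbabilityMeasure_map hU.aemeasurable
  have huniv := (Measure.isProbabilityMeasure_map (μ := P.map Ustar)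
    measurable_vecPart.aemeasurable).measure_univ
  rwa [hU.map_vecPart, withDensity_apply _ MeasurableSet.univ, Measure.restrict_univ] at huniv

theorem IsElliptical.marginalDensity_eq_normalDensity
    (hU : IsElliptical P Ustar 0 (starMatrix δ Ωbar) f) {σ a : ℝ} (hσ : 0 < σ) (ha : 0 < a)
    (hf : ∀ᵐ t ∂volume.restrict (Set.Ioi (0 : ℝ)), f t = a * Real.exp (-(1 / (2 * σ ^ 2)) * t))
    (z : EuclideanSpace ℝ (Fin d)) :
    marginalDensity δ Ωbar f z = normalDensity (σ ^ 2 • Ωbar) z := by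
  have hΩ := posDef_of_starMatrix hU.posDef
  have hσ_sq : 0 < σ ^ 2 := by positivity
  have hΩσ : (σ ^ 2 • Ωbar).PosDef := hΩ.smul hσ_sq
  have hc := hU.marginalConst_pos
  have hdet := Real.sqrt_pos.2 hΩσ.det_pos
  set k := marginalConst δ Ωbar f * (a * √(Real.pi / (1 / (2 * σ ^ 2)))) /
    ((2 * Real.pi) ^ (-(d : ℝ) / 2) / √(σ ^ 2 • Ωbar).det) with hk
  have hk_pos : 0 < k := by positivity
  have hmul : ∀ z, marginalDensity δ Ωbar f z = k * normalDensity (σ ^ 2 • Ωbar) z := by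
    intro z
    rw [marginalDensity_eq hU.posDef,
      integral_comp_add_sq_of_eq_exp hU.measurable_generator (invQuadForm_nonneg hΩ z) hf,
      normalDensity, invQuadForm_smul hσ_sq.ne' hΩ, hk]
    have hexp : -((σ ^ 2)⁻¹ * invQuadForm Ωbar z) / 2 =
        -(1 / (2 * σ ^ 2)) * invQuadForm Ωbar z := by
      field_simp
    rw [hexp]
    field_simp
  rw [hmul, eq_one_of_lintegral_const_mul (ae_of_all _ hmul) hk_pos.le
    hU.lintegral_marginalDensity (lintegral_normalDensity hΩσ), one_mul]

theorem IsElliptical.isSkewNormal_of_generator_eq_exp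
    (hU : IsElliptical P Ustar 0 (starMatrix δ Ωbar) f) (hdiag : ∀ i, Ωbar i i = 1)
    {σ a : ℝ} (hσ : 0 < σ) (ha : 0 < a)
    (hf : ∀ᵐ t ∂volume.restrict (Set.Ioi (0 : ℝ)), f t = a * Real.exp (-(1 / (2 * σ ^ 2)) * t)) :
    IsSkewNormal (skewLaw P Ustar) 0 (σ ^ 2 • Ωbar) (shapeParam δ Ωbar) := by
  have hΩ := posDef_of_starMatrix hU.posDef
  refine ⟨hΩ.smul (by positivity), ?_⟩
  rw [hU.skewLaw_eq]
  congr 1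
  ext z
  rw [condDistFun_eq_cdf_gaussianReal hU.measurable_generator hσ ha (invQuadForm_nonneg hΩ z) hf,
    hU.marginalDensity_eq_normalDensity hσ ha hf, skewNormalDensity, sub_zero,
    cdf_gaussianReal_zero_sq hσ]
  congr 3
  simp only [Matrix.smul_apply, hdiag, smul_eq_mul, mul_one, Real.sqrt_sq hσ.le, dotProduct,
    Finset.sum_div, mul_div_assoc]

theorem IsElliptical.exists_condDistFun_eq_cdf (hU : IsElliptical P Ustar 0 (starMatrix δ Ωbar) f)
    (hG : HasGaussianLaw Ustar P) :
    ∃ ν : Measure ℝ, IsProbabilityMeasure ν ∧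
      ∀ (z : EuclideanSpace ℝ (Fin d)) (y : ℝ),
        condDistFun f (invQuadForm Ωbar z) y = cdf ν y := by
  obtain ⟨σ, a, hσ, ha, hf⟩ := hU.generator_eq_exp_of_hasGaussianLaw hG
  exact ⟨gaussianReal 0 (σ ^ 2).toNNReal, inferInstance, fun z y =>
    condDistFun_eq_cdf_gaussianReal hU.measurable_generator hσ ha
      (invQuadForm_nonneg (posDef_of_starMatrix hU.posDef) z) hf y⟩

theorem IsElliptical.exists_isSkewNormal_of_hasGaussianLaw
    (hU : IsElliptical P Ustar 0 (starMatrix δ Ωbar) f) (hdiag : ∀ i, Ωbar i i = 1)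
    (hG : HasGaussianLaw Ustar P) :
    ∃ σ : ℝ, 0 < σ ∧ IsSkewNormal (skewLaw P Ustar) 0 (σ ^ 2 • Ωbar) (shapeParam δ Ωbar) := by
  obtain ⟨σ, a, hσ, ha, hf⟩ := hU.generator_eq_exp_of_hasGaussianLaw hG
  exact ⟨σ, hσ, hU.isSkewNormal_of_generator_eq_exp hdiag hσ ha hf⟩

end SkewNormal

section AxisSlicing

open scoped RealInnerProductSpace

theorem inner_single_joinVec {n : ℕ} (y : ℝ) (w : EuclideanSpace ℝ (Fin n)) :
    ⟪EuclideanSpace.single (Sum.inl ()) (1 : ℝ), joinVec y w⟫ = y := by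
  simp [EuclideanSpace.inner_single_left, joinVec]

theorem norm_sq_joinVec {n : ℕ} (y : ℝ) (w : EuclideanSpace ℝ (Fin n)) :
    ‖joinVec y w‖ ^ 2 = y ^ 2 + ‖w‖ ^ 2 := by
  simp [EuclideanSpace.norm_sq_eq, joinVec, Fintype.sum_sum_type]

variable {E : Type*} [NormedAddCommGroup E] [InnerProductSpace ℝ E] [FiniteDimensional ℝ E]

theorem exists_linearIsometryEquiv_apply_eq_single {n : ℕ} (hn : Module.finrank ℝ E = 1 + n)
    {e : E} (he : ‖e‖ = 1) :
    ∃ L : E ≃ₗᵢ[ℝ] EuclideanSpace ℝ (Unit ⊕ Fin n),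
      L e = EuclideanSpace.single (Sum.inl ()) 1 := by
  have horth : Orthonormal ℝ (({Sum.inl ()} : Set (Unit ⊕ Fin n)).domRestrict fun _ => e) :=
    ⟨fun _ => he, fun i j hij => (hij (Subsingleton.elim i j)).elim⟩
  obtain ⟨b, hb⟩ := horth.exists_orthonormalBasis_extension_of_card_eq (by simpa using hn)
  exact ⟨b.repr, by rw [← hb _ rfl, b.repr_self]⟩

theorem exists_inner_eq_inner_symm (T : E ≃L[ℝ] E) (a : E) : ∃ b, ∀ w, ⟪b, w⟫ = ⟪a, T.symm w⟫ :=
  ⟨(T.symm : E →L[ℝ] E).adjoint a, fun w => by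
    rw [ContinuousLinearMap.adjoint_inner_left, ContinuousLinearEquiv.coe_coe]⟩

variable [MeasurableSpace E] [BorelSpace E] {p : ℝ → ℝ → Prop}

theorem ae_ae_of_ae_inner_norm_sq_of_norm_eq_one (hE : 2 ≤ Module.finrank ℝ E)
    (hp : MeasurableSet {x : ℝ × ℝ | p x.1 x.2}) {e : E} (he : ‖e‖ = 1)
    (h : ∀ᵐ s : E, p ⟪e, s⟫ (‖s‖ ^ 2)) :
    ∀ᵐ y : ℝ, ∀ᵐ q ∂volume.restrict (Set.Ioi (0 : ℝ)), y ^ 2 < q → p y q := by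
  obtain ⟨n, hn⟩ : ∃ n, Module.finrank ℝ E = 1 + (n + 1) := ⟨Module.finrank ℝ E - 2, by omega⟩
  obtain ⟨L, hL⟩ := exists_linearIsometryEquiv_apply_eq_single hn he
  have hslice : ∀ᵐ x : ℝ × EuclideanSpace ℝ (Fin (n + 1)), p x.1 (x.1 ^ 2 + ‖x.2‖ ^ 2) := by
    filter_upwards [(L.symm.measurePreserving.comp
      measurePreserving_joinVec).quasiMeasurePreserving.ae h] with x hx
    rwa [Function.comp_apply, L.symm.norm_map, norm_sq_joinVec, ← L.inner_map_map,
      L.apply_symm_apply, hL, inner_single_joinVec] at hx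
  filter_upwards [Measure.ae_ae_of_ae_prod hslice] with y hy
  have hshift := (ae_norm_sq_iff _ (p := fun t => p y (y ^ 2 + t))
    (hp.preimage (by fun_prop : Measurable fun t => (y, y ^ 2 + t)))).1 hy
  rw [ae_restrict_iff' measurableSet_Ioi] at hshift ⊢
  filter_upwards [(measurePreserving_sub_right volume (y ^ 2)).quasiMeasurePreserving.ae hshift]
    with q hq _ hyq
  simpa using hq (sub_pos.2 hyq)

theorem ae_ae_of_ae_inner_norm_sq (hE : 2 ≤ Module.finrank ℝ E)
    (hp : MeasurableSet {x : ℝ × ℝ | p x.1 x.2}) {b : E} (hb : b ≠ 0)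
    (h : ∀ᵐ s : E, p ⟪b, s⟫ (‖s‖ ^ 2)) :
    ∀ᵐ y : ℝ, ∀ᵐ q ∂volume.restrict (Set.Ioi (0 : ℝ)), y ^ 2 < ‖b‖ ^ 2 * q → p y q := by
  have hb0 : 0 < ‖b‖ := norm_pos_iff.2 hb
  have hunit := ae_ae_of_ae_inner_norm_sq_of_norm_eq_one (p := fun y q => p (‖b‖ * y) q) hE
    (hp.preimage (by fun_prop : Measurable fun x : ℝ × ℝ => (‖b‖ * x.1, x.2)))
    (norm_smul_inv_norm (𝕜 := ℝ) hb) (by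
      filter_upwards [h] with s hs
      simpa [real_inner_smul_left, hb0.ne'] using hs)
  have hscale := (Measure.quasiMeasurePreserving_smul volume (inv_ne_zero hb0.ne')).ae hunit
  filter_upwards [hscale] with y hy
  filter_upwards [hy] with q hq hyq
  simpa [hb0.ne'] using hq (by
    rw [smul_eq_mul, mul_pow, inv_pow, inv_mul_lt_iff₀ (by positivity)]
    exact hyq)

end AxisSlicing

section Transport

open scoped RealInnerProductSpace

variable {E : Type*} [NormedAddCommGroup E] [InnerProductSpace ℝ E] [FiniteDimensional ℝ E]
  [MeasurableSpace E] [BorelSpace E]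

theorem ae_comp_symm_of_map_eq_smul {T : E ≃L[ℝ] E} {k : ENNReal} (hk : k ≠ 0)
    (hT : (volume : Measure E).map T = k • volume) {p : E → Prop} (h : ∀ᵐ z : E, p z) :
    ∀ᵐ w : E, p (T.symm w) := by
  have hmap : ∀ᵐ w ∂((volume : Measure E).map T), p (T.symm w) := by
    refine T.toHomeomorph.measurableEmbedding.ae_map_iff.2 ?_
    simpa using h
  rwa [hT, Measure.ae_ennreal_smul_measure_iff hk] at hmap

variable {ι : Type*} [Fintype ι] [DecidableEq ι] {A : Matrix ι ι ℝ}

theorem exists_standardizingMap (hA : A.PosDef) :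
    ∃ T : EuclideanSpace ℝ ι ≃L[ℝ] EuclideanSpace ℝ ι,
      (∀ w, invQuadForm A (T.symm w) = ‖w‖ ^ 2) ∧
      ∀ p : EuclideanSpace ℝ ι → Prop, (∀ᵐ z, p z) → ∀ᵐ w, p (T.symm w) := by
  obtain ⟨T, hT, hdet⟩ := exists_norm_sq_eq_invQuadForm hA
  have hdet0 : ENNReal.ofReal √A.det ≠ 0 := by simpa using Real.sqrt_pos.2 hA.det_pos
  exact ⟨T, fun w => by rw [← hT, T.apply_symm_apply],
    fun _ => ae_comp_symm_of_map_eq_smul hdet0 hdet⟩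

theorem ae_Ioi_of_ae_invQuadForm [Nonempty ι] (hA : A.PosDef) {p : ℝ → Prop}
    (hp : MeasurableSet {t | p t}) (h : ∀ᵐ z : EuclideanSpace ℝ ι, p (invQuadForm A z)) :
    ∀ᵐ t ∂volume.restrict (Set.Ioi (0 : ℝ)), p t := by
  obtain ⟨T, hT, hae⟩ := exists_standardizingMap hA
  refine (ae_norm_sq_iff (EuclideanSpace ℝ ι) hp).1 ?_
  simpa only [hT] using hae _ h

end Transport

section Rigidity

open scoped RealInnerProductSpace

theorem inner_toLp {ι : Type*} [Fintype ι] (x : ι → ℝ) (y : EuclideanSpace ℝ ι) :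
    ⟪WithLp.toLp 2 x, y⟫ = x ⬝ᵥ y.ofLp := by
  rw [EuclideanSpace.inner_eq_star_dotProduct, star_trivial, dotProduct_comm]

variable {f : ℝ → ℝ}

theorem measurable_condDistFun (hf : Measurable f) :
    Measurable fun x : ℝ × ℝ => condDistFun f x.2 x.1 := by
  have hgen : Measurable fun v : (ℝ × ℝ) × ℝ => condGenerator f v.1.2 (v.2 ^ 2) :=
    hf.comp (by fun_prop)
  have hle : MeasurableSet {v : (ℝ × ℝ) × ℝ | v.2 ≤ v.1.1} :=
    measurableSet_le (by fun_prop) (by fun_prop)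
  refine Measurable.div (f := fun x : ℝ × ℝ => ∫ t in Set.Iic x.1, condGenerator f x.2 (t ^ 2)) ?_
    hgen.stronglyMeasurable.integral_prod_right'.measurable
  simp only [← integral_indicator measurableSet_Iic]
  exact (hgen.indicator hle).stronglyMeasurable.integral_prod_right'.measurable

theorem measurable_integral_condGenerator (hf : Measurable f) :
    Measurable fun q => ∫ x, condGenerator f q (x ^ 2) :=
  (hf.comp (by fun_prop : Measurable fun v : ℝ × ℝ => v.1 + v.2 ^ 2)
    ).stronglyMeasurable.integral_prod_right'.measurable

theorem condDistFun_nonneg (hf : ∀ t, 0 ≤ t → 0 ≤ f t) {q : ℝ} (hq : 0 ≤ q) (y : ℝ) :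
    0 ≤ condDistFun f q y :=
  div_nonneg (integral_nonneg fun x => hf _ (by positivity))
    (integral_nonneg fun x => hf _ (by positivity))

variable {d : ℕ} {δ : Fin d → ℝ} {Ωbar : Matrix (Fin d) (Fin d) ℝ}
  {S : Type*} [MeasurableSpace S] {P : Measure S} {Ustar : S → EuclideanSpace ℝ (Unit ⊕ Fin d)}

theorem IsElliptical.measurable_marginalDensity
    (hU : IsElliptical P Ustar 0 (starMatrix δ Ωbar) f) :
    Measurable (marginalDensity δ Ωbar f) :=
  ((measurable_ellipticalDensity hU.measurable_generator).comp
    measurable_joinVec).stronglyMeasurable.integral_prod_left'.measurable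

theorem IsElliptical.marginalDensity_nonneg
    (hU : IsElliptical P Ustar 0 (starMatrix δ Ωbar) f) (z : EuclideanSpace ℝ (Fin d)) :
    0 ≤ marginalDensity δ Ωbar f z :=
  integral_nonneg fun _ => ellipticalDensity_nonneg hU.posDef hU.generator_nonneg _

theorem IsElliptical.aemeasurable_skewDensity
    (hU : IsElliptical P Ustar 0 (starMatrix δ Ωbar) f) :
    AEMeasurable fun z : EuclideanSpace ℝ (Fin d) => 2 * marginalDensity δ Ωbar f z *
      condDistFun f (invQuadForm Ωbar z) (shapeParam δ Ωbar ⬝ᵥ z.ofLp) := by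
  have hcond : Measurable fun z : EuclideanSpace ℝ (Fin d) =>
      condDistFun f (invQuadForm Ωbar z) (shapeParam δ Ωbar ⬝ᵥ z.ofLp) := by
    have hquad := (continuous_invQuadForm Ωbar).measurable
    simp only [← inner_toLp]
    exact (measurable_condDistFun hU.measurable_generator).comp
      ((by fun_prop : Measurable fun z : EuclideanSpace ℝ (Fin d) =>
        ⟪WithLp.toLp 2 (shapeParam δ Ωbar), z⟫).prodMk hquad)
  exact ((hU.measurable_marginalDensity.const_mul 2).mul hcond).aemeasurable

variable [IsProbabilityMeasure P]

theorem IsElliptical.marginalDensity_ne_zero_iff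
    (hU : IsElliptical P Ustar 0 (starMatrix δ Ωbar) f) (z : EuclideanSpace ℝ (Fin d)) :
    marginalDensity δ Ωbar f z ≠ 0 ↔ ∫ x, condGenerator f (invQuadForm Ωbar z) (x ^ 2) ≠ 0 := by
  rw [marginalDensity_eq hU.posDef]
  simp [condGenerator, hU.marginalConst_pos.ne']

theorem IsElliptical.hasGaussianLaw_of_condDistFun_ae_eq (hd : 1 ≤ d)
    (hU : IsElliptical P Ustar 0 (starMatrix δ Ωbar) f) {κ : ℝ} (hκ : 0 < κ) {F : ℝ → ℝ}
    (h : ∀ᵐ y, ∀ᵐ q ∂volume.restrict (Set.Ioi (0 : ℝ)), y ^ 2 < κ * q →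
      ∫ x, condGenerator f q (x ^ 2) ≠ 0 → condDistFun f q y = F y) : HasGaussianLaw Ustar P := by
  have : Nontrivial (Unit ⊕ Fin d) := ⟨Sum.inl (), Sum.inr ⟨0, hd⟩, by simp⟩
  have : Nonempty (Fin d) := ⟨⟨0, hd⟩⟩
  have hgen : Measurable fun v : ℝ × ℝ => condGenerator f v.1 (v.2 ^ 2) :=
    hU.measurable_generator.comp (by fun_prop)
  have hint : ∀ᵐ q ∂volume.restrict (Set.Ioi (0 : ℝ)),
      Integrable fun x => condGenerator f q (x ^ 2) :=
    ae_Ioi_of_ae_invQuadForm (posDef_of_starMatrix hU.posDef)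
      (measurableSet_integrable hgen.stronglyMeasurable) hU.ae_integrable_condGenerator
  obtain ⟨a, c, ha, hc, hexp⟩ := ae_eq_exp_of_condDistFun_eq hU.measurable_generator
    hU.generator_nonneg (fun r hr => hU.integrableOn_generator hr) hU.not_ae_eq_zero hint hκ h
  exact hU.hasGaussianLaw_of_generator_eq_exp ha hc hexp

theorem IsElliptical.hasGaussianLaw_of_condDistFun_const (hd : 1 ≤ d)
    (hU : IsElliptical P Ustar 0 (starMatrix δ Ωbar) f) {F : ℝ → ℝ}
    (h : ∀ᵐ z : EuclideanSpace ℝ (Fin d), marginalDensity δ Ωbar f z ≠ 0 →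
      ∀ y, condDistFun f (invQuadForm Ωbar z) y = F y) : HasGaussianLaw Ustar P := by
  have : Nonempty (Fin d) := ⟨⟨0, hd⟩⟩
  have hf := hU.measurable_generator
  refine hU.hasGaussianLaw_of_condDistFun_ae_eq (F := F) hd one_pos (.of_forall fun y => ?_)
  have hmeas : MeasurableSet {q | ∫ x, condGenerator f q (x ^ 2) ≠ 0 → condDistFun f q y = F y} :=
    (measurableSet_eq_fun (measurable_integral_condGenerator hf) measurable_const).compl.imp
      (measurableSet_eq_fun ((measurable_condDistFun hf).comp measurable_prodMk_left)
        measurable_const)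
  filter_upwards [ae_Ioi_of_ae_invQuadForm (posDef_of_starMatrix hU.posDef) hmeas
    (h.mono fun z hz hne => hz ((hU.marginalDensity_ne_zero_iff z).2 hne) y)] with q hq _ using hq

theorem IsElliptical.ae_condDistFun_eq_of_skewLaw_eq
    (hU : IsElliptical P Ustar 0 (starMatrix δ Ωbar) f) {ν : Measure ℝ}
    (h : skewLaw P Ustar = volume.withDensity fun z => ENNReal.ofReal
      (2 * marginalDensity δ Ωbar f z * cdf ν (shapeParam δ Ωbar ⬝ᵥ z.ofLp))) :
    ∀ᵐ z : EuclideanSpace ℝ (Fin d), ∫ x, condGenerator f (invQuadForm Ωbar z) (x ^ 2) ≠ 0 →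
      condDistFun f (invQuadForm Ωbar z) (shapeParam δ Ωbar ⬝ᵥ z.ofLp) =
        cdf ν (shapeParam δ Ωbar ⬝ᵥ z.ofLp) := by
  have hmeas : AEMeasurable fun z : EuclideanSpace ℝ (Fin d) => ENNReal.ofReal
      (2 * marginalDensity δ Ωbar f z * cdf ν (shapeParam δ Ωbar ⬝ᵥ z.ofLp)) := by
    have := hU.measurable_marginalDensity
    have := (monotone_cdf ν).measurable
    simp only [← inner_toLp]
    exact Measurable.aemeasurable (by fun_prop)
  rw [hU.skewLaw_eq, withDensity_eq_iff_of_sigmaFinite hU.aemeasurable_skewDensity.ennreal_ofReal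
    hmeas] at h
  filter_upwards [h] with z hz hne
  have hm := hU.marginalDensity_nonneg z
  have hcond := condDistFun_nonneg hU.generator_nonneg
    (invQuadForm_nonneg (posDef_of_starMatrix hU.posDef) z) (shapeParam δ Ωbar ⬝ᵥ z.ofLp)
  have hcdf := cdf_nonneg ν (shapeParam δ Ωbar ⬝ᵥ z.ofLp)
  rw [ENNReal.ofReal_eq_ofReal_iff (by positivity) (by positivity)] at hz
  exact mul_left_cancel₀ (mul_ne_zero two_ne_zero ((hU.marginalDensity_ne_zero_iff z).2 hne)) hz

theorem IsElliptical.hasGaussianLaw_of_skewLaw_eq (hd : 2 ≤ d) (hδ : δ ≠ 0)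
    (hU : IsElliptical P Ustar 0 (starMatrix δ Ωbar) f) {ν : Measure ℝ}
    (h : skewLaw P Ustar = volume.withDensity fun z => ENNReal.ofReal
      (2 * marginalDensity δ Ωbar f z * cdf ν (shapeParam δ Ωbar ⬝ᵥ z.ofLp))) :
    HasGaussianLaw Ustar P := by
  have hf := hU.measurable_generator
  obtain ⟨T, hT, hae⟩ := exists_standardizingMap (posDef_of_starMatrix hU.posDef)
  obtain ⟨b, hb⟩ := exists_inner_eq_inner_symm T (WithLp.toLp 2 (shapeParam δ Ωbar))
  have hb0 : b ≠ 0 := by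
    rintro rfl
    refine shapeParam_ne_zero hU.posDef hδ ((WithLp.toLp_eq_zero 2).1 ?_)
    exact ext_inner_right ℝ fun z => by simpa using (hb (T z)).symm
  have hmeas : MeasurableSet {x : ℝ × ℝ | ∫ t, condGenerator f x.2 (t ^ 2) ≠ 0 →
      condDistFun f x.2 x.1 = cdf ν x.1} :=
    (measurableSet_eq_fun ((measurable_integral_condGenerator hf).comp measurable_snd)
      measurable_const).compl.imp
      (measurableSet_eq_fun (measurable_condDistFun hf)
        ((monotone_cdf ν).measurable.comp measurable_fst))
  refine hU.hasGaussianLaw_of_condDistFun_ae_eq (F := cdf ν) (by omega)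
    (by positivity : 0 < ‖b‖ ^ 2) (ae_ae_of_ae_inner_norm_sq (p := fun y q =>
      ∫ t, condGenerator f q (t ^ 2) ≠ 0 → condDistFun f q y = cdf ν y) (by simpa) hmeas hb0 ?_)
  filter_upwards [hae _ (hU.ae_condDistFun_eq_of_skewLaw_eq h)] with w hw
  rwa [hT, ← inner_toLp, ← hb] at hw

end Rigidity

section SquareExponentialMoment

open Set

variable {E : Type*} [NormedAddCommGroup E] [MeasurableSpace E]

/-- The exponential moment `∫ exp (l ‖x‖²) dν(x)` of order `l` of the squared norm; the orders at
which it is finite measure the Gaussian decay of the tails of `ν`. -/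
def sqExpMoment (ν : Measure E) (l : ℝ) : ENNReal :=
  ∫⁻ x, ENNReal.ofReal (Real.exp (l * ‖x‖ ^ 2)) ∂ν

theorem sqExpMoment_lt_top_of_nonpos (ν : Measure E) [IsFiniteMeasure ν] {l : ℝ} (hl : l ≤ 0) :
    sqExpMoment ν l < ⊤ := by
  calc sqExpMoment ν l ≤ ∫⁻ _, 1 ∂ν := lintegral_mono fun x => ENNReal.ofReal_le_one.2 <|
        Real.exp_le_one_iff.2 (mul_nonpos_of_nonpos_of_nonneg hl (by positivity))
    _ = ν univ := lintegral_one
    _ < ⊤ := measure_lt_top ν univ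

theorem mul_add_sq_le {l l' : ℝ} (hl : l' < l) (m x : ℝ) :
    l' * (m + x) ^ 2 ≤ l * l' * m ^ 2 / (l - l') + l * x ^ 2 := by
  have hpos : 0 < l - l' := sub_pos.2 hl
  have hid : l * l' * m ^ 2 / (l - l') + l * x ^ 2 - l' * (m + x) ^ 2 =
      (l' * m - (l - l') * x) ^ 2 / (l - l') := by
    field_simp
    ring
  have : 0 ≤ (l' * m - (l - l') * x) ^ 2 / (l - l') := by positivity
  linarith

theorem sqExpMoment_restrict_Ioi_map_add_lt_top {ν : Measure ℝ} [IsFiniteMeasure ν] {l l' : ℝ}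
    (hl : l' < l) (h : sqExpMoment (ν.restrict (Ioi 0)) l < ⊤) (m : ℝ) :
    sqExpMoment ((ν.map (m + ·)).restrict (Ioi 0)) l' < ⊤ := by
  rcases le_or_gt l' 0 with hl' | hl'
  · exact sqExpMoment_lt_top_of_nonpos _ hl'
  set K := ENNReal.ofReal (Real.exp (l * l' * m ^ 2 / (l - l')))
  have hbound : ∀ x ∈ (m + ·) ⁻¹' Ioi 0, ENNReal.ofReal (Real.exp (l' * ‖m + x‖ ^ 2)) ≤
      K * (1 + (Ioi 0).indicator (fun x => ENNReal.ofReal (Real.exp (l * ‖x‖ ^ 2))) x) := by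
    intro x hx
    simp only [Real.norm_eq_abs, sq_abs]
    by_cases hx0 : x ∈ Ioi 0
    · rw [indicator_of_mem hx0, mul_add, ← ENNReal.ofReal_mul (Real.exp_pos _).le, ← Real.exp_add]
      exact le_add_left (ENNReal.ofReal_le_ofReal (Real.exp_le_exp.2 (mul_add_sq_le hl m x)))
    · rw [indicator_of_notMem hx0, add_zero, mul_one]
      refine ENNReal.ofReal_le_ofReal (Real.exp_le_exp.2 ?_)
      have hx1 : 0 < m + x := hx
      have hx2 : x ≤ 0 := not_lt.1 hx0
      calc l' * (m + x) ^ 2 ≤ l' * m ^ 2 := by gcongr; linarith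
        _ ≤ l * l' * m ^ 2 / (l - l') := by simpa using mul_add_sq_le hl m 0
  have hind : Measurable ((Ioi (0 : ℝ)).indicator
      fun x => ENNReal.ofReal (Real.exp (l * ‖x‖ ^ 2))) :=
    Measurable.indicator (by fun_prop) measurableSet_Ioi
  calc sqExpMoment ((ν.map (m + ·)).restrict (Ioi 0)) l'
      = ∫⁻ x in (m + ·) ⁻¹' Ioi 0, ENNReal.ofReal (Real.exp (l' * ‖m + x‖ ^ 2)) ∂ν :=
        setLIntegral_map measurableSet_Ioi (by fun_prop) (by fun_prop)
    _ ≤ ∫⁻ x, K * (1 + (Ioi 0).indicator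
          (fun x => ENNReal.ofReal (Real.exp (l * ‖x‖ ^ 2))) x) ∂ν :=
        (setLIntegral_mono (by fun_prop) hbound).trans
          (setLIntegral_le_lintegral _ _)
    _ = K * (ν univ + sqExpMoment (ν.restrict (Ioi 0)) l) := by
        rw [lintegral_const_mul' _ _ ENNReal.ofReal_ne_top,
          lintegral_add_left measurable_const, lintegral_one, lintegral_indicator measurableSet_Ioi,
          sqExpMoment]
    _ < ⊤ := ENNReal.mul_lt_top ENNReal.ofReal_lt_top (ENNReal.add_lt_top.2 ⟨measure_lt_top _ _, h⟩)

variable [InnerProductSpace ℝ E] [FiniteDimensional ℝ E] [BorelSpace E]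

theorem sqExpMoment_stdGaussian (l : ℝ) : sqExpMoment (stdGaussian E) l =
    ∫⁻ w : E, ENNReal.ofReal ((2 * Real.pi) ^ (-(Module.finrank ℝ E : ℝ) / 2) *
      Real.exp (-(1 / 2 - l) * ‖w‖ ^ 2)) := by
  rw [sqExpMoment, stdGaussian_eq_withDensity, lintegral_withDensity_eq_lintegral_mul _
    (continuous_isotropicGaussianDensity 1).measurable.ennreal_ofReal (by fun_prop)]
  refine lintegral_congr fun w => ?_
  rw [Pi.mul_apply, ← ENNReal.ofReal_mul (isotropicGaussianDensity_pos one_pos w).le,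
    isotropicGaussianDensity, mul_assoc, ← Real.exp_add]
  ring_nf

theorem sqExpMoment_stdGaussian_lt_top_iff [Nontrivial E] {l : ℝ} :
    sqExpMoment (stdGaussian E) l < ⊤ ↔ l < 1 / 2 := by
  rw [sqExpMoment_stdGaussian]
  set k := (2 * Real.pi) ^ (-(Module.finrank ℝ E : ℝ) / 2)
  have hk : 0 < k := by positivity
  constructor
  · contrapose!
    intro hl
    calc (⊤ : ENNReal) = ∫⁻ _ : E, ENNReal.ofReal k := by simp [hk]
      _ ≤ _ := lintegral_mono fun w => ENNReal.ofReal_le_ofReal <| le_mul_of_one_le_right hk.le <|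
          Real.one_le_exp (mul_nonneg (by linarith) (by positivity))
  · intro hl
    have hint := (GaussianFourier.integrable_cexp_neg_mul_sq_norm_add (V := E)
      (b := ((1 / 2 - l : ℝ) : ℂ)) (by simpa using hl) 0 0).re
    have hint' : Integrable fun w : E => k * Real.exp (-(1 / 2 - l) * ‖w‖ ^ 2) := by
      refine (hint.const_mul k).congr (ae_of_all _ fun w => ?_)
      simp only [zero_mul, add_zero]
      norm_cast
    exact (hasFiniteIntegral_iff_ofReal (ae_of_all _ fun w => by positivity)).1 hint'.2

end SquareExponentialMoment

section HalfSpaceProjection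

open scoped RealInnerProductSpace

variable {E : Type*} [NormedAddCommGroup E] [InnerProductSpace ℝ E] {a b : E}

/-- The metric projection of `a` onto the half-space `{w | 0 ≤ ⟪b, w⟫}`, for a unit vector `b`.
Its norm is the supremum of `⟪a, w⟫` over the unit vectors of this half-space, provided it is not
zero. -/
def halfSpaceProj (a b : E) : E := a + max 0 (-⟪a, b⟫) • b

theorem inner_halfSpaceProj_right (hb : ‖b‖ = 1) : ⟪b, halfSpaceProj a b⟫ = max 0 ⟪a, b⟫ := by
  rw [halfSpaceProj, inner_add_right, real_inner_smul_right, real_inner_self_eq_norm_sq, hb,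
    real_inner_comm]
  rcases le_total 0 ⟪a, b⟫ with h | h <;> simp [h]

theorem norm_halfSpaceProj_sq (hb : ‖b‖ = 1) :
    ‖halfSpaceProj a b‖ ^ 2 = ‖a‖ ^ 2 - max 0 (-⟪a, b⟫) ^ 2 := by
  rw [halfSpaceProj, norm_add_sq_real, real_inner_smul_right, norm_smul, hb]
  rcases le_total 0 ⟪a, b⟫ with h | h <;> simp [h]
  ring

theorem inner_halfSpaceProj_left (hb : ‖b‖ = 1) :
    ⟪a, halfSpaceProj a b⟫ = ‖halfSpaceProj a b‖ ^ 2 := by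
  rw [norm_halfSpaceProj_sq hb, halfSpaceProj, inner_add_right, real_inner_smul_right,
    real_inner_self_eq_norm_sq]
  rcases le_total 0 ⟪a, b⟫ with h | h <;> simp [h]
  ring

theorem inner_le_norm_halfSpaceProj_mul_norm {w : E} (hw : 0 ≤ ⟪b, w⟫) :
    ⟪a, w⟫ ≤ ‖halfSpaceProj a b‖ * ‖w‖ := by
  calc ⟪a, w⟫ ≤ ⟪halfSpaceProj a b, w⟫ := by
        rw [halfSpaceProj, inner_add_left, real_inner_smul_left]
        exact le_add_of_nonneg_right (mul_nonneg (le_max_left _ _) hw)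
    _ ≤ _ := real_inner_le_norm _ _

theorem norm_halfSpaceProj_pos (hb : ‖b‖ = 1) (hab : ⟪a, b⟫ ^ 2 < ‖a‖ ^ 2) :
    0 < ‖halfSpaceProj a b‖ := by
  refine (norm_nonneg _).lt_of_ne' fun h0 => ?_
  have h := norm_halfSpaceProj_sq (a := a) hb
  rw [h0] at h
  rcases le_total 0 ⟪a, b⟫ with hs | hs
  · rw [max_eq_left (neg_nonpos.2 hs)] at h
    nlinarith
  · rw [max_eq_right (neg_nonneg.2 hs), neg_sq] at h
    linarith

theorem norm_sq_eq_max_norm_halfSpaceProj_sq (hb : ‖b‖ = 1) :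
    ‖a‖ ^ 2 = max (‖halfSpaceProj a b‖ ^ 2) (‖halfSpaceProj (-a) b‖ ^ 2) := by
  rw [norm_halfSpaceProj_sq hb, norm_halfSpaceProj_sq hb, inner_neg_left, neg_neg, norm_neg]
  rcases le_total 0 ⟪a, b⟫ with h | h <;> simp [h, sq_nonneg]

theorem norm_eq_mul_and_inner_eq_mul_of_norm_halfSpaceProj_sq {a' b' : E} (hb : ‖b‖ = 1)
    (hb' : ‖b'‖ = 1) {κ : ℝ} (hκ : 0 ≤ κ)
    (h : ‖halfSpaceProj a b‖ ^ 2 = κ ^ 2 * ‖halfSpaceProj a' b'‖ ^ 2)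
    (hneg : ‖halfSpaceProj (-a) b‖ ^ 2 = κ ^ 2 * ‖halfSpaceProj (-a') b'‖ ^ 2) :
    ‖a‖ = κ * ‖a'‖ ∧ ⟪a, b⟫ = κ * ⟪a', b'⟫ := by
  have hnorm : ‖a‖ ^ 2 = κ ^ 2 * ‖a'‖ ^ 2 := by
    rw [norm_sq_eq_max_norm_halfSpaceProj_sq hb, h, hneg,
      norm_sq_eq_max_norm_halfSpaceProj_sq (a := a') hb', mul_max_of_nonneg _ _ (sq_nonneg κ)]
  have hsq : ∀ {x y : ℝ}, 0 ≤ x → 0 ≤ y → x ^ 2 = κ ^ 2 * y ^ 2 → x = κ * y := fun hx hy hxy =>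
    (pow_left_inj₀ hx (mul_nonneg hκ hy) two_ne_zero).1 (hxy.trans (mul_pow ..).symm)
  rw [norm_halfSpaceProj_sq hb, norm_halfSpaceProj_sq hb'] at h hneg
  rw [inner_neg_left, inner_neg_left, neg_neg, neg_neg, norm_neg, norm_neg] at hneg
  have hpart := hsq (le_max_left 0 ⟪a, b⟫) (le_max_left 0 ⟪a', b'⟫) (by linarith)
  have hpart_neg := hsq (le_max_left 0 (-⟪a, b⟫)) (le_max_left 0 (-⟪a', b'⟫)) (by linarith)
  refine ⟨hsq (norm_nonneg a) (norm_nonneg a') hnorm, ?_⟩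
  rw [← max_zero_sub_max_neg_zero_eq_self ⟪a, b⟫, ← max_zero_sub_max_neg_zero_eq_self ⟪a', b'⟫,
    max_comm, max_comm _ 0, max_comm _ 0, max_comm _ 0]
  linarith

theorem exists_inner_pos_and_mul_sq_lt (hb : ‖b‖ = 1) (hab : ⟪a, b⟫ ^ 2 < ‖a‖ ^ 2)
    {l l' : ℝ} (hl : l < l' * ‖halfSpaceProj a b‖ ^ 2) :
    ∃ w, 0 < ⟪b, w⟫ ∧ 0 < ⟪a, w⟫ ∧ l * ‖w‖ ^ 2 < l' * ⟪a, w⟫ ^ 2 := by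
  set w₀ := halfSpaceProj a b
  have hpos : 0 < ‖w₀‖ := norm_halfSpaceProj_pos hb hab
  have hinner : ⟪a, w₀⟫ = ‖w₀‖ ^ 2 := inner_halfSpaceProj_left hb
  have ha : ∀ᶠ ε : ℝ in nhds 0, 0 < ⟪a, w₀ + ε • b⟫ :=
    (by fun_prop : Continuous fun ε : ℝ => ⟪a, w₀ + ε • b⟫).continuousAt.eventually_const_lt
      (by simp only [zero_smul, add_zero, hinner]; positivity)
  have hlt : ∀ᶠ ε : ℝ in nhds 0, l * ‖w₀ + ε • b‖ ^ 2 < l' * ⟪a, w₀ + ε • b⟫ ^ 2 := by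
    refine Filter.Tendsto.eventually_lt
      (by fun_prop : Continuous fun ε : ℝ => l * ‖w₀ + ε • b‖ ^ 2).continuousAt
      (by fun_prop : Continuous fun ε : ℝ => l' * ⟪a, w₀ + ε • b⟫ ^ 2).continuousAt ?_
    simp only [zero_smul, add_zero, hinner, sq (‖w₀‖ ^ 2), ← mul_assoc]
    gcongr
  obtain ⟨ε, ⟨ha, hlt⟩, hε⟩ := ((ha.and hlt).filter_mono nhdsWithin_le_nhds).and
    (self_mem_nhdsWithin (s := Set.Ioi 0)) |>.exists
  refine ⟨w₀ + ε • b, ?_, ha, hlt⟩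
  rw [inner_add_right, inner_halfSpaceProj_right hb, real_inner_smul_right,
    real_inner_self_eq_norm_sq, hb]
  have : 0 < ε := hε
  positivity

end HalfSpaceProjection

section HalfSpaceTail

open Set
open scoped RealInnerProductSpace

variable {E : Type*} [NormedAddCommGroup E] [InnerProductSpace ℝ E]
  [MeasurableSpace E] [BorelSpace E] {a b : E} {l l' : ℝ}

/-- The image under `w ↦ ⟪a, w⟫` of the restriction of `μ` to the half-space `0 < ⟪b, w⟫`. It is
not normalised: for a symmetric probability measure its total mass is `1 / 2`. -/
def halfSpaceMarginal (μ : Measure E) (b a : E) : Measure ℝ :=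
  (μ.restrict {w | 0 < ⟪b, w⟫}).map fun w => ⟪a, w⟫

instance (μ : Measure E) [IsFiniteMeasure μ] (b a : E) :
    IsFiniteMeasure (halfSpaceMarginal μ b a) := by
  unfold halfSpaceMarginal
  infer_instance

variable [SecondCountableTopology E]

theorem halfSpaceMarginal_apply (μ : Measure E) (b a : E) {s : Set ℝ} (hs : MeasurableSet s) :
    halfSpaceMarginal μ b a s = μ {w | 0 < ⟪b, w⟫ ∧ ⟪a, w⟫ ∈ s} := by
  rw [halfSpaceMarginal, Measure.map_apply (by fun_prop) hs,
    Measure.restrict_apply' (by measurability), inter_comm]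
  rfl

theorem sqExpMoment_restrict_Ioi_halfSpaceMarginal (μ : Measure E) (b a : E) (l : ℝ) :
    sqExpMoment ((halfSpaceMarginal μ b a).restrict (Ioi 0)) l =
      ∫⁻ w in {w | 0 < ⟪b, w⟫ ∧ 0 < ⟪a, w⟫}, ENNReal.ofReal (Real.exp (l * ⟪a, w⟫ ^ 2)) ∂μ := by
  rw [sqExpMoment, halfSpaceMarginal, setLIntegral_map measurableSet_Ioi (by fun_prop)
    (by fun_prop), Measure.restrict_restrict (measurableSet_Ioi.preimage (by fun_prop)),
    inter_comm]
  simp only [Real.norm_eq_abs, sq_abs]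
  rfl

theorem sqExpMoment_halfSpaceMarginal_le (μ : Measure E) (hl : 0 ≤ l) :
    sqExpMoment ((halfSpaceMarginal μ b a).restrict (Ioi 0)) l ≤
      sqExpMoment μ (l * ‖halfSpaceProj a b‖ ^ 2) := by
  rw [sqExpMoment_restrict_Ioi_halfSpaceMarginal]
  refine (setLIntegral_mono (by fun_prop) fun w hw => ?_).trans (setLIntegral_le_lintegral _ _)
  have ha : 0 < ⟪a, w⟫ := hw.2
  rw [mul_assoc, ← mul_pow]
  gcongr
  exact inner_le_norm_halfSpaceProj_mul_norm (le_of_lt hw.1)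

end HalfSpaceTail

section RadialHalfSpaceTail

open Set
open scoped RealInnerProductSpace

variable {E : Type*} [NormedAddCommGroup E] [InnerProductSpace ℝ E] [FiniteDimensional ℝ E]
  [MeasurableSpace E] [BorelSpace E] {p q : ℝ → ENNReal}

section Cone

variable [Nontrivial E] {K : Set E}

theorem setLIntegral_radialMeasure_cone (hp : Measurable p) (hK : MeasurableSet K)
    (hcone : IsRadialCone K) {h : ℝ → ENNReal} (hh : Measurable h) :
    ∫⁻ w in K, h ‖w‖ ∂radialMeasure E p = (volume : Measure E).toSphere ((↑) ⁻¹' K) *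
      ∫⁻ r : Ioi (0 : ℝ), p r * h r ∂.volumeIoiPow (Module.finrank ℝ E - 1) := by
  rw [radialMeasure, restrict_withDensity hK,
    lintegral_withDensity_eq_lintegral_mul _ (by fun_prop) (by fun_prop),
    ← setLIntegral_cone_fun_norm hK hcone (h := fun r => p r * h r) (by fun_prop)]
  rfl

theorem lintegral_radialMeasure_lt_top_of_setLIntegral_cone (hp : Measurable p) (hK : IsOpen K)
    (hcone : IsRadialCone K) (hne : K.Nonempty) {h : ℝ → ENNReal} (hh : Measurable h)
    (hfin : ∫⁻ w in K, h ‖w‖ ∂radialMeasure E p < ⊤) :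
    ∫⁻ w, h ‖w‖ ∂radialMeasure E p < ⊤ := by
  rw [setLIntegral_radialMeasure_cone hp hK.measurableSet hcone hh] at hfin
  rw [← setLIntegral_univ, setLIntegral_radialMeasure_cone hp .univ isRadialCone_univ hh]
  exact ENNReal.mul_lt_top (measure_lt_top _ _)
    (ENNReal.lt_top_of_mul_ne_top_right hfin.ne (toSphere_preimage_pos hK hcone hne).ne')

theorem radialMeasure_cone_eq_div (hp : Measurable p) [IsProbabilityMeasure (radialMeasure E p)]
    (hK : MeasurableSet K) (hcone : IsRadialCone K) :
    radialMeasure E p K =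
      (volume : Measure E).toSphere ((↑) ⁻¹' K) / (volume : Measure E).toSphere univ := by
  have hpolar : ∀ {C : Set E}, MeasurableSet C → IsRadialCone C →
      radialMeasure E p C = (volume : Measure E).toSphere ((↑) ⁻¹' C) *
        ∫⁻ r : Ioi (0 : ℝ), p r ∂.volumeIoiPow (Module.finrank ℝ E - 1) := by
    intro C hC hC'
    simpa using setLIntegral_radialMeasure_cone hp hC hC' (h := fun _ => 1) (by fun_prop)
  have htotal := hpolar .univ isRadialCone_univ
  rw [measure_univ, preimage_univ, mul_comm] at htotal
  rw [hpolar hK hcone, ENNReal.eq_inv_of_mul_eq_one_left htotal.symm, div_eq_mul_inv]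

end Cone

variable {a b a' b' : E} {l l' m : ℝ}

theorem sqExpMoment_radialMeasure_lt_top (hp : Measurable p) (hb : ‖b‖ = 1)
    (hab : ⟪a, b⟫ ^ 2 < ‖a‖ ^ 2) (hl : l < l' * ‖halfSpaceProj a b‖ ^ 2)
    (h : sqExpMoment ((halfSpaceMarginal (radialMeasure E p) b a).restrict (Ioi 0)) l' < ⊤) :
    sqExpMoment (radialMeasure E p) l < ⊤ := by
  have : Nontrivial E := nontrivial_of_ne b 0 (norm_ne_zero_iff.1 (by simp [hb]))
  set K := {w : E | 0 < ⟪b, w⟫ ∧ 0 < ⟪a, w⟫ ∧ l * ‖w‖ ^ 2 < l' * ⟪a, w⟫ ^ 2} with hK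
  have hopen : IsOpen K := by
    refine IsOpen.and ?_ (IsOpen.and ?_ ?_) <;> exact isOpen_lt (by fun_prop) (by fun_prop)
  have hcone : IsRadialCone K := by
    intro r hr w
    have hscale : l * (r * ‖w‖) ^ 2 < l' * (r * ⟪a, w⟫) ^ 2 ↔ l * ‖w‖ ^ 2 < l' * ⟪a, w⟫ ^ 2 := by
      rw [mul_pow, mul_pow, mul_left_comm, mul_left_comm l', mul_lt_mul_iff_right₀ (by positivity)]
    simp only [hK, mem_ofPred_eq, real_inner_smul_right, norm_smul, Real.norm_of_nonneg hr.le,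
      mul_pos_iff_of_pos_left hr, hscale]
  refine lintegral_radialMeasure_lt_top_of_setLIntegral_cone hp hopen hcone
    (exists_inner_pos_and_mul_sq_lt hb hab hl)
    (h := fun r => ENNReal.ofReal (Real.exp (l * r ^ 2))) (by fun_prop) (lt_of_le_of_lt ?_ h)
  calc ∫⁻ w in K, ENNReal.ofReal (Real.exp (l * ‖w‖ ^ 2)) ∂radialMeasure E p
      ≤ ∫⁻ w in K, ENNReal.ofReal (Real.exp (l' * ⟪a, w⟫ ^ 2)) ∂radialMeasure E p :=
        setLIntegral_mono (by fun_prop) fun w hw =>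
          ENNReal.ofReal_le_ofReal (Real.exp_le_exp.2 hw.2.2.le)
    _ ≤ ∫⁻ w in {w | 0 < ⟪b, w⟫ ∧ 0 < ⟪a, w⟫}, ENNReal.ofReal (Real.exp (l' * ⟪a, w⟫ ^ 2))
          ∂radialMeasure E p := lintegral_mono_set fun w (hw : w ∈ K) => ⟨hw.1, hw.2.1⟩
    _ = _ := (sqExpMoment_restrict_Ioi_halfSpaceMarginal _ _ _ _).symm

theorem sqExpMoment_radialMeasure_lt_top_of_halfSpaceMarginal_eq {μ : Measure E}
    [IsFiniteMeasure μ] [IsFiniteMeasure (radialMeasure E p)] (hp : Measurable p)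
    (hb : ‖b‖ = 1) (hb' : ‖b'‖ = 1) (hab : ⟪a, b⟫ ^ 2 < ‖a‖ ^ 2)
    (hab' : ⟪a', b'⟫ ^ 2 < ‖a'‖ ^ 2)
    (hmap : halfSpaceMarginal (radialMeasure E p) b a =
      (halfSpaceMarginal μ b' a').map (m + ·))
    (hl : l * ‖halfSpaceProj a' b'‖ ^ 2 < l' * ‖halfSpaceProj a b‖ ^ 2)
    (h : sqExpMoment μ l' < ⊤) : sqExpMoment (radialMeasure E p) l < ⊤ := by
  rcases le_or_gt l 0 with hl0 | hl0
  · exact sqExpMoment_lt_top_of_nonpos _ hl0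
  have hρ : 0 < ‖halfSpaceProj a b‖ ^ 2 := by have := norm_halfSpaceProj_pos hb hab; positivity
  have hρ' : 0 < ‖halfSpaceProj a' b'‖ ^ 2 := by
    have := norm_halfSpaceProj_pos hb' hab'
    positivity
  have hl' : 0 < l' := pos_of_mul_pos_left ((mul_pos hl0 hρ').trans hl) hρ.le
  obtain ⟨k, hk, hk'⟩ := exists_between ((div_lt_div_iff₀ hρ hρ').2 hl)
  refine sqExpMoment_radialMeasure_lt_top hp hb hab ((div_lt_iff₀ hρ).1 hk) ?_
  rw [hmap]
  refine sqExpMoment_restrict_Ioi_map_add_lt_top hk' ?_ m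
  refine (sqExpMoment_halfSpaceMarginal_le μ (by positivity)).trans_lt ?_
  rwa [div_mul_cancel₀ _ hρ'.ne']

theorem norm_halfSpaceProj_sq_mul_le {c c' : E} {n : ℝ} [IsFiniteMeasure (radialMeasure E p)]
    (hp : Measurable p) (hb : ‖b‖ = 1) (hb' : ‖b'‖ = 1)
    (hab : ⟪a, b⟫ ^ 2 < ‖a‖ ^ 2) (hab' : ⟪a', b'⟫ ^ 2 < ‖a'‖ ^ 2)
    (hcb : ⟪c, b⟫ ^ 2 < ‖c‖ ^ 2) (hcb' : ⟪c', b'⟫ ^ 2 < ‖c'‖ ^ 2)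
    (hmap : halfSpaceMarginal (radialMeasure E p) b a =
      (halfSpaceMarginal (stdGaussian E) b' a').map (m + ·))
    (hmap' : halfSpaceMarginal (stdGaussian E) b' c' =
      (halfSpaceMarginal (radialMeasure E p) b c).map (n + ·)) :
    ‖halfSpaceProj a b‖ ^ 2 * ‖halfSpaceProj c' b'‖ ^ 2 ≤
      ‖halfSpaceProj c b‖ ^ 2 * ‖halfSpaceProj a' b'‖ ^ 2 := by
  have : Nontrivial E := nontrivial_of_ne b 0 (norm_ne_zero_iff.1 (by simp [hb]))
  have hρa : 0 < ‖halfSpaceProj a b‖ ^ 2 := by have := norm_halfSpaceProj_pos hb hab; positivity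
  have hρa' : 0 < ‖halfSpaceProj a' b'‖ ^ 2 := by
    have := norm_halfSpaceProj_pos hb' hab'
    positivity
  have hρc' : 0 < ‖halfSpaceProj c' b'‖ ^ 2 := by
    have := norm_halfSpaceProj_pos hb' hcb'
    positivity
  by_contra! hlt
  obtain ⟨l, hlc, hla⟩ := exists_between
    (mul_lt_mul_of_pos_left ((div_lt_div_iff₀ hρc' hρa').2 hlt) (by norm_num : (0 : ℝ) < 1 / 2))
  rw [← mul_div_assoc] at hlc hla
  obtain ⟨l₁, hl₁, hhalf⟩ := exists_between ((div_lt_iff₀ hρa).2 ((lt_div_iff₀ hρa').1 hla))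
  have hμ : sqExpMoment (radialMeasure E p) l < ⊤ :=
    sqExpMoment_radialMeasure_lt_top_of_halfSpaceMarginal_eq hp hb hb' hab hab' hmap
      ((div_lt_iff₀ hρa).1 hl₁) (sqExpMoment_stdGaussian_lt_top_iff.2 hhalf)
  obtain ⟨q, hq, hγ⟩ := exists_stdGaussian_eq_radialMeasure (E := E)
  have := hγ ▸ (inferInstance : IsFiniteMeasure (stdGaussian E))
  rw [hγ] at hmap'
  have hcrit := sqExpMoment_radialMeasure_lt_top_of_halfSpaceMarginal_eq hq hb' hb hcb' hcb hmap'
    ((div_lt_iff₀ hρc').1 hlc) hμ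
  rw [← hγ, sqExpMoment_stdGaussian_lt_top_iff] at hcrit
  exact hcrit.false

end RadialHalfSpaceTail

section HalfSpaceMarginalRigidity

open Set
open scoped RealInnerProductSpace

variable {E : Type*} [NormedAddCommGroup E] [InnerProductSpace ℝ E]

theorem exists_linearIsometryEquiv_apply_eq {a b a' b' : E} (ha : ‖a‖ = ‖a'‖) (hb : ‖b‖ = ‖b'‖)
    (hab : ⟪a, b⟫ = ⟪a', b'⟫) : ∃ e : E ≃ₗᵢ[ℝ] E, e a = a' ∧ e b = b' := by
  let r := (ℝ ∙ (b - b'))ᗮ.reflection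
  have hrb : r b = b' := Submodule.reflection_sub hb
  let s := (ℝ ∙ (r a - a'))ᗮ.reflection
  have hsa : s (r a) = a' := Submodule.reflection_sub (by rw [r.norm_map, ha])
  have horth : b' ∈ (ℝ ∙ (r a - a'))ᗮ := by
    rw [Submodule.mem_orthogonal_singleton_iff_inner_right, inner_sub_left, ← hab, ← hrb,
      r.inner_map_map, sub_self]
  refine ⟨r.trans s, hsa, ?_⟩
  rw [LinearIsometryEquiv.trans_apply, hrb]
  exact Submodule.reflection_mem_subspace_eq_self horth

theorem exists_inner_eq_inner_eq {a b : E} (hb : ‖b‖ = 1) (hab : ⟪a, b⟫ ^ 2 < ‖a‖ ^ 2)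
    (x : ℝ) : ∃ w, ⟪b, w⟫ = 1 ∧ ⟪a, w⟫ = x := by
  have hD : ‖a‖ ^ 2 - ⟪a, b⟫ ^ 2 ≠ 0 := (sub_pos.2 hab).ne'
  refine ⟨b + ((x - ⟪a, b⟫) / (‖a‖ ^ 2 - ⟪a, b⟫ ^ 2)) • (a - ⟪a, b⟫ • b), ?_, ?_⟩
  · simp [inner_add_right, inner_sub_right, real_inner_smul_right, hb, real_inner_comm a b]
  · simp only [inner_add_right, inner_sub_right, real_inner_smul_right,
      real_inner_self_eq_norm_sq]
    field_simp
    ring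

variable [MeasurableSpace E] [BorelSpace E]

theorem halfSpaceMarginal_neg [SecondCountableTopology E] (μ : Measure E) (b a : E) :
    halfSpaceMarginal μ b (-a) = (halfSpaceMarginal μ b a).map Neg.neg := by
  rw [halfSpaceMarginal, halfSpaceMarginal, Measure.map_map measurable_neg (by fun_prop)]
  simp only [Function.comp_def, inner_neg_left]

variable [FiniteDimensional ℝ E]

theorem halfSpaceMarginal_add_map_neg {μ : Measure E} (hμ : μ ≪ volume)
    (hneg : MeasurePreserving Neg.neg μ μ) {b : E} (hb : b ≠ 0) (a : E) :
    halfSpaceMarginal μ b a + (halfSpaceMarginal μ b a).map Neg.neg =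
      μ.map fun w => ⟪a, w⟫ := by
  have hmeas : MeasurableSet {w : E | 0 < ⟪b, w⟫} := measurableSet_lt (by fun_prop) (by fun_prop)
  have hcompl : (μ.restrict {w | 0 < ⟪b, w⟫}).map Neg.neg = μ.restrict {w | 0 < ⟪b, w⟫}ᶜ := by
    have hpre : {w : E | 0 < ⟪b, w⟫} = Neg.neg ⁻¹' {w | ⟪b, w⟫ < 0} := by
      ext w
      simp
    rw [hpre, (hneg.restrict_preimage (measurableSet_lt (by fun_prop) (by fun_prop))).map_eq,
      ← hpre]
    refine Measure.restrict_congr_set ?_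
    have hnull : ∀ᵐ w ∂μ, ⟪b, w⟫ ≠ 0 := by
      rw [ae_iff]
      simpa using hμ (volume_inner_eq_zero hb)
    filter_upwards [hnull] with w hw
    refine propext ⟨fun h => not_lt.2 (le_of_lt h), fun h => lt_of_le_of_ne (not_lt.1 h) hw⟩
  rw [halfSpaceMarginal, Measure.map_map measurable_neg (by fun_prop),
    show Neg.neg ∘ (fun w => ⟪a, w⟫) = (fun w => ⟪a, w⟫) ∘ Neg.neg by ext w; simp,
    ← Measure.map_map (by fun_prop) measurable_neg, hcompl, ← Measure.map_add _ _ (by fun_prop),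
    Measure.restrict_add_restrict_compl hmeas]

theorem strictAnti_halfSpaceMarginal_stdGaussian {a b : E} (hb : ‖b‖ = 1)
    (hab : ⟪a, b⟫ ^ 2 < ‖a‖ ^ 2) :
    StrictAnti fun s => halfSpaceMarginal (stdGaussian E) b a (Ioi s) := by
  intro s t hst
  have hpos : halfSpaceMarginal (stdGaussian E) b a (Ioo s t) ≠ 0 := by
    obtain ⟨x, hx⟩ := exists_between hst
    obtain ⟨w, hbw, haw⟩ := exists_inner_eq_inner_eq hb hab x
    have hopen : IsOpen {w : E | 0 < ⟪b, w⟫ ∧ ⟪a, w⟫ ∈ Ioo s t} :=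
      (isOpen_lt (by fun_prop) (by fun_prop)).and (isOpen_Ioo.preimage (by fun_prop))
    have hac : (volume : Measure E) ≪ stdGaussian E := by
      rw [stdGaussian_eq_withDensity]
      exact withDensity_absolutelyContinuous'
        (continuous_isotropicGaussianDensity 1).measurable.ennreal_ofReal.aemeasurable
        (.of_forall fun w => (ENNReal.ofReal_pos.2 (isotropicGaussianDensity_pos one_pos w)).ne')
    rw [halfSpaceMarginal_apply _ _ _ measurableSet_Ioo]
    exact fun h0 => (hopen.measure_pos volume ⟨w, by simp [hbw], by rwa [haw]⟩).ne' (hac h0)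
  calc halfSpaceMarginal (stdGaussian E) b a (Ioi t)
      < halfSpaceMarginal (stdGaussian E) b a (Ioo s t) +
          halfSpaceMarginal (stdGaussian E) b a (Ioi t) := by
        rw [add_comm]
        exact ENNReal.lt_add_right (measure_ne_top _ _) hpos
    _ = halfSpaceMarginal (stdGaussian E) b a (Ioo s t ∪ Ioi t) :=
        (measure_union (Set.disjoint_left.2 fun x hx => not_lt.2 hx.2.le)
          measurableSet_Ioi).symm
    _ ≤ halfSpaceMarginal (stdGaussian E) b a (Ioi s) :=
        measure_mono (union_subset Ioo_subset_Ioi_self (Ioi_subset_Ioi hst.le))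

variable {p : ℝ → ENNReal} {a b a' b' : E} {m : ℝ}

theorem exists_norm_eq_mul_and_inner_eq_mul [IsFiniteMeasure (radialMeasure E p)]
    (hp : Measurable p) (hb : ‖b‖ = 1) (hb' : ‖b'‖ = 1)
    (hab : ⟪a, b⟫ ^ 2 < ‖a‖ ^ 2) (hab' : ⟪a', b'⟫ ^ 2 < ‖a'‖ ^ 2)
    (hmap : halfSpaceMarginal (radialMeasure E p) b a =
      (halfSpaceMarginal (stdGaussian E) b' a').map (m + ·)) :
    ∃ κ, 0 < κ ∧ ‖a‖ = κ * ‖a'‖ ∧ ⟪a, b⟫ = κ * ⟪a', b'⟫ := by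
  have hneg : ∀ {c d : E}, ⟪c, d⟫ ^ 2 < ‖c‖ ^ 2 → ⟪-c, d⟫ ^ 2 < ‖-c‖ ^ 2 := by simp
  have hinv : ∀ {μ ν : Measure ℝ} {x : ℝ}, μ = ν.map (x + ·) → ν = μ.map (-x + ·) := by
    rintro μ ν x rfl
    rw [Measure.map_map (by fun_prop) (by fun_prop)]
    simp [Function.comp_def]
  have hmap_neg : halfSpaceMarginal (radialMeasure E p) b (-a) =
      (halfSpaceMarginal (stdGaussian E) b' (-a')).map (-m + ·) := by
    rw [halfSpaceMarginal_neg, halfSpaceMarginal_neg, hmap,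
      Measure.map_map (by fun_prop) (by fun_prop), Measure.map_map (by fun_prop) (by fun_prop)]
    simp [Function.comp_def, add_comm]
  have hle := norm_halfSpaceProj_sq_mul_le hp hb hb' hab hab' (hneg hab) (hneg hab') hmap
    (hinv hmap_neg)
  have hge := norm_halfSpaceProj_sq_mul_le hp hb hb' (hneg hab) (hneg hab') hab hab' hmap_neg
    (hinv hmap)
  have hρ := norm_halfSpaceProj_pos hb hab
  have hρ' := norm_halfSpaceProj_pos hb' hab'
  set κ := ‖halfSpaceProj a b‖ / ‖halfSpaceProj a' b'‖
  have hκ : 0 < κ := div_pos hρ hρ'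
  refine ⟨κ, hκ, norm_eq_mul_and_inner_eq_mul_of_norm_halfSpaceProj_sq hb hb' hκ.le ?_ ?_⟩
  · rw [← mul_pow, div_mul_cancel₀ _ hρ'.ne']
  · rw [div_pow, div_mul_eq_mul_div, eq_div_iff (by positivity)]
    exact hge.antisymm hle

theorem radialMeasure_quadrant_eq {q : ℝ → ENNReal} (hp : Measurable p) (hq : Measurable q)
    [IsProbabilityMeasure (radialMeasure E p)] [IsProbabilityMeasure (radialMeasure E q)]
    {κ : ℝ} (hκ : 0 < κ) (hb : ‖b‖ = ‖b'‖) (ha : ‖a‖ = κ * ‖a'‖)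
    (hab : ⟪a, b⟫ = κ * ⟪a', b'⟫) :
    radialMeasure E p {w | 0 < ⟪b, w⟫ ∧ 0 < ⟪a, w⟫} =
      radialMeasure E q {w | 0 < ⟪b', w⟫ ∧ 0 < ⟪a', w⟫} := by
  have hmeas : ∀ c d : E, MeasurableSet {w : E | 0 < ⟪c, w⟫ ∧ 0 < ⟪d, w⟫} := fun c d =>
    ((isOpen_lt (by fun_prop) (by fun_prop)).and
      (isOpen_lt (by fun_prop) (by fun_prop))).measurableSet
  obtain ⟨e, hea, heb⟩ := exists_linearIsometryEquiv_apply_eq (a := a) (b := b) (a' := κ • a')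
    (by rw [norm_smul, Real.norm_of_nonneg hκ.le, ha]) hb (by rw [real_inner_smul_left, hab])
  have hpre : e ⁻¹' {w | 0 < ⟪b', w⟫ ∧ 0 < ⟪a', w⟫} = {w | 0 < ⟪b, w⟫ ∧ 0 < ⟪a, w⟫} := by
    ext w
    rw [mem_preimage, mem_ofPred_eq, mem_ofPred_eq, ← e.inner_map_map b w,
      ← e.inner_map_map a w, heb, hea, real_inner_smul_left, mul_pos_iff_of_pos_left hκ]
  have hcone : IsRadialCone {w : E | 0 < ⟪b', w⟫ ∧ 0 < ⟪a', w⟫} := fun r hr w => by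
    simp only [mem_ofPred_eq, real_inner_smul_right, mul_pos_iff_of_pos_left hr]
  rw [← hpre, (measurePreserving_radialMeasure hp e).measure_preimage (hmeas _ _).nullMeasurableSet]
  rcases subsingleton_or_nontrivial E with hE | hE
  · simp [Subsingleton.elim _ (0 : E)]
  · rw [radialMeasure_cone_eq_div hp (hmeas _ _) hcone,
      radialMeasure_cone_eq_div hq (hmeas _ _) hcone]

theorem eq_zero_of_halfSpaceMarginal_eq_map_add [IsProbabilityMeasure (radialMeasure E p)]
    (hp : Measurable p) (hb : ‖b‖ = 1) (hb' : ‖b'‖ = 1)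
    (hab : ⟪a, b⟫ ^ 2 < ‖a‖ ^ 2) (hab' : ⟪a', b'⟫ ^ 2 < ‖a'‖ ^ 2)
    (hmap : halfSpaceMarginal (radialMeasure E p) b a =
      (halfSpaceMarginal (stdGaussian E) b' a').map (m + ·)) : m = 0 := by
  obtain ⟨κ, hκ, hnorm, hinner⟩ :=
    exists_norm_eq_mul_and_inner_eq_mul hp hb hb' hab hab' hmap
  obtain ⟨q, hq, hγ⟩ := exists_stdGaussian_eq_radialMeasure (E := E)
  have : IsProbabilityMeasure (radialMeasure E q) := hγ ▸ inferInstance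
  refine neg_eq_zero.1 ((strictAnti_halfSpaceMarginal_stdGaussian hb' hab').injective ?_)
  calc halfSpaceMarginal (stdGaussian E) b' a' (Ioi (-m))
      = (halfSpaceMarginal (stdGaussian E) b' a').map (m + ·) (Ioi 0) := by
        rw [Measure.map_apply (by fun_prop) measurableSet_Ioi]
        simp
    _ = radialMeasure E p {w | 0 < ⟪b, w⟫ ∧ 0 < ⟪a, w⟫} := by
        rw [← hmap, halfSpaceMarginal_apply _ _ _ measurableSet_Ioi]
        rfl
    _ = stdGaussian E {w | 0 < ⟪b', w⟫ ∧ 0 < ⟪a', w⟫} := by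
        rw [hγ]
        exact radialMeasure_quadrant_eq hp hq hκ (hb.trans hb'.symm) hnorm hinner
    _ = halfSpaceMarginal (stdGaussian E) b' a' (Ioi 0) :=
        (halfSpaceMarginal_apply _ _ _ measurableSet_Ioi).symm

theorem exists_radialMeasure_eq_stdGaussian_map [IsProbabilityMeasure (radialMeasure E p)]
    (hp : Measurable p) (hb : ‖b‖ = 1) (hb' : ‖b'‖ = 1)
    (hab : ⟪a, b⟫ ^ 2 < ‖a‖ ^ 2) (hab' : ⟪a', b'⟫ ^ 2 < ‖a'‖ ^ 2)
    (hmap : halfSpaceMarginal (radialMeasure E p) b a =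
      (halfSpaceMarginal (stdGaussian E) b' a').map (m + ·)) :
    ∃ σ : ℝ, radialMeasure E p = (stdGaussian E).map (σ • ·) := by
  have hm := eq_zero_of_halfSpaceMarginal_eq_map_add hp hb hb' hab hab' hmap
  simp only [hm, zero_add, Measure.map_id'] at hmap
  have ha : a ≠ 0 := by
    rintro rfl
    simp at hab
  have hne : ∀ {c : E}, ‖c‖ = 1 → c ≠ 0 := fun hc => norm_ne_zero_iff.1 (hc.trans_ne one_ne_zero)
  have hneg : ∀ {p : ℝ → ENNReal}, Measurable p →
      MeasurePreserving Neg.neg (radialMeasure E p) (radialMeasure E p) := fun hp =>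
    measurePreserving_radialMeasure hp (LinearIsometryEquiv.neg ℝ)
  obtain ⟨q, hq, hγ⟩ := exists_stdGaussian_eq_radialMeasure (E := E)
  refine ⟨_, radialMeasure_eq_stdGaussian_map hp ha (norm_nonneg a') ?_⟩
  rw [← stdGaussian_map_inner, ← halfSpaceMarginal_add_map_neg
      (radialMeasure_absolutelyContinuous p) (hneg hp) (hne hb), hmap,
    hγ, halfSpaceMarginal_add_map_neg (radialMeasure_absolutelyContinuous q) (hneg hq) (hne hb')]

end HalfSpaceMarginalRigidity

section SkewLawProjection

open scoped RealInnerProductSpace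

theorem inner_sq_lt_norm_sq_of_inner_eq_zero {E : Type*} [NormedAddCommGroup E]
    [InnerProductSpace ℝ E] {a b v : E} (hb : ‖b‖ = 1) (hbv : ⟪b, v⟫ = 0) (hav : ⟪a, v⟫ ≠ 0) :
    ⟪a, b⟫ ^ 2 < ‖a‖ ^ 2 := by
  have hres : ‖a - ⟪a, b⟫ • b‖ ^ 2 = ‖a‖ ^ 2 - ⟪a, b⟫ ^ 2 := by
    rw [norm_sub_sq_real, real_inner_smul_right, norm_smul, hb, mul_one, Real.norm_eq_abs, sq_abs]
    ring
  have hne : a - ⟪a, b⟫ • b ≠ 0 := fun h0 => hav (by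
    rw [sub_eq_zero.1 h0, real_inner_smul_left, hbv, mul_zero])
  have := pow_pos (norm_pos_iff.2 hne) 2
  linarith

variable {d : ℕ} {δ : Fin d → ℝ} {Ωbar : Matrix (Fin d) (Fin d) ℝ} {f : ℝ → ℝ}
  {S : Type*} [MeasurableSpace S] {P : Measure S} {Ustar : S → EuclideanSpace ℝ (Unit ⊕ Fin d)}

theorem inner_joinVec_zero (t : EuclideanSpace ℝ (Fin d)) (y : EuclideanSpace ℝ (Unit ⊕ Fin d)) :
    ⟪joinVec 0 t, y⟫ = ⟪t, vecPart y⟫ := by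
  rw [joinVec, inner_toLp, ← WithLp.toLp_ofLp 2 t, inner_toLp]
  simp [vecPart, dotProduct, Fintype.sum_sum_type]

variable [IsProbabilityMeasure P]

theorem IsElliptical.exists_map_inner_skewLaw (hU : IsElliptical P Ustar 0 (starMatrix δ Ωbar) f)
    {t : EuclideanSpace ℝ (Fin d)} (ht : t ≠ 0) :
    ∃ a b : EuclideanSpace ℝ (Unit ⊕ Fin d), ‖b‖ = 1 ∧ ⟪a, b⟫ ^ 2 < ‖a‖ ^ 2 ∧
      (skewLaw P Ustar).map (⟪t, ·⟫) = (2 : ENNReal) • halfSpaceMarginal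
        (radialMeasure _ (sphericalProfile (Unit ⊕ Fin d) f)) b a := by
  obtain ⟨T, hT, hdet⟩ := exists_norm_sq_eq_invQuadForm hU.posDef
  obtain ⟨a, ha⟩ := exists_inner_eq_inner_symm T (joinVec 0 t)
  obtain ⟨b, hb⟩ := exists_inner_eq_inner_symm T (EuclideanSpace.single (Sum.inl ()) (1 : ℝ))
  have hcoord : ∀ y, ⟪b, T y⟫ = y.ofLp (Sum.inl ()) := fun y => by
    simp [hb, EuclideanSpace.inner_single_left]
  have hb0 : 0 < ‖b‖ := norm_pos_iff.2 (by
    rintro rfl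
    simpa [joinVec] using hcoord (joinVec 1 0))
  have hunit : ∀ w, ⟪‖b‖⁻¹ • b, w⟫ = ‖b‖⁻¹ * ⟪b, w⟫ := fun w => real_inner_smul_left _ _ _
  have hindep : ⟪a, T (joinVec 0 t)⟫ ≠ 0 := by
    rw [ha, T.symm_apply_apply]
    exact inner_self_ne_zero.2 fun h0 => ht (congrArg vecPart h0)
  have hpos : T ⁻¹' {w | 0 < ⟪‖b‖⁻¹ • b, w⟫} = {y | 0 < y.ofLp (Sum.inl ())} := by
    ext y
    simp [hunit, hcoord, hb0]
  have hnorm := norm_smul_inv_norm (𝕜 := ℝ) (norm_pos_iff.1 hb0)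
  refine ⟨a, ‖b‖⁻¹ • b, hnorm,
    inner_sq_lt_norm_sq_of_inner_eq_zero (v := T (joinVec 0 t)) hnorm ?_ hindep, ?_⟩
  · rw [hunit, hcoord]
    exact mul_zero _
  have hvec := measurable_vecPart (d := d)
  rw [skewLaw_eq_map_cond hU.aemeasurable, ProbabilityTheory.cond, hU.measure_pos_eq_half, inv_inv,
    Measure.map_smul, Measure.map_smul, Measure.map_map (by fun_prop) hvec, halfSpaceMarginal,
    ← hU.map_eq_radialMeasure hT hdet, Measure.restrict_map T.continuous.measurable
      (measurableSet_lt measurable_const (by fun_prop)), hpos,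
    Measure.map_map (by fun_prop) T.continuous.measurable]
  congr 2
  ext y
  simp [ha, inner_joinVec_zero]

end SkewLawProjection

section SkewNormalRepresentation

open Matrix

variable {d : ℕ} {A : Matrix (Fin d) (Fin d) ℝ}

theorem starMatrix_posDef_of_schurComplement_pos {δ : Fin d → ℝ} (hA : A.PosDef)
    (hδ : 0 < 1 - δ ⬝ᵥ (A⁻¹ *ᵥ δ)) : (starMatrix δ A).PosDef := by
  have := hA.isUnit.invertible
  have hstar : starMatrix δ A = fromBlocks 1 (replicateRow Unit δ) (replicateRow Unit δ)ᴴ A := by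
    rw [starMatrix, conjTranspose_replicateRow, star_trivial]
  have hschur : (1 : Matrix Unit Unit ℝ) - replicateRow Unit δ * A⁻¹ * (replicateRow Unit δ)ᴴ =
      diagonal fun _ => 1 - δ ⬝ᵥ (A⁻¹ *ᵥ δ) := by
    ext
    rw [dotProduct_mulVec]
    simp [mul_apply, vecMul, dotProduct]
  have hpsd : (starMatrix δ A).PosSemidef := by
    rw [hstar, hA.fromBlocks₂₂, hschur]
    exact .diagonal fun _ => hδ.le
  refine hpsd.posDef_iff_isUnit.2 ?_
  rw [isUnit_iff_isUnit_det, hstar, det_fromBlocks₂₂, invOf_eq_nonsing_inv, hschur, det_diagonal]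
  simpa using ⟨hA.det_pos.ne', hδ.ne'⟩

/-- The vector `δ` for which `starMatrix δ A` has shape parameter `β`. -/
def shapeParamInv (A : Matrix (Fin d) (Fin d) ℝ) (β : Fin d → ℝ) : Fin d → ℝ :=
  (1 / √(1 + β ⬝ᵥ (A *ᵥ β))) • (A *ᵥ β)

theorem schurComplement_shapeParamInv (hA : A.PosDef) (β : Fin d → ℝ) :
    1 - shapeParamInv A β ⬝ᵥ (A⁻¹ *ᵥ shapeParamInv A β) = (1 + β ⬝ᵥ (A *ᵥ β))⁻¹ := by
  have hβ : 0 ≤ β ⬝ᵥ (A *ᵥ β) := hA.posSemidef.dotProduct_mulVec_nonneg β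
  rw [shapeParamInv, mulVec_smul, inv_mulVec_mulVec_of_posDef hA, smul_dotProduct,
    dotProduct_smul, dotProduct_comm (A *ᵥ β), smul_smul, smul_eq_mul, div_mul_div_comm,
    Real.mul_self_sqrt (by positivity)]
  field_simp
  ring

theorem shapeParam_shapeParamInv (hA : A.PosDef) (β : Fin d → ℝ) :
    shapeParam (shapeParamInv A β) A = β := by
  have hβ : 0 ≤ β ⬝ᵥ (A *ᵥ β) := hA.posSemidef.dotProduct_mulVec_nonneg β
  rw [shapeParam, schurComplement_shapeParamInv hA, shapeParamInv, mulVec_smul,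
    inv_mulVec_mulVec_of_posDef hA, smul_smul, Real.sqrt_inv, one_div, inv_inv,
    mul_one_div_cancel (Real.sqrt_pos.2 (by positivity)).ne', one_smul]

theorem starMatrix_shapeParamInv_posDef (hA : A.PosDef) (β : Fin d → ℝ) :
    (starMatrix (shapeParamInv A β) A).PosDef := by
  have hβ : 0 ≤ β ⬝ᵥ (A *ᵥ β) := hA.posSemidef.dotProduct_mulVec_nonneg β
  refine starMatrix_posDef_of_schurComplement_pos hA ?_
  rw [schurComplement_shapeParamInv hA]
  positivity

theorem measurable_skewNormalDensity {ξ : EuclideanSpace ℝ (Fin d)} {α : Fin d → ℝ} :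
    Measurable (skewNormalDensity ξ A α) := by
  have := (continuous_normalDensity (A := A)).measurable
  have := (monotone_cdf (gaussianReal 0 1)).measurable
  unfold skewNormalDensity
  fun_prop

theorem map_add_left_withDensity {E : Type*} [AddGroup E] [MeasurableSpace E] [MeasurableAdd E]
    {μ : Measure E} [μ.IsAddLeftInvariant] {p : E → ENNReal} (hp : Measurable p) (m : E) :
    (μ.withDensity p).map (m + ·) = μ.withDensity fun x => p (-m + x) := by
  ext s hs
  have hadd := measurable_const_add m
  rw [Measure.map_apply hadd hs, withDensity_apply _ (hadd hs), withDensity_apply _ hs,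
    ← (measurePreserving_add_left μ m).setLIntegral_comp_preimage hs (by fun_prop)]
  simp only [neg_add_cancel_left]

theorem isElliptical_id {ι : Type*} [Fintype ι] [DecidableEq ι] {B : Matrix ι ι ℝ} {f : ℝ → ℝ}
    (hB : B.PosDef) (hf : Measurable f) (hf0 : ∀ t, 0 ≤ t → 0 ≤ f t) :
    IsElliptical (volume.withDensity fun y => ENNReal.ofReal (ellipticalDensity 0 B f y))
      id 0 B f where
  posDef := hB
  measurable_generator := hf
  generator_nonneg := hf0
  aemeasurable := aemeasurable_id
  law := Measure.map_id

theorem isProbabilityMeasure_ellipticalDensity {ι : Type*} [Fintype ι] [DecidableEq ι]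
    {B : Matrix ι ι ℝ} {f : ℝ → ℝ} (hB : B.PosDef) (hf : Measurable f)
    (hf0 : ∀ t, 0 ≤ t → 0 ≤ f t) (hint : ∫ w : EuclideanSpace ℝ ι, f (‖w‖ ^ 2) ≠ 0) :
    IsProbabilityMeasure (volume.withDensity fun y : EuclideanSpace ℝ ι =>
      ENNReal.ofReal (ellipticalDensity 0 B f y)) := by
  obtain ⟨T, hT, hdet⟩ := exists_norm_sq_eq_invQuadForm hB
  suffices IsProbabilityMeasure ((volume.withDensity fun y : EuclideanSpace ℝ ι =>
      ENNReal.ofReal (ellipticalDensity 0 B f y)).map T) from Measure.isProbabilityMeasure_of_map T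
  refine ⟨?_⟩
  rw [map_ellipticalDensity hB hf hT hdet, radialMeasure, withDensity_apply _ MeasurableSet.univ,
    Measure.restrict_univ]
  simp only [sphericalProfile]
  rw [← ofReal_integral_eq_lintegral_ofReal ((Integrable.of_integral_ne_zero hint).const_mul _)
    (ae_of_all _ fun w => mul_nonneg (ellipticalConst_nonneg hf0) (hf0 _ (sq_nonneg _))),
    integral_const_mul, ellipticalConst, inv_mul_cancel₀ hint, ENNReal.ofReal_one]

theorem IsElliptical.skewDensity_eq_of_generator_eq_exp {S : Type*} [MeasurableSpace S]
    {P : Measure S} [IsProbabilityMeasure P] {Ustar : S → EuclideanSpace ℝ (Unit ⊕ Fin d)}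
    {δ : Fin d → ℝ}
    (hU : IsElliptical P Ustar 0 (starMatrix δ A) fun t => Real.exp (-(1 / 2) * t))
    (z : EuclideanSpace ℝ (Fin d)) (y : ℝ) :
    2 * marginalDensity δ A (fun t => Real.exp (-(1 / 2) * t)) z *
        condDistFun (fun t => Real.exp (-(1 / 2) * t)) (invQuadForm A z) y =
      2 * normalDensity A z * cdf (gaussianReal 0 1) y := by
  have hexp : ∀ᵐ t ∂volume.restrict (Set.Ioi (0 : ℝ)),
      Real.exp (-(1 / 2) * t) = 1 * Real.exp (-(1 / (2 * 1 ^ 2)) * t) := ae_of_all _ fun t => by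
    rw [one_pow, mul_one, one_mul]
  rw [hU.marginalDensity_eq_normalDensity one_pos one_pos hexp,
    condDistFun_eq_cdf_gaussianReal hU.measurable_generator one_pos one_pos
      (invQuadForm_nonneg (posDef_of_starMatrix hU.posDef) z) hexp,
    one_pow, one_smul, Real.toNNReal_one]

theorem IsSkewNormal.exists_eq_map_skewLaw {μ : Measure (EuclideanSpace ℝ (Fin d))}
    {ξ : EuclideanSpace ℝ (Fin d)} {α : Fin d → ℝ} (h : IsSkewNormal μ ξ A α) :
    ∃ (Q : Measure (EuclideanSpace ℝ (Unit ⊕ Fin d))) (δ : Fin d → ℝ), IsProbabilityMeasure Q ∧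
      IsElliptical Q id 0 (starMatrix δ A) (fun t => Real.exp (-(1 / 2) * t)) ∧
      μ = (skewLaw Q id).map (ξ + ·) := by
  obtain ⟨hA, rfl⟩ := h
  set β : Fin d → ℝ := fun i => α i / √(A i i) with hβ
  set g : ℝ → ℝ := fun t => Real.exp (-(1 / 2) * t) with hg
  have hpd := starMatrix_shapeParamInv_posDef hA β
  have hgm : Measurable g := by fun_prop
  have hg0 : ∀ t, 0 ≤ t → 0 ≤ g t := fun t _ => (Real.exp_pos _).le
  have hQ := isProbabilityMeasure_ellipticalDensity hpd hgm hg0 (by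
    simp only [hg]
    rw [GaussianFourier.integral_rexp_neg_mul_sq_norm (by norm_num)]
    positivity)
  have hell := isElliptical_id hpd hgm hg0
  refine ⟨_, _, hQ, hell, ?_⟩
  have hdens : ∀ z : EuclideanSpace ℝ (Fin d), 2 * marginalDensity (shapeParamInv A β) A g z *
      condDistFun g (invQuadForm A z) (shapeParam (shapeParamInv A β) A ⬝ᵥ z.ofLp) =
        skewNormalDensity 0 A α z := fun z => by
    rw [hell.skewDensity_eq_of_generator_eq_exp, shapeParam_shapeParamInv hA, skewNormalDensity,
      sub_zero, dotProduct]
    simp only [hβ, div_mul_eq_mul_div, mul_div_assoc]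
  simp only [hell.skewLaw_eq, hdens]
  rw [map_add_left_withDensity]
  · simp only [skewNormalDensity, neg_add_eq_sub, sub_zero]
  · exact measurable_skewNormalDensity.ennreal_ofReal

end SkewNormalRepresentation

section SkewNormalRigidity

open scoped RealInnerProductSpace

variable {d : ℕ} {δ : Fin d → ℝ} {Ωbar : Matrix (Fin d) (Fin d) ℝ} {f : ℝ → ℝ}
  {S : Type*} [MeasurableSpace S] {P : Measure S} [IsProbabilityMeasure P]
  {Ustar : S → EuclideanSpace ℝ (Unit ⊕ Fin d)}

theorem IsElliptical.hasGaussianLaw_of_isSkewNormal (hd : 1 ≤ d)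
    (hU : IsElliptical P Ustar 0 (starMatrix δ Ωbar) f) {ξ : EuclideanSpace ℝ (Fin d)}
    {A : Matrix (Fin d) (Fin d) ℝ} {α : Fin d → ℝ} (h : IsSkewNormal (skewLaw P Ustar) ξ A α) :
    HasGaussianLaw Ustar P := by
  obtain ⟨Q, δ', hQ, hV, hshift⟩ := h.exists_eq_map_skewLaw
  have hγ := hV.radialMeasure_eq_of_generator_eq_exp one_pos one_half_pos
    (ae_of_all _ fun t => (one_mul _).symm)
  norm_num only [mul_one_div, one_div_one, Real.sqrt_one, one_smul, Measure.map_id'] at hγ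
  set t : EuclideanSpace ℝ (Fin d) := EuclideanSpace.single ⟨0, hd⟩ 1
  have ht : t ≠ 0 := by simp [t]
  obtain ⟨a, b, hb, hab, hproj⟩ := hU.exists_map_inner_skewLaw ht
  obtain ⟨a', b', hb', hab', hproj'⟩ := hV.exists_map_inner_skewLaw ht
  rw [hγ] at hproj'
  have hmap : halfSpaceMarginal (radialMeasure _ (sphericalProfile (Unit ⊕ Fin d) f)) b a =
      (halfSpaceMarginal (stdGaussian _) b' a').map (⟪t, ξ⟫ + ·) := by
    have htwo : (skewLaw P Ustar).map (⟪t, ·⟫) =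
        ((skewLaw Q id).map (⟪t, ·⟫)).map (⟪t, ξ⟫ + ·) := by
      rw [hshift, Measure.map_map (by fun_prop) (by fun_prop),
        Measure.map_map (by fun_prop) (by fun_prop)]
      congr 1
      ext z
      exact inner_add_right _ _ _
    rw [hproj, hproj', Measure.map_smul] at htwo
    have hhalf := congrArg ((2⁻¹ : ENNReal) • ·) htwo
    simpa [smul_smul, ENNReal.inv_mul_cancel] using hhalf
  have := hU.isProbabilityMeasure_radialMeasure
  obtain ⟨σ, hσ⟩ := exists_radialMeasure_eq_stdGaussian_map
    (measurable_sphericalProfile hU.measurable_generator) hb hb' hab hab' hmap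
  rw [hU.hasGaussianLaw_iff, hσ]
  exact isGaussian_stdGaussian_map_smul σ

end SkewNormalRigidity

end

theorem proposition6 {S : Type*} [MeasurableSpace S] (P : Measure S) [IsProbabilityMeasure P]
    (d : ℕ) (hd : 1 ≤ d) (δ : Fin d → ℝ) (Ωbar : Matrix (Fin d) (Fin d) ℝ)
    (hΩ : IsFullRankCorrelation (starMatrix δ Ωbar)) (f : ℝ → ℝ)
    (Ustar : S → EuclideanSpace ℝ (Unit ⊕ Fin d))
    (hU : IsElliptical P Ustar 0 (starMatrix δ Ωbar) f) :
    -- the skewing argument can be taken to be `w(z) = αᵀ z` iff `U*` is Gaussian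
    (2 ≤ d → δ ≠ 0 →
      ((∃ (ν : Measure ℝ) (w : EuclideanSpace ℝ (Fin d) → ℝ),
          IsSkewingRepresentation P Ustar δ Ωbar f ν w ∧
            ∀ z, w z = shapeParam δ Ωbar ⬝ᵥ z.ofLp) ↔
        HasGaussianLaw Ustar P)) ∧
    -- `Q_z` is absent from the conditional distribution function iff `U*` is Gaussian
    ((∃ ν : Measure ℝ, IsProbabilityMeasure ν ∧
        ∀ᵐ z : EuclideanSpace ℝ (Fin d), marginalDensity δ Ωbar f z ≠ 0 →
          ∀ y, condDistFun f (invQuadForm Ωbar z) y = cdf ν y) ↔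
      HasGaussianLaw Ustar P) ∧
    -- `U*` is Gaussian iff `Z` is skew normal
    List.TFAE [
      HasGaussianLaw Ustar P,
      ∃ σ : ℝ, 0 < σ ∧
        IsSkewNormal (skewLaw P Ustar) 0 (σ ^ 2 • Ωbar) (shapeParam δ Ωbar),
      ∃ (ξ : EuclideanSpace ℝ (Fin d)) (A : Matrix (Fin d) (Fin d) ℝ) (α : Fin d → ℝ),
        IsSkewNormal (skewLaw P Ustar) ξ A α] := by
  refine ⟨fun hd2 hδ => ⟨?_, fun hG => ?_⟩, ⟨?_, fun hG => ?_⟩, ?_⟩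
  · rintro ⟨ν, w, ⟨-, -, hlaw⟩, hw⟩
    simp only [hw] at hlaw
    exact hU.hasGaussianLaw_of_skewLaw_eq hd2 hδ hlaw
  · obtain ⟨ν, hν, hcdf⟩ := hU.exists_condDistFun_eq_cdf hG
    refine ⟨ν, fun z => shapeParam δ Ωbar ⬝ᵥ z.ofLp, ⟨hν, ⟨fun x _ => x, fun _ => rfl⟩, ?_⟩,
      fun _ => rfl⟩
    simp only [hU.skewLaw_eq, hcdf]
  · rintro ⟨ν, -, h⟩
    exact hU.hasGaussianLaw_of_condDistFun_const hd h
  · obtain ⟨ν, hν, hcdf⟩ := hU.exists_condDistFun_eq_cdf hG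
    exact ⟨ν, hν, ae_of_all _ fun z _ => hcdf z⟩
  · tfae_have 1 → 2 := hU.exists_isSkewNormal_of_hasGaussianLaw fun i => hΩ.2 (Sum.inr i)
    tfae_have 2 → 3 := fun ⟨σ, _, h⟩ => ⟨0, σ ^ 2 • Ωbar, shapeParam δ Ωbar, h⟩
    tfae_have 3 → 1 := fun ⟨_, _, _, h⟩ => hU.hasGaussianLaw_of_isSkewNormal hd h
    tfae_finish
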